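/- Let $G$ be a discrete group. Let $\varpi$ be the universal representation of $G$ (the direct sum of all cyclic unitary representations), and let $C^*(G)$ be the norm-closed linear span of $\varpi(G)$. The Fourier--Stieltjes algebra $B(G)$ is the algebra of all matrix coefficients $\pi_{\xi,\eta}(s)=\langle\pi(s)\xi,\eta\rangle$ of unitary representations $\pi$ of $G$, with pointwise operations and norm $\|u\|=\inf\{\|\xi\|\,\|\eta\| : u=\pi_{\xi,\eta}\}$; it carries the operator space structure and the weak* topology of $B(G)=C^*(G)^*$, where $u\in B(G)$ corresponds to the functional with $\varpi(s)\mapsto u(s)$. The Fourier algebra $A(G)$ is the norm closure in $B(G)$ of the span of the matrix coefficients of the left regular representation $\lambda$ on $\ell^2(G)$; $\rho$ denotes the right regular representation. A completely contractive dual Banach algebra $A$ is operator Connes-amenable if every weak*-continuous, completely bounded derivation $D\colon A\to E$ into a normal dual completely bounded $A$-bimodule $E$ is inner; here $E$ is the dual of an operator space, the module actions are jointly completely bounded and weak*-continuous in the variable from $E$, and normality means that $a\mapsto a\cdot x$ and $a\mapsto x\cdot a$ are weak*-continuous for all $x\in E$. The group $G$ has the factorization property if the representation $(s,t)\mapsto\lambda(s)\rho(t)$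 of $G\times G$ on $\ell^2(G)$ extends to a $*$-representation of $C^*(G)\otimes_{\min}C^*(G)$, i.e. if there is a $*$-representation $\Phi$ with $\Phi(\varpi(s)\otimes\varpi(t))=\lambda(s)\rho(t)$ for all $s,t\in G$. 1. If $B$ is a weak*-closed (not necessarily unital) subalgebra of $B(G)$ with $A(G)\subseteq B$, equipped with the inherited operator space structure and weak* topology, and $B$ is operator Connes-amenable, then $G$ has the factorization property. 2. $G$ has the factorization property if and only if the indicator function $1_\Delta$ of the diagonal $\Delta\subseteq G\times G$ extends to a state on $C^*(G)\otimes_{\min}C^*(G)$, i.e. there is a state $\varphi$ with $\varphi(\varpi(s)\otimes\varpi(t))=1_\Delta(s,t)$ for all $s,t\in G$. 3. In particular, if $G$ does not have the factorization property, then $B(G)$ is not operator Connes-amenable. -/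

import Mathlib

open scoped Matrix.Norms.L2Operator TensorProduct InnerProductSpace ComplexOrder Topology

universe u v w

noncomputable section

/-! ### Operator spaces -/

/-- A choice of a number `matNorm x` for every square matrix `x` over `V` (indexed by an
arbitrary finite type): the data of an operator space structure. Scalar matrices always carry
the operator norm on `ℓ²`. -/
class MatrixNorms (V : Type*) where
  matNorm : ∀ {ι : Type} [Fintype ι] [DecidableEq ι], Matrix ι ι V → ℝ

open MatrixNorms (matNorm)

/-- Ruan's axioms for an abstract operator space structure on a normed space `V`. Together they
imply that every `matNorm` is a norm; `M₁(V)` carries the given norm of `V`. -/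
class IsOperatorSpace (V : Type*) [NormedAddCommGroup V] [NormedSpace ℂ V] [MatrixNorms V] :
    Prop where
  matNorm_add_le : ∀ {ι : Type} [Fintype ι] [DecidableEq ι] (x y : Matrix ι ι V),
    matNorm (x + y) ≤ matNorm x + matNorm y
  matNorm_smul : ∀ {ι : Type} [Fintype ι] [DecidableEq ι] (c : ℂ) (x : Matrix ι ι V),
    matNorm (c • x) = ‖c‖ * matNorm x
  matNorm_one_by_one : ∀ v : V, matNorm (Matrix.of fun _ _ : Unit => v) = ‖v‖
  /-- `‖α x β‖ ≤ ‖α‖ ‖x‖ ‖β‖` for (rectangular) scalar matrices `α`, `β`. -/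
  matNorm_mul_mul_le : ∀ {ι κ : Type} [Fintype ι] [DecidableEq ι] [Fintype κ] [DecidableEq κ]
    (α : Matrix κ ι ℂ) (x : Matrix ι ι V) (β : Matrix ι κ ℂ),
    matNorm (Matrix.of fun k l => ∑ i, ∑ j, (α k i * β j l) • x i j) ≤ ‖α‖ * matNorm x * ‖β‖
  /-- `‖x ⊕ y‖ = max ‖x‖ ‖y‖`. -/
  matNorm_fromBlocks : ∀ {ι κ : Type} [Fintype ι] [DecidableEq ι] [Fintype κ] [DecidableEq κ]
    (x : Matrix ι ι V) (y : Matrix κ κ V),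
    matNorm (Matrix.fromBlocks x 0 0 y) = max (matNorm x) (matNorm y)

/-- The dual operator space structure: `M_ι(V*)` is normed as the space of completely bounded
maps `V → M_ι(ℂ)`, i.e. `[φ i j]` gets the completely bounded norm of `x ↦ [φ i j x]`. -/
instance instMatrixNormsStrongDual (V : Type*) [NormedAddCommGroup V] [NormedSpace ℂ V]
    [MatrixNorms V] : MatrixNorms (StrongDual ℂ V) where
  matNorm {ι} _ _ φ := sInf {C : ℝ | 0 ≤ C ∧ ∀ (n : ℕ) (x : Matrix (Fin n) (Fin n) V),
    ‖(Matrix.of fun p q : ι × Fin n => φ p.1 q.1 (x p.2 q.2) :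
      Matrix (ι × Fin n) (ι × Fin n) ℂ)‖ ≤ C * matNorm x}

/-- The weak* topology `σ(V*, V)` on the dual of `V`. -/
@[reducible] def weakStar (V : Type*) [NormedAddCommGroup V] [NormedSpace ℂ V] :
    TopologicalSpace (StrongDual ℂ V) :=
  TopologicalSpace.induced (fun φ => StrongDual.toWeakDual φ) inferInstance

/-- Complete boundedness of a linear map. -/
def IsCompletelyBounded {V W : Type*} [AddCommGroup V] [Module ℂ V] [AddCommGroup W] [Module ℂ W]
    [MatrixNorms V] [MatrixNorms W] (f : V →ₗ[ℂ] W) : Prop :=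
  ∃ C : ℝ, ∀ (n : ℕ) (x : Matrix (Fin n) (Fin n) V), matNorm (x.map f) ≤ C * matNorm x

/-- (Joint) complete boundedness of a bilinear map `V × W → X`, i.e. complete boundedness of its
linearization on the operator space projective tensor product of `V` and `W`. -/
def IsJointlyCompletelyBounded {V W X : Type*} [AddCommGroup V] [Module ℂ V]
    [AddCommGroup W] [Module ℂ W] [AddCommGroup X] [Module ℂ X]
    [MatrixNorms V] [MatrixNorms W] [MatrixNorms X] (f : V →ₗ[ℂ] W →ₗ[ℂ] X) : Prop :=
  ∃ C : ℝ, ∀ (m n : ℕ) (x : Matrix (Fin m) (Fin m) V) (y : Matrix (Fin n) (Fin n) W),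
    matNorm (Matrix.of fun p q : Fin m × Fin n => f (x p.1 q.1) (y p.2 q.2))
      ≤ C * matNorm x * matNorm y

/-! ### Operator Connes-amenability -/

/-- A dual completely bounded `A`-bimodule: the dual `F*` of an operator space `F` with jointly
completely bounded, commuting left and right actions of `A` such that every `a` acts from either
side by a weak*-continuous map. -/
structure DualOperatorBimodule (A : Type*) [NonUnitalRing A] [Module ℂ A] [MatrixNorms A]
    (F : Type*) [NormedAddCommGroup F] [NormedSpace ℂ F] [MatrixNorms F] where
  /-- `left a x = a · x` -/
  left : A →ₗ[ℂ] StrongDual ℂ F →ₗ[ℂ] StrongDual ℂ F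
  /-- `right a x = x · a` -/
  right : A →ₗ[ℂ] StrongDual ℂ F →ₗ[ℂ] StrongDual ℂ F
  left_mul : ∀ a b x, left (a * b) x = left a (left b x)
  right_mul : ∀ a b x, right (a * b) x = right b (right a x)
  left_right : ∀ a b x, left a (right b x) = right b (left a x)
  left_cb : IsJointlyCompletelyBounded left
  right_cb : IsJointlyCompletelyBounded right
  left_weakStar : ∀ a, Continuous[weakStar F, weakStar F] (left a)
  right_weakStar : ∀ a, Continuous[weakStar F, weakStar F] (right a)

/-- The bimodule is normal: for every `x` the maps `a ↦ a · x` and `a ↦ x · a` are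
weak*-continuous, where `τ` is the weak* topology of `A`. -/
def DualOperatorBimodule.IsNormal {A : Type*} [NonUnitalRing A] [Module ℂ A] [MatrixNorms A]
    (τ : TopologicalSpace A)
    {F : Type*} [NormedAddCommGroup F] [NormedSpace ℂ F] [MatrixNorms F]
    (E : DualOperatorBimodule A F) : Prop :=
  ∀ x, Continuous[τ, weakStar F] (fun a => E.left a x) ∧
    Continuous[τ, weakStar F] (fun a => E.right a x)

/-- Operator Connes-amenability of a completely contractive dual Banach algebra `A`, which enters
through its algebra structure, its matrix norms and its weak* topology `τ`: every weak*-continuous,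
completely bounded derivation from `A` into a normal dual completely bounded `A`-bimodule is
inner. -/
def OperatorConnesAmenable (A : Type v) [NonUnitalRing A] [Module ℂ A] [MatrixNorms A]
    (τ : TopologicalSpace A) : Prop :=
  ∀ (F : Type w) [NormedAddCommGroup F] [NormedSpace ℂ F] [CompleteSpace F] [MatrixNorms F]
    [IsOperatorSpace F] (E : DualOperatorBimodule A F), E.IsNormal τ →
    ∀ D : A →ₗ[ℂ] StrongDual ℂ F,
      (∀ a b, D (a * b) = E.left a (D b) + E.right b (D a)) →
      IsCompletelyBounded D → Continuous[τ, weakStar F] D →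
      ∃ x : StrongDual ℂ F, ∀ a, D a = E.left a x - E.right a x

/-! ### Concrete operator algebras -/

section Concrete

variable {H : Type*} [NormedAddCommGroup H] [InnerProductSpace ℂ H]
variable {K : Type*} [NormedAddCommGroup K] [InnerProductSpace ℂ K]

/-- The operator on the Hilbert space `H^ι` given by a matrix of operators on `H`. -/
def opMatrix {ι : Type*} [Fintype ι] (a : Matrix ι ι (H →L[ℂ] H)) :
    PiLp 2 (fun _ : ι => H) →L[ℂ] PiLp 2 (fun _ : ι => H) :=
  ((PiLp.continuousLinearEquiv 2 ℂ fun _ : ι => H).symm.toContinuousLinearMap).comp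
    ((ContinuousLinearMap.pi fun i => ∑ j, (a i j).comp (ContinuousLinearMap.proj j)).comp
      (PiLp.continuousLinearEquiv 2 ℂ fun _ : ι => H).toContinuousLinearMap)

variable [CompleteSpace H] in
/-- The operator space structure of a concrete C*-algebra `A ⊆ B(H)`: `M_ι(A) ⊆ B(H^ι)`. -/
instance instMatrixNormsStarSubalgebra (A : StarSubalgebra ℂ (H →L[ℂ] H)) : MatrixNorms A where
  matNorm x := ‖opMatrix (x.map fun a => (a : H →L[ℂ] H))‖

variable (H K) in
/-- The Hilbert space tensor product. -/
def HilbertTensor : Type _ := UniformSpace.Completion (H ⊗[ℂ] K)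

instance : NormedAddCommGroup (HilbertTensor H K) :=
  inferInstanceAs (NormedAddCommGroup (UniformSpace.Completion (H ⊗[ℂ] K)))

instance : InnerProductSpace ℂ (HilbertTensor H K) :=
  inferInstanceAs (InnerProductSpace ℂ (UniformSpace.Completion (H ⊗[ℂ] K)))

instance : CompleteSpace (HilbertTensor H K) :=
  inferInstanceAs (CompleteSpace (UniformSpace.Completion (H ⊗[ℂ] K)))

variable (H K) in
/-- The canonical isometric embedding of the algebraic tensor product. -/
def HilbertTensor.incl : H ⊗[ℂ] K →ₗᵢ[ℂ] HilbertTensor H K :=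
  UniformSpace.Completion.toComplₗᵢ

theorem HilbertTensor.denseRange_incl : DenseRange (HilbertTensor.incl H K) :=
  UniformSpace.Completion.denseRange_coe

/-- The operator `a ⊗ b` on the Hilbert space tensor product. -/
def opTensor (a : H →L[ℂ] H) (b : K →L[ℂ] K) : HilbertTensor H K →L[ℂ] HilbertTensor H K :=
  (TensorProduct.mapL a b).completion

theorem opTensor_incl (a : H →L[ℂ] H) (b : K →L[ℂ] K) (x : H ⊗[ℂ] K) :
    opTensor a b (HilbertTensor.incl H K x)
      = HilbertTensor.incl H K (TensorProduct.mapL a b x) :=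
  ContinuousLinearMap.completion_apply_coe (TensorProduct.mapL a b) x

variable [CompleteSpace H] [CompleteSpace K]

/-- The minimal (spatial) tensor product of two concrete C*-algebras: the C*-algebra on the
Hilbert space tensor product generated by the elementary tensors `a ⊗ b`. -/
def minTensor (A : StarSubalgebra ℂ (H →L[ℂ] H)) (B : StarSubalgebra ℂ (K →L[ℂ] K)) :
    StarSubalgebra ℂ (HilbertTensor H K →L[ℂ] HilbertTensor H K) :=
  (StarAlgebra.adjoin ℂ {T | ∃ a ∈ A, ∃ b ∈ B, T = opTensor a b}).topologicalClosure

/-- The elementary tensor `a ⊗ b` in the minimal tensor product. -/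
def minTmul {A : StarSubalgebra ℂ (H →L[ℂ] H)} {B : StarSubalgebra ℂ (K →L[ℂ] K)}
    (a : A) (b : B) : minTensor A B :=
  ⟨opTensor a b, StarSubalgebra.le_topologicalClosure _
    (StarAlgebra.subset_adjoin ℂ _ ⟨a, a.2, b, b.2, rfl⟩)⟩

/-- A state: a positive linear functional of norm one. -/
def IsState {A : StarSubalgebra ℂ (H →L[ℂ] H)} (φ : StrongDual ℂ A) : Prop :=
  (∀ a : A, 0 ≤ φ (star a * a)) ∧ ‖φ‖ = 1

end Concrete

/-! ### Unitary representations of a discrete group -/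

/-- A unitary representation of the discrete group `G` on `H`. -/
abbrev UnitaryRep (G : Type*) [Group G] (H : Type*) [NormedAddCommGroup H]
    [InnerProductSpace ℂ H] : Type _ := G →* (H ≃ₗᵢ[ℂ] H)

section Reps

variable {G : Type*} [Group G]
variable {H : Type*} [NormedAddCommGroup H] [InnerProductSpace ℂ H]
variable {K : Type*} [NormedAddCommGroup K] [InnerProductSpace ℂ K]

/-- `π(s)` as a bounded operator. -/
def UnitaryRep.op (π : UnitaryRep G H) (s : G) : H →L[ℂ] H :=
  (π s).toContinuousLinearEquiv.toContinuousLinearMap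

@[simp]
theorem UnitaryRep.op_apply (π : UnitaryRep G H) (s : G) (x : H) : UnitaryRep.op π s x = π s x :=
  rfl

/-- The matrix coefficient `s ↦ ⟨π(s) ξ, η⟩`; Mathlib's inner product is linear in the second
variable. -/
def UnitaryRep.coeff (π : UnitaryRep G H) (ξ η : H) (s : G) : ℂ := ⟪η, π s ξ⟫_ℂ

/-- A group homomorphism into the isometric bounded operators is a unitary representation. -/
def UnitaryRep.ofIsometric (f : G →* (H →L[ℂ] H)) (hf : ∀ s x, ‖f s x‖ = ‖x‖) :
    UnitaryRep G H where
  toFun s :=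
    { toFun := f s
      map_add' := map_add (f s)
      map_smul' := map_smul (f s)
      invFun := f s⁻¹
      left_inv := fun x => by
        rw [← mul_apply_eq_comp, ← map_mul]; simp
      right_inv := fun x => by
        rw [← mul_apply_eq_comp, ← map_mul]; simp
      norm_map' := hf s }
  map_one' := by ext x; simp
  map_mul' s t := by ext x; simp

@[simp]
theorem UnitaryRep.ofIsometric_apply (f : G →* (H →L[ℂ] H)) (hf : ∀ s x, ‖f s x‖ = ‖x‖)
    (s : G) (x : H) : UnitaryRep.ofIsometric f hf s x = f s x := rfl

/-- The Hilbert space direct sum of a family of unitary representations. -/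
def UnitaryRep.hilbertSum {I : Type*} {E : I → Type*} [∀ i, NormedAddCommGroup (E i)]
    [∀ i, InnerProductSpace ℂ (E i)] (π : ∀ i, UnitaryRep G (E i)) :
    UnitaryRep G (lp E 2) :=
  UnitaryRep.ofIsometric
    { toFun := fun s => lp.mapCLM 2 (fun i => UnitaryRep.op (π i) s) zero_le_one fun i =>
        ContinuousLinearMap.opNorm_le_bound _ zero_le_one fun x => by simp
      map_one' := by ext x i; simp
      map_mul' := fun s t => by ext x i; simp }
    (fun s x => by
      rw [lp.norm_eq_tsum_rpow (by simp), lp.norm_eq_tsum_rpow (by simp)]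
      simp)

/-- The concrete C*-algebra generated by a unitary representation. -/
def UnitaryRep.cstar [CompleteSpace H] (π : UnitaryRep G H) : StarSubalgebra ℂ (H →L[ℂ] H) :=
  (StarAlgebra.adjoin ℂ (Set.range (UnitaryRep.op π))).topologicalClosure

/-- `π(s)` as an element of the C*-algebra generated by `π`. -/
def UnitaryRep.cstarOf [CompleteSpace H] (π : UnitaryRep G H) (s : G) : UnitaryRep.cstar π :=
  ⟨UnitaryRep.op π s, StarSubalgebra.le_topologicalClosure _
    (StarAlgebra.subset_adjoin ℂ _ ⟨s, rfl⟩)⟩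

/-- The direct sum of two unitary representations. -/
def UnitaryRep.prod (π : UnitaryRep G H) (σ : UnitaryRep G K) : UnitaryRep G (WithLp 2 (H × K)) :=
  UnitaryRep.ofIsometric
    { toFun := fun s =>
        ((WithLp.prodContinuousLinearEquiv 2 ℂ H K).symm.toContinuousLinearMap).comp
          (((UnitaryRep.op π s).prodMap (UnitaryRep.op σ s)).comp
            (WithLp.prodContinuousLinearEquiv 2 ℂ H K).toContinuousLinearMap)
      map_one' := by
        ext x
        exact WithLp.ofLp_injective 2 (Prod.ext (by simp) (by simp))
      map_mul' := fun s t => by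
        ext x
        exact WithLp.ofLp_injective 2 (Prod.ext (by simp) (by simp)) }
    (fun s x => by simp [WithLp.prod_norm_eq_of_L2])

theorem UnitaryRep.prod_coeff (π : UnitaryRep G H) (σ : UnitaryRep G K) (ξ η : H) (ξ' η' : K)
    (s : G) :
    UnitaryRep.coeff (UnitaryRep.prod π σ) (WithLp.toLp 2 (ξ, ξ')) (WithLp.toLp 2 (η, η')) s
      = UnitaryRep.coeff π ξ η s + UnitaryRep.coeff σ ξ' η' s := by
  simp [UnitaryRep.coeff, UnitaryRep.prod, WithLp.prod_inner_apply]

/-- The (inner) tensor product of two unitary representations. -/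
def UnitaryRep.tensor (π : UnitaryRep G H)
    (σ : UnitaryRep G K) : UnitaryRep G (HilbertTensor H K) :=
  UnitaryRep.ofIsometric
    { toFun := fun s => opTensor (UnitaryRep.op π s) (UnitaryRep.op σ s)
      map_one' := by
        refine ContinuousLinearMap.coeFn_injective ?_
        refine HilbertTensor.denseRange_incl.equalizer (by fun_prop) (by fun_prop) ?_
        funext x
        have h : TensorProduct.mapL (UnitaryRep.op π 1) (UnitaryRep.op σ 1)
            = ContinuousLinearMap.id ℂ (H ⊗[ℂ] K) := by
          rw [← TensorProduct.mapL_id_id]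
          congr 1 <;> ext x <;> simp
        simp only [Function.comp_apply, opTensor_incl, h]
        rfl
      map_mul' := fun s t => by
        refine ContinuousLinearMap.coeFn_injective ?_
        refine HilbertTensor.denseRange_incl.equalizer (by fun_prop) (by fun_prop) ?_
        funext x
        have h : TensorProduct.mapL (UnitaryRep.op π (s * t)) (UnitaryRep.op σ (s * t))
            = TensorProduct.mapL (UnitaryRep.op π s) (UnitaryRep.op σ s)
              * TensorProduct.mapL (UnitaryRep.op π t) (UnitaryRep.op σ t) := by
          rw [← TensorProduct.mapL_mul]
          congr 1 <;> ext x <;> simp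
        simp only [Function.comp_apply, mul_apply_eq_comp, opTensor_incl, h] }
    (fun s x => by
      refine HilbertTensor.denseRange_incl.induction_on x
        (isClosed_eq (by fun_prop) (by fun_prop)) fun x => ?_
      simp only [MonoidHom.coe_mk, OneHom.coe_mk, opTensor_incl,
        LinearIsometry.norm_map]
      rw [TensorProduct.mapL_apply]
      exact TensorProduct.norm_map (π s).toLinearIsometry (σ s).toLinearIsometry x)

theorem UnitaryRep.tensor_coeff (π : UnitaryRep G H)
    (σ : UnitaryRep G K) (ξ η : H) (ξ' η' : K) (s : G) :
    UnitaryRep.coeff (UnitaryRep.tensor π σ) (HilbertTensor.incl H K (ξ ⊗ₜ[ℂ] ξ'))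
      (HilbertTensor.incl H K (η ⊗ₜ[ℂ] η')) s
      = UnitaryRep.coeff π ξ η s * UnitaryRep.coeff σ ξ' η' s := by
  simp only [UnitaryRep.coeff, UnitaryRep.tensor, UnitaryRep.ofIsometric_apply,
    MonoidHom.coe_mk, OneHom.coe_mk, opTensor_incl, LinearIsometry.inner_map_map]
  simp

/-- The restriction of a unitary representation to an invariant subspace. -/
def UnitaryRep.sub (π : UnitaryRep G H) (M : Submodule ℂ H) (hM : ∀ s, ∀ x ∈ M, π s x ∈ M) :
    UnitaryRep G M :=
  UnitaryRep.ofIsometric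
    { toFun := fun s => ((UnitaryRep.op π s).comp M.subtypeL).codRestrict M fun x => hM s x x.2
      map_one' := ContinuousLinearMap.ext fun x => Subtype.ext (by
        change π 1 (x : H) = x
        simp)
      map_mul' := fun s t => ContinuousLinearMap.ext fun x => Subtype.ext (by
        change π (s * t) (x : H) = π s (π t x)
        simp) }
    (fun s x => (π s).norm_map x)

@[simp]
theorem UnitaryRep.coe_sub_apply (π : UnitaryRep G H) (M : Submodule ℂ H)
    (hM : ∀ s, ∀ x ∈ M, π s x ∈ M) (s : G) (x : M) :
    (UnitaryRep.sub π M hM s x : H) = π s x := rfl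

/-- `ξ` is a cyclic vector for `π`: the linear span of its orbit is dense. -/
def UnitaryRep.IsCyclicVector (π : UnitaryRep G H) (ξ : H) : Prop :=
  (Submodule.span ℂ (Set.range fun s => π s ξ)).topologicalClosure = ⊤

/-- The closed linear span of the orbit of `ξ`. -/
def UnitaryRep.cyclicSubspace (π : UnitaryRep G H) (ξ : H) : Submodule ℂ H :=
  (Submodule.span ℂ (Set.range fun s => π s ξ)).topologicalClosure

theorem UnitaryRep.self_mem_cyclicSubspace (π : UnitaryRep G H) (ξ : H) :
    ξ ∈ UnitaryRep.cyclicSubspace π ξ :=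
  Submodule.le_topologicalClosure _ (Submodule.subset_span ⟨1, by simp⟩)

theorem UnitaryRep.cyclicSubspace_invariant (π : UnitaryRep G H) (ξ : H) (s : G) :
    ∀ x ∈ UnitaryRep.cyclicSubspace π ξ, π s x ∈ UnitaryRep.cyclicSubspace π ξ := by
  intro x hx
  refine map_mem_closure (π s).continuous hx fun y hy => ?_
  induction hy using Submodule.span_induction with
  | mem y hy =>
    obtain ⟨t, rfl⟩ := hy
    exact Submodule.subset_span ⟨s * t, by simp⟩
  | zero => simp
  | add y z _ _ hy hz => simpa using add_mem hy hz
  | smul c y _ hy => simpa using Submodule.smul_mem _ c hy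

theorem UnitaryRep.isCyclicVector_sub (π : UnitaryRep G H) (ξ : H) :
    UnitaryRep.IsCyclicVector
      (UnitaryRep.sub π (UnitaryRep.cyclicSubspace π ξ) (UnitaryRep.cyclicSubspace_invariant π ξ))
      ⟨ξ, UnitaryRep.self_mem_cyclicSubspace π ξ⟩ := by
  refine eq_top_iff.2 fun x _ => ?_
  refine closure_subtype.2 ?_
  have hx : (x : H) ∈ closure (Submodule.span ℂ (Set.range fun s => π s ξ) : Set H) := x.2
  refine closure_mono (fun y hy => ?_) hx
  have := Submodule.map_span (UnitaryRep.cyclicSubspace π ξ).subtype (Set.range fun s =>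
    UnitaryRep.sub π (UnitaryRep.cyclicSubspace π ξ) (UnitaryRep.cyclicSubspace_invariant π ξ) s
      ⟨ξ, UnitaryRep.self_mem_cyclicSubspace π ξ⟩)
  rw [← Set.range_comp] at this
  have hy' : y ∈ Submodule.map (UnitaryRep.cyclicSubspace π ξ).subtype _ := this ▸ hy
  exact hy'


end Reps

section Group

variable (G : Type u) [Group G]

/-- A cyclic unitary representation of `G` on a Hilbert space. -/
structure CyclicRep : Type (u + 1) where
  /-- the underlying Hilbert space -/
  carrier : Type u
  [normed : NormedAddCommGroup carrier]
  [inner : InnerProductSpace ℂ carrier]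
  [complete : CompleteSpace carrier]
  /-- the representation -/
  rep : UnitaryRep G carrier
  cyclic : ∃ ξ, UnitaryRep.IsCyclicVector rep ξ

attribute [instance] CyclicRep.normed CyclicRep.inner CyclicRep.complete

/-- The universal representation of `G`: the direct sum of all its cyclic representations. -/
def universalRep : UnitaryRep G (lp (fun σ : CyclicRep G => σ.carrier) 2) :=
  UnitaryRep.hilbertSum fun σ : CyclicRep G => σ.rep

/-- The full group C*-algebra `C*(G)`. -/
abbrev fullCStar := UnitaryRep.cstar (universalRep G)

/-- The canonical image `ϖ(s)` of `s ∈ G` in `C*(G)`. -/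
abbrev fullCStarOf (s : G) : fullCStar G := UnitaryRep.cstarOf (universalRep G) s

/-! ### The Fourier-Stieltjes algebra and the Fourier algebra -/

variable {G} in
/-- `f` is the coefficient `π_{ξ,η}` of some unitary representation, and `r = ‖ξ‖ ‖η‖`. -/
def IsCoeffWithNorm (f : G → ℂ) (r : ℝ) : Prop :=
  ∃ (H : Type u) (_ : NormedAddCommGroup H) (_ : InnerProductSpace ℂ H) (_ : CompleteSpace H)
    (π : UnitaryRep G H) (ξ η : H), f = UnitaryRep.coeff π ξ η ∧ r = ‖ξ‖ * ‖η‖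

/-- The Fourier-Stieltjes algebra `B(G)`: all matrix coefficients of unitary representations,
with pointwise operations. -/
def fourierStieltjes : Subalgebra ℂ (G → ℂ) where
  carrier := {f | ∃ r, IsCoeffWithNorm f r}
  mul_mem' := by
    rintro _ _ ⟨_, H, _, _, _, π, ξ, η, rfl, _⟩ ⟨_, K, _, _, _, σ, ξ', η', rfl, _⟩
    exact ⟨_, HilbertTensor H K, inferInstance, inferInstance, inferInstance,
      UnitaryRep.tensor π σ, HilbertTensor.incl H K (ξ ⊗ₜ[ℂ] ξ'),
      HilbertTensor.incl H K (η ⊗ₜ[ℂ] η'),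
      funext fun s => (UnitaryRep.tensor_coeff π σ ξ η ξ' η' s).symm, rfl⟩
  add_mem' := by
    rintro _ _ ⟨_, H, _, _, _, π, ξ, η, rfl, _⟩ ⟨_, K, _, _, _, σ, ξ', η', rfl, _⟩
    exact ⟨_, WithLp 2 (H × K), inferInstance, inferInstance, inferInstance,
      UnitaryRep.prod π σ, WithLp.toLp 2 (ξ, ξ'), WithLp.toLp 2 (η, η'),
      funext fun s => (UnitaryRep.prod_coeff π σ ξ η ξ' η' s).symm, rfl⟩
  algebraMap_mem' c :=
    ⟨_, EuclideanSpace ℂ PUnit.{u + 1}, inferInstance, inferInstance, inferInstance, 1,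
      EuclideanSpace.single PUnit.unit c, EuclideanSpace.single PUnit.unit 1,
      by ext s; simp [UnitaryRep.coeff, EuclideanSpace.inner_single_left], rfl⟩

variable {G}

/-- The norm of `B(G)`: the infimum of `‖ξ‖ ‖η‖` over all `π`, `ξ`, `η` with `f = π_{ξ,η}`. -/
def fsNorm (f : fourierStieltjes G) : ℝ := sInf {r | IsCoeffWithNorm (f : G → ℂ) r}

/-- Every `f ∈ B(G)` defines a bounded functional on `C*(G)` with `ϖ(s) ↦ f(s)`; there is exactly
one because the `ϖ(s)` span a dense subspace. -/
theorem exists_functional (f : fourierStieltjes G) :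
    ∃ φ : StrongDual ℂ (fullCStar G), ∀ s, φ (fullCStarOf G s) = (f : G → ℂ) s := by
  classical
  obtain ⟨f, _, H, _, _, _, π, ξ, η, rfl, _⟩ := f
  let M := UnitaryRep.cyclicSubspace π ξ
  have : CompleteSpace M := (Submodule.isClosed_topologicalClosure _).completeSpace_coe
  let σ : CyclicRep G := ⟨M, UnitaryRep.sub π M (UnitaryRep.cyclicSubspace_invariant π ξ), _,
    UnitaryRep.isCyclicVector_sub π ξ⟩
  let ξ' : M := ⟨ξ, UnitaryRep.self_mem_cyclicSubspace π ξ⟩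
  let η' : M := M.orthogonalProjectionOnto η
  let x : lp (fun σ : CyclicRep G => σ.carrier) 2 := lp.single 2 σ ξ'
  let y : lp (fun σ : CyclicRep G => σ.carrier) 2 := lp.single 2 σ η'
  refine ⟨((innerSL ℂ y).comp (ContinuousLinearMap.apply ℂ _ x)).comp
    (fullCStar G).toSubalgebra.toSubmodule.subtypeL, fun s => ?_⟩
  change ⟪y, universalRep G s x⟫_ℂ = ⟪η, π s ξ⟫_ℂ
  rw [lp.inner_single_left]
  have h : (universalRep G s x) σ = σ.rep s ξ' := by
    change σ.rep s (x σ) = _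
    simp [x]
  rw [h]
  exact Submodule.inner_orthogonalProjectionOnto_eq_of_mem_right (σ.rep s ξ') η


/-- The pairing of `B(G)` with `C*(G)`, which identifies `B(G)` with the dual of `C*(G)`. -/
def fsToDual (f : fourierStieltjes G) : StrongDual ℂ (fullCStar G) :=
  (exists_functional f).choose

theorem fsToDual_apply (f : fourierStieltjes G) (s : G) :
    fsToDual f (fullCStarOf G s) = (f : G → ℂ) s :=
  (exists_functional f).choose_spec s

/-- The operator space structure of `B(G)` as the dual of `C*(G)`. -/
instance instMatrixNormsFS : MatrixNorms (fourierStieltjes G) where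
  matNorm x := matNorm (x.map fsToDual)

/-- A subalgebra of `B(G)` carries the inherited operator space structure. -/
instance instMatrixNormsFSSub (B : NonUnitalSubalgebra ℂ (fourierStieltjes G)) :
    MatrixNorms B where
  matNorm x := matNorm (x.map fun b => (b : fourierStieltjes G))

variable (G) in
/-- The weak* topology `σ(B(G), C*(G))`. -/
@[reducible] def fsWeakStar : TopologicalSpace (fourierStieltjes G) :=
  TopologicalSpace.induced fsToDual (weakStar (fullCStar G))

/-- The weak* topology of a subalgebra `B` of `B(G)`, inherited from `B(G)`. If `B` is
weak*-closed, this is the weak* topology given by the predual `C*(G) / B_⊥`. -/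
@[reducible] def fsSubWeakStar (B : NonUnitalSubalgebra ℂ (fourierStieltjes G)) :
    TopologicalSpace B :=
  TopologicalSpace.induced (fun b => (b : fourierStieltjes G)) (fsWeakStar G)

variable (G)

variable {G} in
/-- The operator `f ↦ f ∘ e` on `ℓ²(G)`. -/
def lpComp (e : Equiv.Perm G) : lp (fun _ : G => ℂ) 2 →ₗᵢ[ℂ] lp (fun _ : G => ℂ) 2 where
  toFun f := ⟨fun x => f (e x), by
    have h := (memℓp_gen_iff (by simp)).1 (lp.memℓp f)
    exact (memℓp_gen_iff (by simp)).2 (e.summable_iff.2 h)⟩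
  map_add' f g := rfl
  map_smul' c f := rfl
  norm_map' f := by
    rw [lp.norm_eq_tsum_rpow (by simp), lp.norm_eq_tsum_rpow (by simp)]
    congr 1
    exact e.tsum_eq fun x => ‖f x‖ ^ (2 : ENNReal).toReal

/-- The left regular representation `(λ(s) f)(x) = f(s⁻¹ x)` on `ℓ²(G)`. -/
def leftRegular : UnitaryRep G (lp (fun _ : G => ℂ) 2) :=
  UnitaryRep.ofIsometric
    { toFun := fun s => (lpComp (Equiv.mulLeft s⁻¹)).toContinuousLinearMap
      map_one' := by ext f x; simp [lpComp]
      map_mul' := fun s t => by ext f x; simp [lpComp, mul_assoc] }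
    (fun s f => (lpComp (Equiv.mulLeft s⁻¹)).norm_map f)

/-- The right regular representation `(ρ(t) f)(x) = f(x t)` on `ℓ²(G)`. -/
def rightRegular : UnitaryRep G (lp (fun _ : G => ℂ) 2) :=
  UnitaryRep.ofIsometric
    { toFun := fun t => (lpComp (Equiv.mulRight t)).toContinuousLinearMap
      map_one' := by ext f x; simp [lpComp]
      map_mul' := fun s t => by ext f x; simp [lpComp, mul_assoc] }
    (fun t f => (lpComp (Equiv.mulRight t)).norm_map f)

/-- The Fourier algebra `A(G)`: the norm closure in `B(G)` of the linear span of the coefficients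
of the left regular representation. -/
def fourierAlgebra : Set (fourierStieltjes G) :=
  {f | ∀ ε > 0, ∃ g ∈ Submodule.span ℂ {g : fourierStieltjes G |
      ∃ ξ η, (g : G → ℂ) = UnitaryRep.coeff (leftRegular G) ξ η}, fsNorm (f - g) < ε}

/-! ### The factorization property -/

/-- `C*(G) ⊗_min C*(G)`. -/
abbrev minSquare := minTensor (fullCStar G) (fullCStar G)

/-- The factorization property: the representation `(s, t) ↦ λ(s) ρ(t)` of `G × G` on `ℓ²(G)`
extends to a *-representation of `C*(G) ⊗_min C*(G)`. -/
def FactorizationProperty : Prop :=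
  ∃ Φ : minSquare G →⋆ₐ[ℂ] (lp (fun _ : G => ℂ) 2 →L[ℂ] lp (fun _ : G => ℂ) 2),
    ∀ s t : G, Φ (minTmul (fullCStarOf G s) (fullCStarOf G t)) =
      UnitaryRep.op (leftRegular G) s * UnitaryRep.op (rightRegular G) t

open Classical in
/-- The indicator function `1_Δ` of the diagonal subgroup of `G × G` extends to a state on
`C*(G) ⊗_min C*(G)`. -/
def DiagonalExtendsToState : Prop :=
  ∃ φ : StrongDual ℂ (minSquare G), IsState φ ∧
    ∀ s t : G, φ (minTmul (fullCStarOf G s) (fullCStarOf G t)) = if s = t then 1 else 0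

end Group

end

/-! Write V = C*(G) ⊗_min C*(G) and e(s,t) = ϖ(s) ⊗ ϖ(t). The algebra B(G) acts on V through either
leg: L_u multiplies e(s,t) by u(s), and R_u multiplies it by u(t). The two actions commute and agree
on W, the closed span of the e(s,s). The trivial representation gives a functional M₀ on V with
value 1 at every e(s,t). Each M₀ ∘ (L_u - R_u) vanishes on W, so u ↦ M₀ ∘ (L_u - R_u) is a
derivation into the dual bimodule (V/W)* = W^⊥. Amenability implements it by some N in W^⊥, and M =
M₀ - N satisfies M ∘ L_u = M ∘ R_u while keeping the value 1 at e(s,s)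
(`OperatorConnesAmenable.exists_balanced`). Hence u(s) M(e(s,t)) = u(t) M(e(s,t)). Since the algebra
contains A(G), u may be the point mass at s, which forces M(e(s,t)) = 0 for s ≠ t. So 1_Δ extends to
a bounded functional on V (`OperatorConnesAmenable.exists_diagonal`).

For amenability to apply, the actions must be completely contractive and normal. Complete
contractivity (`matNorm_minAct_le`) rests on two facts: a tensor product of unitary representations
is again a unitary representation, hence dominated by ϖ, and compressing an operator on H ⊗ K along
orthonormal vectors of K turns the second leg into scalar coefficients. Normality holds because u ↦
ψ(u · v) is evaluation of u at an element of C*(G) (`exists_fsToDual_eq_minAct`).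

Finally, 1_Δ is the coefficient of (s,t) ↦ λ(s)ρ(t) at the cyclic vector δ₁. A bounded functional
extending it is therefore automatically positive, and the GNS estimate bounds λρ by the minimal
tensor norm (`factorizationProperty_of_functional`). Conversely, the vector state of δ₁ in an
extension of λρ extends 1_Δ. -/

open MatrixNorms (matNorm)

/-! ### Matrices of operators -/

section OpMatrix

variable {H : Type*} [NormedAddCommGroup H] [InnerProductSpace ℂ H]
variable {ι κ : Type*} [Fintype ι] [Fintype κ]

/-- Finitely many vectors span a finite-dimensional space. This reduces estimates for matrices of
operators to estimates for scalar matrices, which is the form in which norms of functionals are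
available. -/
theorem exists_orthonormal_coords {ι : Type*} [Finite ι] (X : ι → H) :
    ∃ (N : ℕ) (f : Fin N → H), Orthonormal ℂ f ∧
      ∃ c : ι → Fin N → ℂ, ∀ i, X i = ∑ n, c i n • f n := by
  let M := Submodule.span ℂ (Set.range X)
  have : FiniteDimensional ℂ M := FiniteDimensional.span_of_finite ℂ (Set.finite_range X)
  let b := stdOrthonormalBasis ℂ M
  refine ⟨_, fun n => (b n : H), b.orthonormal.comp_linearIsometry M.subtypeₗᵢ,
    fun i n => b.repr ⟨X i, Submodule.subset_span ⟨i, rfl⟩⟩ n, fun i => ?_⟩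
  have := congrArg (fun x : M => (x : H)) (b.sum_repr ⟨X i, Submodule.subset_span ⟨i, rfl⟩⟩)
  simpa using this.symm

theorem Orthonormal.norm_sq_sum_smul {f : κ → H} (hf : Orthonormal ℂ f) (c : κ → ℂ) :
    ‖∑ n, c n • f n‖ ^ 2 = ∑ n, ‖c n‖ ^ 2 := by
  have h := hf.inner_sum c c Finset.univ
  rw [inner_self_eq_norm_sq_to_K] at h
  have h2 : ((‖∑ n, c n • f n‖ ^ 2 : ℝ) : ℂ) = ((∑ n, ‖c n‖ ^ 2 : ℝ) : ℂ) := by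
    push_cast
    rw [← Complex.coe_algebraMap] at *
    rw [h]
    refine Finset.sum_congr rfl fun n _ => ?_
    rw [RCLike.conj_mul]
  exact_mod_cast h2

theorem opMatrix_apply (a : Matrix ι ι (H →L[ℂ] H)) (X : PiLp 2 fun _ : ι => H) (i : ι) :
    opMatrix a X i = ∑ j, a i j (X j) := by
  simp [opMatrix]

theorem inner_opMatrix (a : Matrix ι ι (H →L[ℂ] H)) (X Y : PiLp 2 fun _ : ι => H) :
    ⟪Y, opMatrix a X⟫_ℂ = ∑ i, ∑ j, ⟪Y i, a i j (X j)⟫_ℂ := by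
  simp [PiLp.inner_apply, opMatrix_apply, inner_sum]

/-- Take y = T x. Norm bounds are proved through sesquilinear forms throughout, because tensoring,
slicing and reindexing only rearrange the sums in the form. -/
theorem opNorm_le_of_inner_le {H₁ H₂ : Type*} [NormedAddCommGroup H₁] [InnerProductSpace ℂ H₁]
    [NormedAddCommGroup H₂] [InnerProductSpace ℂ H₂] (T : H₁ →L[ℂ] H₂) {C : ℝ} (hC : 0 ≤ C)
    (h : ∀ x y, ‖⟪y, T x⟫_ℂ‖ ≤ C * ‖x‖ * ‖y‖) : ‖T‖ ≤ C := by
  refine T.opNorm_le_bound hC fun x => ?_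
  have h1 := h x (T x)
  rw [inner_self_eq_norm_sq_to_K, norm_pow, RCLike.norm_ofReal, abs_norm] at h1
  rcases (norm_nonneg (T x)).eq_or_lt with h0 | h0
  · rw [← h0]; positivity
  · nlinarith

theorem norm_opMatrix_le (a : Matrix ι ι (H →L[ℂ] H)) {C : ℝ} (hC : 0 ≤ C)
    (h : ∀ X Y : PiLp 2 fun _ : ι => H,
      ‖∑ i, ∑ j, ⟪Y i, a i j (X j)⟫_ℂ‖ ≤ C * ‖X‖ * ‖Y‖) : ‖opMatrix a‖ ≤ C :=
  opNorm_le_of_inner_le _ hC fun X Y => by rw [inner_opMatrix]; exact h X Y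

theorem norm_sum_inner_le (a : Matrix ι ι (H →L[ℂ] H)) (X Y : PiLp 2 fun _ : ι => H) :
    ‖∑ i, ∑ j, ⟪Y i, a i j (X j)⟫_ℂ‖ ≤ ‖opMatrix a‖ * ‖X‖ * ‖Y‖ := by
  rw [← inner_opMatrix]
  refine (norm_inner_le_norm _ _).trans ?_
  rw [mul_comm]
  gcongr
  exact (opMatrix a).le_opNorm X

theorem opMatrix_add (a b : Matrix ι ι (H →L[ℂ] H)) :
    opMatrix (a + b) = opMatrix a + opMatrix b := by
  ext X i; simp [opMatrix_apply, Finset.sum_add_distrib]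

theorem opMatrix_smul (c : ℂ) (a : Matrix ι ι (H →L[ℂ] H)) :
    opMatrix (c • a) = c • opMatrix a := by
  ext X i; simp [opMatrix_apply, Finset.smul_sum]

theorem opMatrix_mul (a b : Matrix ι ι (H →L[ℂ] H)) :
    opMatrix (a * b) = opMatrix a * opMatrix b := by
  ext X i
  simp only [opMatrix_apply, Matrix.mul_apply, map_sum,
    sum_apply, mul_apply_eq_comp]
  exact Finset.sum_comm

theorem opMatrix_apply_single [DecidableEq ι] (a : Matrix ι ι (H →L[ℂ] H)) (i j : ι) (x : H) :
    opMatrix a (PiLp.single 2 j x) i = a i j x := by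
  rw [opMatrix_apply, Finset.sum_eq_single j] <;> simp +contextual

theorem opMatrix_injective :
    Function.Injective (opMatrix : Matrix ι ι (H →L[ℂ] H) → _) := by
  classical
  intro a b h
  ext i j x
  rw [← opMatrix_apply_single a, h, opMatrix_apply_single]

theorem norm_entry_le_norm_opMatrix (a : Matrix ι ι (H →L[ℂ] H)) (i j : ι) :
    ‖a i j‖ ≤ ‖opMatrix a‖ := by
  classical
  refine ContinuousLinearMap.opNorm_le_bound _ (opMatrix a).opNorm_nonneg fun x => ?_
  rw [← opMatrix_apply_single a]
  refine (PiLp.norm_apply_le _ i).trans (((opMatrix a).le_opNorm _).trans ?_)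
  simp

theorem norm_opMatrix_le_sum (a : Matrix ι ι (H →L[ℂ] H)) :
    ‖opMatrix a‖ ≤ ∑ i, ∑ j, ‖a i j‖ := by
  refine norm_opMatrix_le a (by positivity) fun X Y => ?_
  rw [Finset.sum_mul, Finset.sum_mul]
  refine (norm_sum_le _ _).trans (Finset.sum_le_sum fun i _ => ?_)
  rw [Finset.sum_mul, Finset.sum_mul]
  refine (norm_sum_le _ _).trans (Finset.sum_le_sum fun j _ => ?_)
  refine (norm_inner_le_norm _ _).trans ?_
  rw [mul_comm]
  gcongr
  · exact ((a i j).le_opNorm _).trans (by gcongr; exact PiLp.norm_apply_le _ _)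
  · exact PiLp.norm_apply_le _ _

theorem opMatrix_star [CompleteSpace H] (a : Matrix ι ι (H →L[ℂ] H)) :
    opMatrix a.conjTranspose = star (opMatrix a) := by
  rw [ContinuousLinearMap.star_eq_adjoint, ContinuousLinearMap.eq_adjoint_iff]
  intro X Y
  rw [inner_opMatrix, ← inner_conj_symm, inner_opMatrix, map_sum, Finset.sum_comm]
  refine Finset.sum_congr rfl fun i _ => ?_
  rw [map_sum]
  refine Finset.sum_congr rfl fun j _ => ?_
  rw [inner_conj_symm, Matrix.conjTranspose_apply, ContinuousLinearMap.star_eq_adjoint,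
    ContinuousLinearMap.adjoint_inner_left]

/-! ### Scalar matrices -/

theorem scalarMatrix_norm_le [DecidableEq ι] [DecidableEq κ] (M : Matrix ι κ ℂ) {C : ℝ}
    (hC : 0 ≤ C)
    (h : ∀ (x : EuclideanSpace ℂ κ) (y : EuclideanSpace ℂ ι),
      ‖∑ i, ∑ j, star (y i) * M i j * x j‖ ≤ C * ‖x‖ * ‖y‖) : ‖M‖ ≤ C := by
  rw [Matrix.l2_opNorm_def]
  refine opNorm_le_of_inner_le _ hC fun x y => ?_
  convert h x y using 2
  simp [PiLp.inner_apply, Matrix.mulVec, dotProduct, Finset.sum_mul, Matrix.toEuclideanLin]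
  refine Finset.sum_congr rfl fun i _ => Finset.sum_congr rfl fun j _ => by ring

theorem norm_sum_scalarMatrix_le [DecidableEq ι] [DecidableEq κ] (M : Matrix ι κ ℂ)
    (x : EuclideanSpace ℂ κ) (y : EuclideanSpace ℂ ι) :
    ‖∑ i, ∑ j, star (y i) * M i j * x j‖ ≤ ‖M‖ * ‖x‖ * ‖y‖ := by
  have h : ∑ i, ∑ j, star (y i) * M i j * x j
      = ⟪y, (EuclideanSpace.equiv ι ℂ).symm (M.mulVec x)⟫_ℂ := by
    simp [PiLp.inner_apply, Matrix.mulVec, dotProduct, Finset.sum_mul]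
    refine Finset.sum_congr rfl fun i _ => Finset.sum_congr rfl fun j _ => by ring
  rw [h]
  refine (norm_inner_le_norm _ _).trans ?_
  rw [mul_comm]
  gcongr
  exact M.l2_opNorm_mulVec x

/-- In orthonormal coordinates M ⊗ 1 decouples: it acts as M on the coefficient vector of each basis
vector, and the squared norms add up. -/
theorem norm_scalarMatrix_smul_le [DecidableEq ι] [DecidableEq κ] (M : Matrix ι κ ℂ)
    (X : PiLp 2 fun _ : κ => H) :
    ‖(WithLp.toLp 2 fun i => ∑ j, M i j • X j : PiLp 2 fun _ : ι => H)‖ ≤ ‖M‖ * ‖X‖ := by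
  obtain ⟨N, f, hf, c, hc⟩ := exists_orthonormal_coords X
  refine le_of_sq_le_sq ?_ (by positivity)
  rw [mul_pow, PiLp.norm_sq_eq_of_L2, PiLp.norm_sq_eq_of_L2]
  have h1 : ∀ i, ∑ j, M i j • X j = ∑ n, (∑ j, M i j * c j n) • f n := fun i => by
    simp_rw [hc, Finset.smul_sum, Finset.sum_smul, smul_smul]
    exact Finset.sum_comm
  simp_rw [h1, hc, hf.norm_sq_sum_smul]
  rw [Finset.sum_comm, Finset.sum_comm (s := (Finset.univ : Finset κ)), Finset.mul_sum]
  refine Finset.sum_le_sum fun n _ => ?_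
  have h2 := M.l2_opNorm_mulVec (WithLp.toLp 2 fun j => c j n)
  have h3 := pow_le_pow_left₀ (norm_nonneg _) h2 2
  rw [mul_pow, EuclideanSpace.norm_sq_eq, EuclideanSpace.norm_sq_eq] at h3
  simpa [Matrix.mulVec, dotProduct] using h3

/-- The columns are distinct standard basis vectors, so the matrix is an isometry and the
C*-identity applies. Compression by such matrices passes to submatrices in every operator space. -/
theorem norm_submatrix_one_le [DecidableEq ι] [DecidableEq κ] {f : κ → ι}
    (hf : Function.Injective f) : ‖((1 : Matrix ι ι ℂ).submatrix id f)‖ ≤ 1 := by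
  have h := Matrix.l2_opNorm_conjTranspose_mul_self ((1 : Matrix ι ι ℂ).submatrix id f)
  have h1 : ((1 : Matrix ι ι ℂ).submatrix id f).conjTranspose * (1 : Matrix ι ι ℂ).submatrix id f
      = 1 := by
    ext i j
    simp [Matrix.mul_apply, Matrix.one_apply, hf.eq_iff, eq_comm]
  rw [h1] at h
  -- Only an inequality, since the norm is 0 when `κ` is empty.
  have h2 : ‖(1 : Matrix κ κ ℂ)‖ ≤ 1 := by
    refine scalarMatrix_norm_le _ zero_le_one fun x y => ?_
    have : ∑ i, ∑ j, star (y i) * (1 : Matrix κ κ ℂ) i j * x j = ⟪y, x⟫_ℂ := by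
      simp [PiLp.inner_apply, Matrix.one_apply, mul_comm]
    rw [this, one_mul, mul_comm]
    exact norm_inner_le_norm _ _
  nlinarith [norm_nonneg ((1 : Matrix ι ι ℂ).submatrix id f)]

end OpMatrix

/-! ### Abstract operator spaces -/

section ScalarNorms

variable {ι κ : Type*} [Fintype ι] [DecidableEq ι] [Fintype κ] [DecidableEq κ]

theorem norm_col_le (x : EuclideanSpace ℂ ι) :
    ‖(Matrix.of fun i (_ : Unit) => x i : Matrix ι Unit ℂ)‖ ≤ ‖x‖ := by
  refine scalarMatrix_norm_le _ (norm_nonneg _) fun c y => ?_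
  have : ∑ i, ∑ j, star (y i) * (Matrix.of fun i (_ : Unit) => x i : Matrix ι Unit ℂ) i j * c j
      = ⟪y, x⟫_ℂ * c () := by
    simp [PiLp.inner_apply, Finset.mul_sum, mul_comm]
  rw [this, norm_mul]
  have h1 : ‖c ()‖ ≤ ‖c‖ := PiLp.norm_apply_le c ()
  calc ‖⟪y, x⟫_ℂ‖ * ‖c ()‖ ≤ (‖y‖ * ‖x‖) * ‖c‖ := by
        gcongr; exact norm_inner_le_norm _ _
    _ = _ := by ring

theorem norm_row_le (y : EuclideanSpace ℂ ι) :
    ‖(Matrix.of fun (_ : Unit) i => star (y i) : Matrix Unit ι ℂ)‖ ≤ ‖y‖ := by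
  have h : (Matrix.of fun (_ : Unit) i => star (y i) : Matrix Unit ι ℂ)
      = (Matrix.of fun i (_ : Unit) => y i : Matrix ι Unit ℂ).conjTranspose := rfl
  rw [h, Matrix.l2_opNorm_conjTranspose]
  exact norm_col_le y

theorem norm_submatrix_one_le' {f : κ → ι} (hf : Function.Injective f) :
    ‖((1 : Matrix ι ι ℂ).submatrix f id)‖ ≤ 1 := by
  have h : (1 : Matrix ι ι ℂ).submatrix f id
      = ((1 : Matrix ι ι ℂ).submatrix id f).conjTranspose := by
    ext i j; simp [Matrix.one_apply, eq_comm]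
  rw [h, Matrix.l2_opNorm_conjTranspose]
  exact norm_submatrix_one_le hf

theorem norm_scalarMatrix_submatrix_le {f : κ → ι} (hf : Function.Injective f)
    (M : Matrix ι ι ℂ) : ‖M.submatrix f f‖ ≤ ‖M‖ := by
  have h : M.submatrix f f
      = (1 : Matrix ι ι ℂ).submatrix f id * M * (1 : Matrix ι ι ℂ).submatrix id f := by
    ext i j; simp [Matrix.mul_apply, Matrix.one_apply]
  rw [h]
  calc _ ≤ ‖(1 : Matrix ι ι ℂ).submatrix f id * M‖ * ‖(1 : Matrix ι ι ℂ).submatrix id f‖ :=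
        Matrix.l2_opNorm_mul _ _
    _ ≤ (1 * ‖M‖) * 1 := by
        gcongr
        · exact (Matrix.l2_opNorm_mul _ _).trans (by gcongr; exact norm_submatrix_one_le' hf)
        · exact norm_submatrix_one_le hf
    _ = ‖M‖ := by ring

end ScalarNorms

/-! ### Matrix norms of functionals. -/

section DualNorms

variable {V : Type*} [NormedAddCommGroup V] [NormedSpace ℂ V] [MatrixNorms V]
variable {ι : Type} [Fintype ι] [DecidableEq ι]

theorem dual_matNorm_le {φ : Matrix ι ι (StrongDual ℂ V)} {C : ℝ} (hC : 0 ≤ C)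
    (h : ∀ (n : ℕ) (x : Matrix (Fin n) (Fin n) V),
      ‖(Matrix.of fun p q : ι × Fin n => φ p.1 q.1 (x p.2 q.2) :
        Matrix (ι × Fin n) (ι × Fin n) ℂ)‖ ≤ C * matNorm x) : matNorm φ ≤ C :=
  csInf_le ⟨0, fun _ hC => hC.1⟩ ⟨hC, h⟩

theorem dual_matNorm_nonneg (φ : Matrix ι ι (StrongDual ℂ V)) : 0 ≤ matNorm φ :=
  Real.sInf_nonneg fun _ hC => hC.1

end DualNorms

/-! ### Consequences of Ruan's axioms. -/

section AbstractOperatorSpace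

variable {V : Type*} [NormedAddCommGroup V] [NormedSpace ℂ V] [MatrixNorms V] [IsOperatorSpace V]
variable {ι κ : Type} [Fintype ι] [DecidableEq ι] [Fintype κ] [DecidableEq κ]

open IsOperatorSpace

theorem matNorm_zero : matNorm (0 : Matrix ι ι V) = 0 := by
  have := matNorm_smul (0 : ℂ) (0 : Matrix ι ι V)
  simpa using this

theorem matNorm_neg (x : Matrix ι ι V) : matNorm (-x) = matNorm x := by
  have := matNorm_smul (-1 : ℂ) x
  simpa using this

theorem matNorm_nonneg (x : Matrix ι ι V) : 0 ≤ matNorm x := by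
  have h := matNorm_add_le x (-x)
  rw [add_neg_cancel, matNorm_zero, matNorm_neg] at h
  linarith

theorem matNorm_submatrix_le {f : κ → ι} (hf : Function.Injective f) (x : Matrix ι ι V) :
    matNorm (x.submatrix f f) ≤ matNorm x := by
  have h := matNorm_mul_mul_le ((1 : Matrix ι ι ℂ).submatrix f id) x
    ((1 : Matrix ι ι ℂ).submatrix id f)
  have h1 : (Matrix.of fun k l => ∑ i, ∑ j, ((1 : Matrix ι ι ℂ).submatrix f id k i *
      (1 : Matrix ι ι ℂ).submatrix id f j l) • x i j) = x.submatrix f f := by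
    ext k l
    simp [Matrix.one_apply, Finset.sum_ite_eq, mul_ite, ite_smul]
  rw [h1] at h
  refine h.trans ?_
  have h0 := matNorm_nonneg x
  calc _ ≤ 1 * matNorm x * 1 := by
        gcongr
        · exact norm_submatrix_one_le' hf
        · exact norm_submatrix_one_le hf
    _ = matNorm x := by ring

/-- Multiplying by the row y* and the column c compresses the matrix to size one, where the matrix
norm is the given norm of V. -/
theorem norm_bilin_le_matNorm (x : Matrix ι ι V) (c y : EuclideanSpace ℂ ι) :
    ‖∑ i, ∑ j, (star (y i) * c j) • x i j‖ ≤ matNorm x * ‖c‖ * ‖y‖ := by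
  have h := matNorm_mul_mul_le (Matrix.of fun (_ : Unit) i => star (y i)) x
    (Matrix.of fun i (_ : Unit) => c i)
  have h1 := matNorm_one_by_one (∑ i, ∑ j, (star (y i) * c j) • x i j)
  simp only [Matrix.of_apply] at h
  rw [h1] at h
  refine h.trans ?_
  have h0 := matNorm_nonneg x
  calc _ ≤ ‖y‖ * matNorm x * ‖c‖ := by
        gcongr
        · exact norm_row_le y
        · exact norm_col_le c
    _ = _ := by ring

/-- Bounded functionals are completely bounded. -/
theorem norm_map_functional_le (φ : StrongDual ℂ V) (x : Matrix ι ι V) :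
    ‖(Matrix.of fun i j => φ (x i j) : Matrix ι ι ℂ)‖ ≤ ‖φ‖ * matNorm x := by
  refine scalarMatrix_norm_le _ (mul_nonneg (norm_nonneg _) (matNorm_nonneg x)) fun c y => ?_
  have h : ∑ i, ∑ j, star (y i) * (Matrix.of fun i j => φ (x i j) : Matrix ι ι ℂ) i j * c j
      = φ (∑ i, ∑ j, (star (y i) * c j) • x i j) := by
    simp only [map_sum, map_smul, Matrix.of_apply, smul_eq_mul]
    refine Finset.sum_congr rfl fun i _ => Finset.sum_congr rfl fun j _ => by ring
  rw [h]
  calc _ ≤ ‖φ‖ * (matNorm x * ‖c‖ * ‖y‖) :=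
        (φ.le_opNorm _).trans (by gcongr; exact norm_bilin_le_matNorm x c y)
    _ = _ := by ring

/-- A crude bound over the blocks. Its role is to show that the set of constants whose infimum
defines the dual matrix norm is nonempty. -/
theorem norm_scalarMatrix_le_sum {κ : Type*} [Fintype κ] [DecidableEq κ]
    (M : Matrix (ι × κ) (ι × κ) ℂ) :
    ‖M‖ ≤ ∑ i, ∑ j, ‖(Matrix.of fun p q => M (i, p) (j, q) : Matrix κ κ ℂ)‖ := by
  refine scalarMatrix_norm_le _ (by positivity) fun c y => ?_
  have h : ∑ p, ∑ q, star (y p) * M p q * c q = ∑ i, ∑ j, ∑ p, ∑ q,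
      star ((WithLp.toLp 2 fun p => y (i, p) : EuclideanSpace ℂ κ) p)
        * (Matrix.of fun p q => M (i, p) (j, q) : Matrix κ κ ℂ) p q
        * (WithLp.toLp 2 fun p => c (j, p) : EuclideanSpace ℂ κ) q := by
    simp only [Fintype.sum_prod_type, Matrix.of_apply]
    refine Finset.sum_congr rfl fun i _ => ?_
    exact Finset.sum_comm
  have hle : ∀ (z : EuclideanSpace ℂ (ι × κ)) (i : ι),
      ‖(WithLp.toLp 2 fun p => z (i, p) : EuclideanSpace ℂ κ)‖ ≤ ‖z‖ := fun z i => by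
    refine le_of_sq_le_sq ?_ (norm_nonneg _)
    rw [EuclideanSpace.norm_sq_eq, EuclideanSpace.norm_sq_eq, Fintype.sum_prod_type]
    exact Finset.single_le_sum (f := fun i => ∑ p, ‖z (i, p)‖ ^ 2)
      (fun _ _ => by positivity) (Finset.mem_univ i)
  rw [h, Finset.sum_mul, Finset.sum_mul]
  refine (norm_sum_le _ _).trans (Finset.sum_le_sum fun i _ => ?_)
  rw [Finset.sum_mul, Finset.sum_mul]
  refine (norm_sum_le _ _).trans (Finset.sum_le_sum fun j _ => ?_)
  refine (norm_sum_scalarMatrix_le _ _ _).trans ?_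
  gcongr
  · exact hle c j
  · exact hle y i

/-- The completely bounded norm of a matrix of functionals is attained. -/
theorem norm_dual_apply_le (φ : Matrix ι ι (StrongDual ℂ V)) (x : Matrix κ κ V) :
    ‖(Matrix.of fun p q : ι × κ => φ p.1 q.1 (x p.2 q.2) : Matrix (ι × κ) (ι × κ) ℂ)‖
      ≤ matNorm φ * matNorm x := by
  set S := {C : ℝ | 0 ≤ C ∧ ∀ (n : ℕ) (x : Matrix (Fin n) (Fin n) V),
    ‖(Matrix.of fun p q : ι × Fin n => φ p.1 q.1 (x p.2 q.2) :
      Matrix (ι × Fin n) (ι × Fin n) ℂ)‖ ≤ C * matNorm x} with hS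
  have hne : S.Nonempty := by
    refine ⟨∑ i, ∑ j, ‖φ i j‖, by positivity, fun n x => ?_⟩
    refine (norm_scalarMatrix_le_sum _).trans ?_
    rw [Finset.sum_mul]
    refine Finset.sum_le_sum fun i _ => ?_
    rw [Finset.sum_mul]
    exact Finset.sum_le_sum fun j _ => norm_map_functional_le (φ i j) x
  have hfin : ∀ (n : ℕ) (x : Matrix (Fin n) (Fin n) V),
      ‖(Matrix.of fun p q : ι × Fin n => φ p.1 q.1 (x p.2 q.2) :
        Matrix (ι × Fin n) (ι × Fin n) ℂ)‖ ≤ sInf S * matNorm x := by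
    intro n x
    -- When `matNorm x = 0` one cannot divide, but any admissible constant already forces the left
    -- side to be 0.
    rcases (matNorm_nonneg x).eq_or_lt with h0 | h0
    · obtain ⟨C, hC⟩ := hne
      have := hC.2 n x
      rwa [← h0, mul_zero] at this ⊢
    · rw [← div_le_iff₀ h0]
      exact le_csInf hne fun C hC => by rw [div_le_iff₀ h0]; exact hC.2 n x
  -- The dual norm is tested only on matrices indexed by `Fin n`; other index types are reached by
  -- reindexing.
  let e := Fintype.equivFin κ
  have h1 := hfin _ (x.submatrix e.symm e.symm)
  have h2 := norm_scalarMatrix_submatrix_le (f := fun p : ι × κ => (p.1, e p.2))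
    (fun p q h => by simpa [Prod.ext_iff] using h)
    (Matrix.of fun p q : ι × Fin (Fintype.card κ) =>
      φ p.1 q.1 (x.submatrix e.symm e.symm p.2 q.2))
  have h3 : (Matrix.of fun p q : ι × Fin (Fintype.card κ) =>
      φ p.1 q.1 (x.submatrix e.symm e.symm p.2 q.2)).submatrix (fun p : ι × κ => (p.1, e p.2))
        (fun p : ι × κ => (p.1, e p.2))
      = (Matrix.of fun p q : ι × κ => φ p.1 q.1 (x p.2 q.2)) := by
    ext p q; simp
  rw [h3] at h2
  have hS0 : 0 ≤ sInf S := Real.sInf_nonneg fun C hC => hC.1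
  exact h2.trans (h1.trans (mul_le_mul_of_nonneg_left
    (matNorm_submatrix_le e.symm.injective x) hS0))

end AbstractOperatorSpace

/-! ### Concrete C*-algebras are operator spaces -/

section Concrete

variable {H : Type*} [NormedAddCommGroup H] [InnerProductSpace ℂ H]

theorem starSubalgebra_matNorm_def [CompleteSpace H] (A : StarSubalgebra ℂ (H →L[ℂ] H))
    {ι : Type} [Fintype ι]
    [DecidableEq ι] (x : Matrix ι ι A) :
    matNorm x = ‖opMatrix (x.map fun a => (a : H →L[ℂ] H))‖ := rfl

/-- The scalar matrices are moved onto the vectors, ⟨Y, αxβ X⟩ = ⟨α*Y, x βX⟩, where they act with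
norm at most ‖α‖ and ‖β‖. -/
theorem norm_opMatrix_mul_mul_le {ι κ : Type*} [Fintype ι] [DecidableEq ι] [Fintype κ]
    [DecidableEq κ] (α : Matrix κ ι ℂ) (x : Matrix ι ι (H →L[ℂ] H)) (β : Matrix ι κ ℂ) :
    ‖opMatrix (Matrix.of fun k l => ∑ i, ∑ j, (α k i * β j l) • x i j)‖
      ≤ ‖α‖ * ‖opMatrix x‖ * ‖β‖ := by
  refine norm_opMatrix_le _ (by positivity) fun X Y => ?_
  let X' : PiLp 2 fun _ : ι => H := WithLp.toLp 2 fun j => ∑ l, β j l • X l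
  let Y' : PiLp 2 fun _ : ι => H := WithLp.toLp 2 fun i => ∑ k, α.conjTranspose i k • Y k
  have h : ∑ k, ∑ l, ⟪Y k, (Matrix.of fun k l => ∑ i, ∑ j, (α k i * β j l) • x i j) k l (X l)⟫_ℂ
      = ∑ i, ∑ j, ⟪Y' i, x i j (X' j)⟫_ℂ := by
    simp only [X', Y', Matrix.of_apply, sum_apply, smul_apply, inner_sum,
      sum_inner, inner_smul_left, inner_smul_right, map_sum, map_smul,
      Matrix.conjTranspose_apply, RCLike.star_def, RCLike.conj_conj]
    have e1 : ∀ k, ∑ l, ∑ i, ∑ j, α k i * β j l * ⟪Y k, (x i j) (X l)⟫_ℂ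
        = ∑ i, ∑ j, ∑ l, β j l * (α k i * ⟪Y k, (x i j) (X l)⟫_ℂ) := fun k => by
      rw [Finset.sum_comm]
      refine Finset.sum_congr rfl fun i _ => ?_
      rw [Finset.sum_comm]
      exact Finset.sum_congr rfl fun j _ => Finset.sum_congr rfl fun l _ => by ring
    simp only [e1]
    rw [Finset.sum_comm]
    refine Finset.sum_congr rfl fun i _ => ?_
    rw [Finset.sum_comm]
    refine Finset.sum_congr rfl fun j _ => ?_
    rw [Finset.sum_comm]
    simp only [Finset.mul_sum]
  rw [h]
  refine (norm_sum_inner_le x X' Y').trans ?_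
  have hX : ‖X'‖ ≤ ‖β‖ * ‖X‖ := norm_scalarMatrix_smul_le β X
  have hY : ‖Y'‖ ≤ ‖α‖ * ‖Y‖ := by
    rw [← Matrix.l2_opNorm_conjTranspose α]
    exact norm_scalarMatrix_smul_le α.conjTranspose Y
  calc _ ≤ ‖opMatrix x‖ * (‖β‖ * ‖X‖) * (‖α‖ * ‖Y‖) := by gcongr
    _ = _ := by ring

theorem norm_opMatrix_fromBlocks_le {ι κ : Type*} [Fintype ι] [Fintype κ]
    (x : Matrix ι ι (H →L[ℂ] H)) (y : Matrix κ κ (H →L[ℂ] H)) :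
    ‖opMatrix (Matrix.fromBlocks x 0 0 y)‖ ≤ max ‖opMatrix x‖ ‖opMatrix y‖ := by
  have hm : 0 ≤ max ‖opMatrix x‖ ‖opMatrix y‖ := le_max_of_le_left (opMatrix x).opNorm_nonneg
  refine ContinuousLinearMap.opNorm_le_bound _ hm fun X => ?_
  refine le_of_sq_le_sq ?_ (by positivity)
  let X₁ : PiLp 2 fun _ : ι => H := WithLp.toLp 2 fun i => X (.inl i)
  let X₂ : PiLp 2 fun _ : κ => H := WithLp.toLp 2 fun i => X (.inr i)
  have h1 : ‖opMatrix (Matrix.fromBlocks x 0 0 y) X‖ ^ 2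
      = ‖opMatrix x X₁‖ ^ 2 + ‖opMatrix y X₂‖ ^ 2 := by
    simp [PiLp.norm_sq_eq_of_L2, opMatrix_apply, X₁, X₂]
  have h2 : ‖X‖ ^ 2 = ‖X₁‖ ^ 2 + ‖X₂‖ ^ 2 := by
    simp [PiLp.norm_sq_eq_of_L2, X₁, X₂]
  rw [h1, mul_pow, h2, mul_add, ← mul_pow, ← mul_pow]
  gcongr
  · exact ((opMatrix x).le_opNorm _).trans (by gcongr; exact le_max_left _ _)
  · exact ((opMatrix y).le_opNorm _).trans (by gcongr; exact le_max_right _ _)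

theorem norm_opMatrix_submatrix_le {ι κ : Type*} [Fintype ι] [Fintype κ]
    {f : κ → ι} (hf : Function.Injective f) (x : Matrix ι ι (H →L[ℂ] H)) :
    ‖opMatrix (x.submatrix f f)‖ ≤ ‖opMatrix x‖ := by
  classical
  have h := norm_opMatrix_mul_mul_le ((1 : Matrix ι ι ℂ).submatrix f id) x
    ((1 : Matrix ι ι ℂ).submatrix id f)
  have h1 : (Matrix.of fun k l => ∑ i, ∑ j, ((1 : Matrix ι ι ℂ).submatrix f id k i *
      (1 : Matrix ι ι ℂ).submatrix id f j l) • x i j) = x.submatrix f f := by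
    ext k l
    simp [Matrix.one_apply, Finset.sum_ite_eq, mul_ite, ite_smul]
  rw [h1] at h
  refine h.trans ?_
  calc _ ≤ 1 * ‖opMatrix x‖ * 1 := by
        gcongr
        · exact norm_submatrix_one_le' hf
        · exact norm_submatrix_one_le hf
    _ = _ := by ring

/-- Operator Connes-amenability quantifies over modules whose predual is an operator space. The
predual used below is a quotient of C*(G) ⊗_min C*(G), so Ruan's axioms are needed for concrete
C*-algebras and for quotients. -/
instance instIsOperatorSpaceStarSubalgebra [CompleteSpace H] (A : StarSubalgebra ℂ (H →L[ℂ] H)) :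
    IsOperatorSpace A where
  matNorm_add_le x y := by
    simp only [starSubalgebra_matNorm_def]
    rw [show ((x + y).map fun a : A => (a : H →L[ℂ] H))
      = (x.map fun a : A => (a : H →L[ℂ] H)) + (y.map fun a : A => (a : H →L[ℂ] H)) from rfl,
      opMatrix_add]
    exact norm_add_le _ _
  matNorm_smul c x := by
    simp only [starSubalgebra_matNorm_def]
    rw [show ((c • x).map fun a : A => (a : H →L[ℂ] H))
      = c • (x.map fun a : A => (a : H →L[ℂ] H)) from rfl, opMatrix_smul]
    exact norm_smul _ _
  matNorm_one_by_one v := by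
    rw [starSubalgebra_matNorm_def]
    refine le_antisymm ((norm_opMatrix_le_sum _).trans ?_) ?_
    · simp
    · exact norm_entry_le_norm_opMatrix
        ((Matrix.of fun _ _ : Unit => v).map fun a : A => (a : H →L[ℂ] H)) () ()
  matNorm_mul_mul_le α x β := by
    simp only [starSubalgebra_matNorm_def]
    convert norm_opMatrix_mul_mul_le α (x.map fun a : A => (a : H →L[ℂ] H)) β using 3
    ext k l : 2
    simp
  matNorm_fromBlocks {ι κ} _ _ _ _ x y := by
    simp only [starSubalgebra_matNorm_def]
    have h : ((Matrix.fromBlocks x 0 0 y).map fun a : A => (a : H →L[ℂ] H))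
        = Matrix.fromBlocks (x.map fun a : A => (a : H →L[ℂ] H)) 0 0
          (y.map fun a : A => (a : H →L[ℂ] H)) := by
      rw [Matrix.fromBlocks_map]
      congr 1
    rw [h]
    refine le_antisymm (norm_opMatrix_fromBlocks_le _ _) (max_le ?_ ?_)
    · exact norm_opMatrix_submatrix_le Sum.inl_injective (Matrix.fromBlocks _ 0 0 _)
    · exact norm_opMatrix_submatrix_le Sum.inr_injective (Matrix.fromBlocks _ 0 0 _)

end Concrete

/-! ### Quotients of operator spaces -/

section Quotient

theorem exists_map_mkQ_eq {ι V : Type*} [NormedAddCommGroup V] [NormedSpace ℂ V]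
    (W : Submodule ℂ V) (x : Matrix ι ι (V ⧸ W)) :
    ∃ y : Matrix ι ι V, y.map W.mkQ = x := by
  choose y hy using fun i j => W.mkQ_surjective (x i j)
  exact ⟨y, by ext i j; exact hy i j⟩

variable {V : Type*} [NormedAddCommGroup V] [NormedSpace ℂ V] [MatrixNorms V]

/-- The quotient operator space structure. -/
noncomputable instance instMatrixNormsQuotient (W : Submodule ℂ V) : MatrixNorms (V ⧸ W) where
  matNorm {ι} _ _ x := sInf {r | ∃ y : Matrix ι ι V, y.map W.mkQ = x ∧ r = matNorm y}

variable {ι κ : Type} [Fintype ι] [DecidableEq ι] [Fintype κ] [DecidableEq κ]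

theorem le_quotient_matNorm (W : Submodule ℂ V) (x : Matrix ι ι (V ⧸ W)) {C : ℝ}
    (h : ∀ y : Matrix ι ι V, y.map W.mkQ = x → C ≤ matNorm y) : C ≤ matNorm x := by
  obtain ⟨y, hy⟩ := exists_map_mkQ_eq W x
  refine le_csInf ⟨_, y, hy, rfl⟩ ?_
  rintro _ ⟨y, hy, rfl⟩
  exact h y hy

/-- Every estimate on the quotient is proved on arbitrary lifts and then passed to the infimum. The
factor K = 0 is separate because it cannot be divided out. -/
theorem le_mul_quotient_matNorm (W : Submodule ℂ V) (x : Matrix ι ι (V ⧸ W)) {C K : ℝ}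
    (hK : 0 ≤ K) (h : ∀ y : Matrix ι ι V, y.map W.mkQ = x → C ≤ K * matNorm y) :
    C ≤ K * matNorm x := by
  rcases hK.eq_or_lt with rfl | hK
  · obtain ⟨y, hy⟩ := exists_map_mkQ_eq W x
    simpa using h y hy
  · rw [← div_le_iff₀' hK]
    exact le_quotient_matNorm W x fun y hy => by rw [div_le_iff₀' hK]; exact h y hy

theorem exists_lift_matNorm_lt (W : Submodule ℂ V) (x : Matrix ι ι (V ⧸ W)) {ε : ℝ} (hε : 0 < ε) :
    ∃ y : Matrix ι ι V, y.map W.mkQ = x ∧ matNorm y < matNorm x + ε := by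
  by_contra! h
  linarith [le_quotient_matNorm W x h]

variable [IsOperatorSpace V]

open IsOperatorSpace

theorem quotient_matNorm_map_le (W : Submodule ℂ V) (y : Matrix ι ι V) :
    matNorm (y.map W.mkQ) ≤ matNorm y :=
  csInf_le ⟨0, by rintro _ ⟨y, _, rfl⟩; exact matNorm_nonneg y⟩ ⟨y, rfl, rfl⟩

instance instIsOperatorSpaceQuotient (W : Submodule ℂ V) [IsClosed (W : Set V)] :
    IsOperatorSpace (V ⧸ W) where
  matNorm_add_le x y := by
    refine le_of_forall_pos_lt_add fun ε hε => ?_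
    obtain ⟨x', rfl, hx⟩ := exists_lift_matNorm_lt W x (half_pos hε)
    obtain ⟨y', rfl, hy⟩ := exists_lift_matNorm_lt W y (half_pos hε)
    have h : x'.map W.mkQ + y'.map W.mkQ = (x' + y').map W.mkQ := rfl
    rw [h]
    linarith [quotient_matNorm_map_le W (x' + y'), matNorm_add_le x' y']
  matNorm_smul {ι} _ _ c x := by
    have key : ∀ (c : ℂ) (x : Matrix ι ι (V ⧸ W)), matNorm (c • x) ≤ ‖c‖ * matNorm x :=
      fun c x => le_mul_quotient_matNorm W x (norm_nonneg c) fun y hy => by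
        rw [← hy, ← matNorm_smul]
        exact quotient_matNorm_map_le W (c • y)
    refine le_antisymm (key c x) ?_
    rcases eq_or_ne c 0 with rfl | hc
    · simp only [norm_zero, zero_mul]
      exact le_quotient_matNorm W _ fun y _ => matNorm_nonneg y
    · have h := key c⁻¹ (c • x)
      rw [smul_smul, inv_mul_cancel₀ hc, one_smul, norm_inv] at h
      have hc' : 0 < ‖c‖ := norm_pos_iff.2 hc
      rwa [← div_eq_inv_mul, le_div_iff₀' hc'] at h
  matNorm_one_by_one v := by
    refine le_antisymm ?_ ?_
    · refine le_of_forall_pos_lt_add fun ε hε => ?_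
      obtain ⟨w, hw, hw'⟩ := Submodule.Quotient.norm_mk_lt v hε
      have h := quotient_matNorm_map_le W (Matrix.of fun _ _ : Unit => w)
      rw [matNorm_one_by_one] at h
      have h2 : (Matrix.of fun _ _ : Unit => w).map W.mkQ = Matrix.of fun _ _ : Unit => v := by
        ext i j; exact hw
      rw [h2] at h
      linarith
    · refine le_quotient_matNorm W _ fun y hy => ?_
      have h1 : y = Matrix.of fun _ _ : Unit => y () () := rfl
      rw [h1, matNorm_one_by_one]
      have h2 : W.mkQ (y () ()) = v := congrFun (congrFun hy ()) ()
      rw [← h2]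
      exact Submodule.Quotient.norm_mk_le W _
  matNorm_mul_mul_le {ι κ} _ _ _ _ α x β := by
    have : ‖α‖ * matNorm x * ‖β‖ = (‖α‖ * ‖β‖) * matNorm x := by ring
    rw [this]
    refine le_mul_quotient_matNorm W x (by positivity) fun y hy => ?_
    have h : (Matrix.of fun k l => ∑ i, ∑ j, (α k i * β j l) • x i j)
        = (Matrix.of fun k l => ∑ i, ∑ j, (α k i * β j l) • y i j).map W.mkQ := by
      rw [← hy]
      ext k l
      simp
    rw [h]
    refine (quotient_matNorm_map_le W _).trans ((matNorm_mul_mul_le α y β).trans ?_)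
    linarith
  matNorm_fromBlocks {ι κ} _ _ _ _ x y := by
    refine le_antisymm ?_ (le_quotient_matNorm W _ fun z hz => max_le ?_ ?_)
    · refine le_of_forall_pos_lt_add fun ε hε => ?_
      obtain ⟨x', rfl, hx⟩ := exists_lift_matNorm_lt W x hε
      obtain ⟨y', rfl, hy⟩ := exists_lift_matNorm_lt W y hε
      have h : Matrix.fromBlocks (x'.map W.mkQ) 0 0 (y'.map W.mkQ)
          = (Matrix.fromBlocks x' 0 0 y').map W.mkQ := by
        rw [Matrix.fromBlocks_map]
        congr 1
      rw [h]
      refine (quotient_matNorm_map_le W _).trans_lt ?_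
      rw [matNorm_fromBlocks, ← max_add_add_right]
      exact max_lt_max hx hy
    · have h : x = (z.submatrix Sum.inl Sum.inl).map W.mkQ := by
        ext i j; exact (congrFun (congrFun hz (.inl i)) (.inl j)).symm
      rw [h]
      exact (quotient_matNorm_map_le W _).trans (matNorm_submatrix_le Sum.inl_injective z)
    · have h : y = (z.submatrix Sum.inr Sum.inr).map W.mkQ := by
        ext i j; exact (congrFun (congrFun hz (.inr i)) (.inr j)).symm
      rw [h]
      exact (quotient_matNorm_map_le W _).trans (matNorm_submatrix_le Sum.inr_injective z)

end Quotient

/-! ### Operators on Hilbert space tensor products -/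

section Tensor

variable {H : Type*} [NormedAddCommGroup H] [InnerProductSpace ℂ H]
variable {K : Type*} [NormedAddCommGroup K] [InnerProductSpace ℂ K]

theorem opTensor_tmul (a : H →L[ℂ] H) (b : K →L[ℂ] K) (x : H) (y : K) :
    opTensor a b (HilbertTensor.incl H K (x ⊗ₜ y)) = HilbertTensor.incl H K (a x ⊗ₜ b y) := by
  rw [opTensor_incl, TensorProduct.mapL_tmul]

theorem HilbertTensor.clm_ext {L : Type*} [NormedAddCommGroup L] [NormedSpace ℂ L]
    {S T : HilbertTensor H K →L[ℂ] L}
    (h : ∀ x y, S (HilbertTensor.incl H K (x ⊗ₜ y)) = T (HilbertTensor.incl H K (x ⊗ₜ y))) :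
    S = T := by
  refine ContinuousLinearMap.coeFn_injective ?_
  refine HilbertTensor.denseRange_incl.equalizer (by fun_prop) (by fun_prop) ?_
  have : S.toLinearMap ∘ₗ (HilbertTensor.incl H K).toLinearMap
      = T.toLinearMap ∘ₗ (HilbertTensor.incl H K).toLinearMap := by
    ext x y
    exact h x y
  exact congrArg DFunLike.coe this

theorem opTensor_add_left (a a' : H →L[ℂ] H) (b : K →L[ℂ] K) :
    opTensor (a + a') b = opTensor a b + opTensor a' b :=
  HilbertTensor.clm_ext fun x y => by simp [opTensor_tmul, TensorProduct.add_tmul]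

theorem opTensor_add_right (a : H →L[ℂ] H) (b b' : K →L[ℂ] K) :
    opTensor a (b + b') = opTensor a b + opTensor a b' :=
  HilbertTensor.clm_ext fun x y => by simp [opTensor_tmul, TensorProduct.tmul_add]

theorem opTensor_smul_left (c : ℂ) (a : H →L[ℂ] H) (b : K →L[ℂ] K) :
    opTensor (c • a) b = c • opTensor a b :=
  HilbertTensor.clm_ext fun x y => by
    rw [smul_apply, opTensor_tmul, opTensor_tmul, smul_apply, ← TensorProduct.smul_tmul', map_smul]

theorem opTensor_smul_right (c : ℂ) (a : H →L[ℂ] H) (b : K →L[ℂ] K) :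
    opTensor a (c • b) = c • opTensor a b :=
  HilbertTensor.clm_ext fun x y => by simp [opTensor_tmul]

theorem opTensor_mul (a a' : H →L[ℂ] H) (b b' : K →L[ℂ] K) :
    opTensor (a * a') (b * b') = opTensor a b * opTensor a' b' :=
  HilbertTensor.clm_ext fun x y => by simp [opTensor_tmul]

theorem opTensor_one : opTensor (1 : H →L[ℂ] H) (1 : K →L[ℂ] K) = 1 :=
  HilbertTensor.clm_ext fun x y => by simp [opTensor_tmul]

theorem norm_opTensor_le (a : H →L[ℂ] H) (b : K →L[ℂ] K) : ‖opTensor a b‖ ≤ ‖a‖ * ‖b‖ := by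
  refine ContinuousLinearMap.opNorm_le_bound _ (by positivity) fun x => ?_
  refine HilbertTensor.denseRange_incl.induction_on x
    (isClosed_le (by fun_prop) (by fun_prop)) fun x => ?_
  rw [opTensor_incl, LinearIsometry.norm_map, LinearIsometry.norm_map]
  exact ((TensorProduct.mapL a b).le_opNorm x).trans
    (by gcongr; exact TensorProduct.norm_mapL_le a b)

theorem continuous_opTensor_left (b : K →L[ℂ] K) :
    Continuous fun a : H →L[ℂ] H => opTensor a b := by
  let f : (H →L[ℂ] H) →ₗ[ℂ] (HilbertTensor H K →L[ℂ] HilbertTensor H K) :=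
    { toFun := fun a => opTensor a b
      map_add' := fun a a' => opTensor_add_left a a' b
      map_smul' := fun c a => opTensor_smul_left c a b }
  exact (f.mkContinuous ‖b‖ fun a => (norm_opTensor_le a b).trans_eq (mul_comm _ _)).continuous

theorem continuous_opTensor_right (a : H →L[ℂ] H) :
    Continuous fun b : K →L[ℂ] K => opTensor a b := by
  let f : (K →L[ℂ] K) →ₗ[ℂ] (HilbertTensor H K →L[ℂ] HilbertTensor H K) :=
    { toFun := fun b => opTensor a b
      map_add' := fun b b' => opTensor_add_right a b b'
      map_smul' := fun c b => opTensor_smul_right c a b }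
  exact (f.mkContinuous ‖a‖ fun b => norm_opTensor_le a b).continuous

theorem opTensor_star [CompleteSpace H] [CompleteSpace K] (a : H →L[ℂ] H) (b : K →L[ℂ] K) :
    opTensor (star a) (star b) = star (opTensor a b) := by
  refine HilbertTensor.clm_ext fun x y => ?_
  refine ext_inner_right ℂ fun z => ?_
  rw [ContinuousLinearMap.star_eq_adjoint (opTensor a b), ContinuousLinearMap.adjoint_inner_left]
  have : (innerSL ℂ (opTensor (star a) (star b) (HilbertTensor.incl H K (x ⊗ₜ y))))
      = (innerSL ℂ (HilbertTensor.incl H K (x ⊗ₜ y))) ∘L opTensor a b := by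
    refine HilbertTensor.clm_ext fun x' y' => ?_
    simp [opTensor_tmul, ContinuousLinearMap.star_eq_adjoint,
      ContinuousLinearMap.adjoint_inner_left]
  exact congrArg (fun f => f z) this

/-- Expanding all second legs in one common orthonormal family identifies the given tensors with
vectors in H^N. -/
theorem exists_tmul_orthonormal {α : Type*} [Finite α] (X : α → H ⊗[ℂ] K) :
    ∃ (N : ℕ) (g : Fin N → K), Orthonormal ℂ g ∧
      ∃ X' : α → Fin N → H, ∀ a, X a = ∑ n, X' a n ⊗ₜ[ℂ] g n := by
  choose k m z h using fun a => TensorProduct.exists_sum_tmul_eq (X a)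
  obtain ⟨N, g, hg, c, hc⟩ := exists_orthonormal_coords fun p : Σ a, Fin (k a) => z p.1 p.2
  refine ⟨N, g, hg, fun a n => ∑ j, c ⟨a, j⟩ n • m a j, fun a => ?_⟩
  rw [h a]
  simp_rw [TensorProduct.sum_tmul]
  rw [Finset.sum_comm]
  refine Finset.sum_congr rfl fun j _ => ?_
  rw [hc ⟨a, j⟩, TensorProduct.tmul_sum]
  exact Finset.sum_congr rfl fun n _ => by
    rw [TensorProduct.tmul_smul, TensorProduct.smul_tmul']

theorem denseRange_incl_pi (α : Type*) [Fintype α] :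
    DenseRange fun X : α → H ⊗[ℂ] K =>
      (WithLp.toLp 2 fun a => HilbertTensor.incl H K (X a) :
        PiLp 2 fun _ : α => HilbertTensor H K) := by
  have h1 : DenseRange (Pi.map fun _ : α => (HilbertTensor.incl H K : H ⊗[ℂ] K → _)) :=
    DenseRange.piMap fun _ => HilbertTensor.denseRange_incl
  exact ((PiLp.continuousLinearEquiv 2 ℂ
    fun _ : α => HilbertTensor H K).symm.surjective.denseRange).comp h1
      (PiLp.continuousLinearEquiv 2 ℂ fun _ : α => HilbertTensor H K).symm.continuous

/-! ### Slicing operators on H ⊗ K along orthonormal families. -/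

section Slice

variable {ι κ ν S : Type*} [Fintype ι] [Fintype κ] [Fintype ν]

/-- The embedding `H^(ι × ν) → (H ⊗ K)^(ι × κ)` given by a family `g` of vectors in `K^κ`. -/
noncomputable def sliceEmb (g : ν → PiLp 2 fun _ : κ => K) (X : PiLp 2 fun _ : ι × ν => H) :
    PiLp 2 fun _ : ι × κ => HilbertTensor H K :=
  WithLp.toLp 2 fun p => ∑ n, HilbertTensor.incl H K (X (p.1, n) ⊗ₜ g n p.2)

theorem sum_inner_sum_tmul (g : ν → PiLp 2 fun _ : κ => K) (a : H →L[ℂ] H)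
    (T : Matrix κ κ (K →L[ℂ] K)) (X Y : ν → H) :
    ∑ k, ∑ l, ⟪∑ n, HilbertTensor.incl H K (Y n ⊗ₜ g n k),
        opTensor a (T k l) (∑ n, HilbertTensor.incl H K (X n ⊗ₜ g n l))⟫_ℂ
      = ∑ n, ∑ m, ⟪g n, opMatrix T (g m)⟫_ℂ * ⟪Y n, a (X m)⟫_ℂ := by
  simp only [map_sum, opTensor_tmul, sum_inner, inner_sum,
    LinearIsometry.inner_map_map, TensorProduct.inner_tmul, inner_opMatrix, Finset.sum_mul]
  calc _ = ∑ k, ∑ l, ∑ n, ∑ m, ⟪Y n, a (X m)⟫_ℂ * ⟪g n k, T k l (g m l)⟫_ℂ :=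
        Finset.sum_congr rfl fun k _ => Finset.sum_congr rfl fun l _ => Finset.sum_comm
    _ = ∑ k, ∑ n, ∑ l, ∑ m, ⟪Y n, a (X m)⟫_ℂ * ⟪g n k, T k l (g m l)⟫_ℂ :=
        Finset.sum_congr rfl fun k _ => Finset.sum_comm
    _ = ∑ n, ∑ k, ∑ l, ∑ m, ⟪Y n, a (X m)⟫_ℂ * ⟪g n k, T k l (g m l)⟫_ℂ := Finset.sum_comm
    _ = ∑ n, ∑ k, ∑ m, ∑ l, ⟪Y n, a (X m)⟫_ℂ * ⟪g n k, T k l (g m l)⟫_ℂ :=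
        Finset.sum_congr rfl fun n _ => Finset.sum_congr rfl fun k _ => Finset.sum_comm
    _ = ∑ n, ∑ m, ∑ k, ∑ l, ⟪Y n, a (X m)⟫_ℂ * ⟪g n k, T k l (g m l)⟫_ℂ :=
        Finset.sum_congr rfl fun n _ => Finset.sum_comm
    _ = _ := by simp only [mul_comm]

theorem sum_prod_prod_comm {ι α S M : Type*} [Fintype ι] [Fintype α] [AddCommMonoid M]
    (s : Finset S) (F : ι × α → ι × α → S → M) :
    ∑ p, ∑ q, ∑ t ∈ s, F p q t = ∑ t ∈ s, ∑ i, ∑ j, ∑ k, ∑ l, F (i, k) (j, l) t := by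
  simp_rw [Finset.sum_comm (t := s)]
  refine Finset.sum_congr rfl fun t _ => ?_
  simp_rw [Fintype.sum_prod_type]
  exact Finset.sum_congr rfl fun i _ => Finset.sum_comm

/-- Compression along `sliceEmb` keeps the first leg of a t ⊗ T t and replaces the second by the
scalar matrix of T t in the family g. Orthonormality is not needed here; it enters only to make the
embedding isometric. -/
theorem sum_inner_sliceEmb (g : ν → PiLp 2 fun _ : κ => K) (s : Finset S)
    (a : S → Matrix ι ι (H →L[ℂ] H)) (T : S → Matrix κ κ (K →L[ℂ] K))
    (X Y : PiLp 2 fun _ : ι × ν => H) :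
    ∑ p, ∑ q, ⟪sliceEmb g Y p,
        (∑ t ∈ s, opTensor (a t p.1 q.1) (T t p.2 q.2)) (sliceEmb g X q)⟫_ℂ
      = ∑ p, ∑ q, ⟪Y p,
        (∑ t ∈ s, ⟪g p.2, opMatrix (T t) (g q.2)⟫_ℂ • a t p.1 q.1) (X q)⟫_ℂ := by
  simp only [sum_apply, inner_sum, smul_apply, inner_smul_right]
  rw [sum_prod_prod_comm, sum_prod_prod_comm]
  refine Finset.sum_congr rfl fun t _ => Finset.sum_congr rfl fun i _ =>
    Finset.sum_congr rfl fun j _ => ?_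
  exact sum_inner_sum_tmul g (a t i j) (T t) (fun n => X (j, n)) (fun n => Y (i, n))

theorem norm_sliceEmb {g : ν → PiLp 2 fun _ : κ => K} (hg : Orthonormal ℂ g)
    (X : PiLp 2 fun _ : ι × ν => H) : ‖sliceEmb g X‖ = ‖X‖ := by
  classical
  have h : ⟪sliceEmb g X, sliceEmb g X⟫_ℂ = ⟪X, X⟫_ℂ := by
    rw [PiLp.inner_apply, PiLp.inner_apply, Fintype.sum_prod_type, Fintype.sum_prod_type]
    refine Finset.sum_congr rfl fun i _ => ?_
    simp only [sliceEmb, sum_inner, inner_sum, LinearIsometry.inner_map_map,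
      TensorProduct.inner_tmul]
    rw [Finset.sum_comm]
    refine Finset.sum_congr rfl fun n _ => ?_
    rw [Finset.sum_comm]
    simp_rw [← Finset.mul_sum, ← PiLp.inner_apply, orthonormal_iff_ite.1 hg]
    simp
  rw [inner_self_eq_norm_sq_to_K, inner_self_eq_norm_sq_to_K] at h
  have h2 : ‖sliceEmb g X‖ ^ 2 = ‖X‖ ^ 2 := by exact_mod_cast h
  exact (pow_left_inj₀ (norm_nonneg _) (norm_nonneg _) two_ne_zero).1 h2

theorem norm_opMatrix_slice_le {g : ν → PiLp 2 fun _ : κ => K} (hg : Orthonormal ℂ g)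
    (s : Finset S) (a : S → Matrix ι ι (H →L[ℂ] H)) (T : S → Matrix κ κ (K →L[ℂ] K)) :
    ‖opMatrix (Matrix.of fun p q : ι × ν =>
        ∑ t ∈ s, ⟪g p.2, opMatrix (T t) (g q.2)⟫_ℂ • a t p.1 q.1)‖
      ≤ ‖opMatrix (Matrix.of fun p q : ι × κ =>
        ∑ t ∈ s, opTensor (a t p.1 q.1) (T t p.2 q.2))‖ := by
  refine norm_opMatrix_le _ (ContinuousLinearMap.opNorm_nonneg _) fun X Y => ?_
  simp only [Matrix.of_apply]
  rw [← sum_inner_sliceEmb, ← norm_sliceEmb hg X, ← norm_sliceEmb hg Y]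
  exact norm_sum_inner_le (Matrix.of fun p q : ι × κ =>
        ∑ t ∈ s, opTensor (a t p.1 q.1) (T t p.2 q.2)) _ _

/-- Converse of `norm_opMatrix_slice_le`: slices determine the spatial norm. By density the test
vectors may be algebraic tensors, and two of these lie in the range of a single slice embedding. -/
theorem norm_opMatrix_opTensor_le (s : Finset S) (a : S → Matrix ι ι (H →L[ℂ] H))
    (T : S → Matrix κ κ (K →L[ℂ] K)) {C : ℝ} (hC : 0 ≤ C)
    (h : ∀ (N : ℕ) (g : Fin N → PiLp 2 fun _ : κ => K), Orthonormal ℂ g →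
      ‖opMatrix (Matrix.of fun p q : ι × Fin N =>
        ∑ t ∈ s, ⟪g p.2, opMatrix (T t) (g q.2)⟫_ℂ • a t p.1 q.1)‖ ≤ C) :
    ‖opMatrix (Matrix.of fun p q : ι × κ =>
        ∑ t ∈ s, opTensor (a t p.1 q.1) (T t p.2 q.2))‖ ≤ C := by
  refine opNorm_le_of_inner_le _ hC fun X Y => ?_
  refine (denseRange_incl_pi (H := H) (K := K) (ι × κ)).induction_on₂
    (isClosed_le (by fun_prop) (by fun_prop)) (fun X Y => ?_) X Y
  classical
  let j : κ → K →ₗ[ℂ] PiLp 2 fun _ : κ => K := fun k =>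
    (WithLp.linearEquiv 2 ℂ (κ → K)).symm.toLinearMap ∘ₗ LinearMap.single ℂ (fun _ => K) k
  -- The components over κ are assembled into one tensor in H ⊗ K^κ, so that a single orthonormal
  -- family in K^κ serves both test vectors.
  let up : (ι × κ → H ⊗[ℂ] K) → ι → H ⊗[ℂ] (PiLp 2 fun _ : κ => K) := fun X i =>
    ∑ k, (j k).lTensor H (X (i, k))
  have hup : ∀ X i k, ((PiLp.projₗ 2 (𝕜 := ℂ) (fun _ : κ => K) k)).lTensor H (up X i)
      = X (i, k) := by
    intro X i k
    simp only [up, map_sum]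
    rw [Finset.sum_eq_single k]
    · rw [← LinearMap.comp_apply, ← LinearMap.lTensor_comp]
      have : PiLp.projₗ 2 (𝕜 := ℂ) (fun _ : κ => K) k ∘ₗ j k = LinearMap.id := by
        ext x; simp [j]
      rw [this]; simp
    · intro l _ hl
      rw [← LinearMap.comp_apply, ← LinearMap.lTensor_comp]
      have : PiLp.projₗ 2 (𝕜 := ℂ) (fun _ : κ => K) k ∘ₗ j l = 0 := by
        ext x; simp [j, hl.symm]
      rw [this]; simp
    · simp
  obtain ⟨N, g, hg, Z, hZ⟩ := exists_tmul_orthonormal (Sum.elim (up X) (up Y))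
  have hemb : ∀ (W : ι × κ → H ⊗[ℂ] K) (W' : ι → Fin N → H),
      (∀ i, up W i = ∑ n, W' i n ⊗ₜ[ℂ] g n) →
      (WithLp.toLp 2 fun p => HilbertTensor.incl H K (W p) :
        PiLp 2 fun _ : ι × κ => HilbertTensor H K)
      = sliceEmb g (WithLp.toLp 2 fun p : ι × Fin N => W' p.1 p.2) := by
    intro W W' hW
    ext p
    have := hup W p.1 p.2
    rw [hW, map_sum] at this
    simp only [sliceEmb, ← map_sum]
    rw [← this]
    simp
  rw [hemb X (fun i => Z (.inl i)) fun i => hZ (.inl i),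
    hemb Y (fun i => Z (.inr i)) fun i => hZ (.inr i), inner_opMatrix]
  simp only [Matrix.of_apply]
  rw [sum_inner_sliceEmb, norm_sliceEmb hg, norm_sliceEmb hg]
  refine (norm_sum_inner_le (Matrix.of fun p q : ι × Fin N =>
        ∑ t ∈ s, ⟪g p.2, opMatrix (T t) (g q.2)⟫_ℂ • a t p.1 q.1) _ _).trans ?_
  gcongr
  exact h N g hg

end Slice

end Tensor

/-! ### Star homomorphisms and matrices -/

section CompleteContractivity

variable {H : Type*} [NormedAddCommGroup H] [InnerProductSpace ℂ H] [CompleteSpace H]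
variable {A : Type*} [CStarAlgebra A] {ι : Type*} [Fintype ι]

/-- The *-representation of `M_ι(A)` on `H^ι` induced by a *-representation of `A` on `H`. -/
noncomputable def opMatrixHom (Φ : A →⋆ₐ[ℂ] (H →L[ℂ] H)) :
    CStarMatrix ι ι A →⋆ₙₐ[ℂ]
      ((PiLp 2 fun _ : ι => H) →L[ℂ] (PiLp 2 fun _ : ι => H)) where
  toFun M := opMatrix (Matrix.of fun i j => Φ (M i j))
  map_smul' c M := by
    rw [← opMatrix_smul]; congr 1; ext i j : 2; simp
  map_zero' := by ext; simp [opMatrix_apply]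
  map_add' M N := by
    rw [← opMatrix_add]; congr 1; ext i j : 2; simp
  map_mul' M N := by
    rw [← opMatrix_mul]; congr 1; ext i j : 2; simp [Matrix.mul_apply, CStarMatrix.mul_apply]
  map_star' M := by
    rw [← opMatrix_star]; congr 1; ext i j : 2
    simp [CStarMatrix.star_apply, map_star]

/-- *-homomorphisms between C*-algebras are contractive, and isometric when injective. Applied to
the C*-algebra of matrices over A, this gives the bound at every matrix level. -/
theorem norm_opMatrix_map_le {K : Type*} [NormedAddCommGroup K] [InnerProductSpace ℂ K]
    [CompleteSpace K] (Φ : A →⋆ₐ[ℂ] (H →L[ℂ] H)) (Ψ : A →⋆ₐ[ℂ] (K →L[ℂ] K))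
    (hΨ : Function.Injective Ψ) (x : Matrix ι ι A) :
    ‖opMatrix (x.map Φ)‖ ≤ ‖opMatrix (x.map Ψ)‖ := by
  let _ := CStarAlgebra.spectralOrder A
  have := CStarAlgebra.spectralOrderedRing A
  have h1 := NonUnitalStarAlgHom.norm_apply_le (opMatrixHom (ι := ι) Φ) (CStarMatrix.ofMatrix x)
  have h2 := NonUnitalStarAlgHom.norm_map (opMatrixHom (ι := ι) Ψ) (fun M N h => by
    ext i j
    have := opMatrix_injective h
    exact hΨ (congrFun (congrFun this i) j)) (CStarMatrix.ofMatrix x)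
  exact h1.trans h2.symm.le

end CompleteContractivity

/-! ### Algebras generated by a group -/

section GroupGenerated

variable {Γ : Type*} [Group Γ]

/-- The image of a group under f is already closed under products and adjoints, so the generated
*-algebra is just its linear span. -/
theorem adjoin_range_eq_span {A : Type*} [Ring A] [StarRing A] [Algebra ℂ A] [StarModule ℂ A]
    (f : Γ →* A) (hf : ∀ s, star (f s) = f s⁻¹) :
    Subalgebra.toSubmodule (StarAlgebra.adjoin ℂ (Set.range f)).toSubalgebra
      = Submodule.span ℂ (Set.range f) := by
  rw [StarAlgebra.adjoin_eq_span]
  have h1 : Set.range f ∪ star (Set.range f) = (MonoidHom.mrange f : Set A) := by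
    rw [MonoidHom.coe_mrange, Set.union_eq_left]
    rintro x ⟨s, hs⟩
    exact ⟨s⁻¹, by rw [← hf, hs, star_star]⟩
  rw [h1, Submonoid.closure_eq, MonoidHom.coe_mrange]

theorem denseRange_linearCombination {A : Type*} [NormedRing A] [StarRing A] [NormedAlgebra ℂ A]
    [StarModule ℂ A] [ContinuousStar A] (f : Γ →* A) (hf : ∀ s, star (f s) = f s⁻¹)
    {B : StarSubalgebra ℂ A} (hB : B = (StarAlgebra.adjoin ℂ (Set.range f)).topologicalClosure)
    (g : Γ → B) (hg : ∀ s, (g s : A) = f s) :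
    DenseRange (Finsupp.linearCombination ℂ g) := by
  intro x
  have hx : (x : A) ∈ closure (Submodule.span ℂ (Set.range f) : Set A) := by
    have := hB.le x.2
    rw [← SetLike.mem_coe, StarSubalgebra.topologicalClosure_coe] at this
    rwa [← adjoin_range_eq_span f hf]
  refine closure_subtype.2 (closure_mono (fun y hy => ?_) hx)
  obtain ⟨c, rfl⟩ := (Finsupp.mem_span_range_iff_exists_finsupp).1 hy
  refine ⟨_, ⟨c, rfl⟩, ?_⟩
  simp [Finsupp.linearCombination_apply, Finsupp.sum, hg]

/-- Norm domination on the group algebra gives a continuous linear extension; multiplicativity and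
the *-property are checked on group elements and pass to the closure. -/
theorem exists_starAlgHom_of_norm_le {A B : Type*} [NormedRing A] [NormedAlgebra ℂ A] [StarRing A]
    [ContinuousStar A] [StarModule ℂ A] [NormedRing B] [NormedAlgebra ℂ B] [StarRing B]
    [ContinuousStar B] [StarModule ℂ B] [CompleteSpace B] (f : Γ →* A) (g : Γ →* B)
    (hf : ∀ s, star (f s) = f s⁻¹) (hg : ∀ s, star (g s) = g s⁻¹)
    (hd : DenseRange (Finsupp.linearCombination ℂ f))
    (hn : ∀ c, ‖Finsupp.linearCombination ℂ g c‖ ≤ ‖Finsupp.linearCombination ℂ f c‖) :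
    ∃ Φ : A →⋆ₐ[ℂ] B, ∀ s, Φ (f s) = g s := by
  let F : A →L[ℂ] B := (Finsupp.linearCombination ℂ g).extendOfNorm (Finsupp.linearCombination ℂ f)
  have hF : ∀ c, F (Finsupp.linearCombination ℂ f c) = Finsupp.linearCombination ℂ g c :=
    LinearMap.extendOfNorm_eq hd ⟨1, by simpa using hn⟩
  have hFs : ∀ s, F (f s) = g s := fun s => by simpa using hF (Finsupp.single s 1)
  have hF1 : F 1 = 1 := by rw [← map_one f, hFs, map_one]
  have hmul : ∀ x y, F (x * y) = F x * F y := fun x y => by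
    refine hd.induction_on₂ (isClosed_eq (by fun_prop) (by fun_prop)) (fun c d => ?_) x y
    induction c using Finsupp.induction_linear with
    | zero => simp
    | add c c' hc hc' => simp [add_mul, hc, hc']
    | single s z =>
      induction d using Finsupp.induction_linear with
      | zero => simp
      | add d d' hd hd' => rw [map_add, mul_add, map_add, hd, hd', map_add, mul_add]
      | single t w =>
        simp only [Finsupp.linearCombination_single, smul_mul_smul_comm, map_smul, ← map_mul, hFs]
  have hstar : ∀ x, F (star x) = star (F x) := fun x => by
    refine hd.induction_on x (isClosed_eq (by fun_prop) (by fun_prop)) fun c => ?_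
    induction c using Finsupp.induction_linear with
    | zero => simp
    | add c c' hc hc' => simp [hc, hc']
    | single s z => simp [hf, hg, hFs]
  exact ⟨{ toFun := F
           map_one' := hF1
           map_mul' := hmul
           map_zero' := map_zero F
           map_add' := map_add F
           commutes' := fun r => by rw [Algebra.algebraMap_eq_smul_one, map_smul, hF1,
             Algebra.algebraMap_eq_smul_one]
           map_star' := hstar }, hFs⟩

end GroupGenerated

/-! ### The universal representation -/

section UnitaryReps

variable {G : Type*} [Group G] {H : Type*} [NormedAddCommGroup H] [InnerProductSpace ℂ H]

/-- A unitary representation as a homomorphism into the bounded operators. -/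
def UnitaryRep.opHom (π : UnitaryRep G H) : G →* (H →L[ℂ] H) where
  toFun := UnitaryRep.op π
  map_one' := by ext x; simp
  map_mul' s t := by ext x; simp

variable [CompleteSpace H]

theorem UnitaryRep.star_op (π : UnitaryRep G H) (s : G) :
    star (UnitaryRep.op π s) = UnitaryRep.op π s⁻¹ := by
  rw [ContinuousLinearMap.star_eq_adjoint]
  symm
  rw [ContinuousLinearMap.eq_adjoint_iff]
  intro x y
  rw [UnitaryRep.op_apply, UnitaryRep.op_apply, ← LinearIsometryEquiv.inner_map_map (π s)]
  congr 1
  simp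

/-- The canonical homomorphism of `G` into the C*-algebra generated by a representation. -/
def UnitaryRep.cstarHom (π : UnitaryRep G H) : G →* UnitaryRep.cstar π where
  toFun := UnitaryRep.cstarOf π
  map_one' := Subtype.ext (map_one (UnitaryRep.opHom π))
  map_mul' s t := Subtype.ext (map_mul (UnitaryRep.opHom π) s t)

theorem UnitaryRep.cstarHom_apply (π : UnitaryRep G H) (s : G) :
    UnitaryRep.cstarHom π s = UnitaryRep.cstarOf π s := rfl

theorem UnitaryRep.star_cstarHom (π : UnitaryRep G H) (s : G) :
    star (UnitaryRep.cstarHom π s) = UnitaryRep.cstarHom π s⁻¹ :=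
  Subtype.ext (UnitaryRep.star_op π s)

theorem UnitaryRep.denseRange_cstarHom (π : UnitaryRep G H) :
    DenseRange (Finsupp.linearCombination ℂ (UnitaryRep.cstarHom π)) :=
  denseRange_linearCombination (UnitaryRep.opHom π) (UnitaryRep.star_op π) rfl _ fun _ => rfl

theorem UnitaryRep.coe_linearCombination_cstarHom (π : UnitaryRep G H) (c : G →₀ ℂ) :
    (Finsupp.linearCombination ℂ (UnitaryRep.cstarHom π) c : H →L[ℂ] H)
      = Finsupp.linearCombination ℂ (UnitaryRep.op π) c := by
  simp [Finsupp.linearCombination_apply, Finsupp.sum, UnitaryRep.cstarHom_apply,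
    UnitaryRep.cstarOf]

end UnitaryReps

section Universal

variable {G : Type u} [Group G]

/-- The matrix of operators `∑ s ∈ S, c(s) ⊗ π(s)` with scalar coefficient matrices `c(s)`. -/
def repMatrix {H : Type*} [NormedAddCommGroup H] [InnerProductSpace ℂ H] {ι : Type*}
    (π : UnitaryRep G H) (S : Finset G) (c : G → Matrix ι ι ℂ) : Matrix ι ι (H →L[ℂ] H) :=
  Matrix.of fun i j => ∑ s ∈ S, c s i j • UnitaryRep.op π s

theorem repMatrix_apply {H : Type*} [NormedAddCommGroup H] [InnerProductSpace ℂ H] {ι : Type*}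
    (π : UnitaryRep G H) (S : Finset G) (c : G → Matrix ι ι ℂ) (i j : ι) :
    repMatrix π S c i j = ∑ s ∈ S, c s i j • UnitaryRep.op π s := rfl

theorem universalRep_apply (s : G) (x : lp (fun σ : CyclicRep G => σ.carrier) 2)
    (σ : CyclicRep G) : (universalRep G s x : ∀ σ : CyclicRep G, σ.carrier) σ = σ.rep s (x σ) := rfl

theorem repMatrix_universalRep_apply {ι : Type*} (S : Finset G) (c : G → Matrix ι ι ℂ) (i j : ι)
    (x : lp (fun σ : CyclicRep G => σ.carrier) 2) (σ : CyclicRep G) :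
    (repMatrix (universalRep G) S c i j x : ∀ σ : CyclicRep G, σ.carrier) σ
      = repMatrix σ.rep S c i j (x σ) := by
  simp only [repMatrix_apply, sum_apply, smul_apply, UnitaryRep.op_apply, lp.coeFn_sum,
    Finset.sum_apply, lp.coeFn_smul, Pi.smul_apply, universalRep_apply]

theorem lp_hasSum_norm_sq {I : Type*} {E : I → Type*} [∀ i, NormedAddCommGroup (E i)]
    (x : lp E 2) : HasSum (fun i => ‖x i‖ ^ 2) (‖x‖ ^ 2) := by
  simpa using lp.hasSum_norm (p := 2) (by simp) x

/-- The norm of a matrix over `C*(G)` is determined by the cyclic representations. -/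
theorem norm_repMatrix_universalRep_le {ι : Type*} [Fintype ι] (S : Finset G)
    (c : G → Matrix ι ι ℂ) {C : ℝ} (hC : 0 ≤ C)
    (h : ∀ σ : CyclicRep G, ‖opMatrix (repMatrix σ.rep S c)‖ ≤ C) :
    ‖opMatrix (repMatrix (universalRep G) S c)‖ ≤ C := by
  refine ContinuousLinearMap.opNorm_le_bound _ hC fun X => ?_
  refine le_of_sq_le_sq ?_ (by positivity)
  have hsum : ∀ Z : PiLp 2 fun _ : ι => lp (fun σ : CyclicRep G => σ.carrier) 2,
      HasSum (fun σ : CyclicRep G =>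
        ‖(WithLp.toLp 2 fun i => Z i σ : PiLp 2 fun _ : ι => σ.carrier)‖ ^ 2) (‖Z‖ ^ 2) := by
    intro Z
    simp_rw [PiLp.norm_sq_eq_of_L2]
    exact hasSum_sum fun i _ => lp_hasSum_norm_sq (Z i)
  have h2 := (hsum X).mul_left (C ^ 2)
  rw [← mul_pow] at h2
  refine hasSum_le (fun σ => ?_) (hsum (opMatrix (repMatrix (universalRep G) S c) X)) h2
  rw [← mul_pow]
  refine pow_le_pow_left₀ (norm_nonneg _) ?_ 2
  have e : (WithLp.toLp 2 fun i => opMatrix (repMatrix (universalRep G) S c) X i σ :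
      PiLp 2 fun _ : ι => σ.carrier)
      = opMatrix (repMatrix σ.rep S c) (WithLp.toLp 2 fun i => X i σ) := by
    ext i
    simp only [opMatrix_apply, lp.coeFn_sum, Finset.sum_apply, repMatrix_universalRep_apply]
  rw [e]
  exact (ContinuousLinearMap.le_opNorm _ _).trans (by gcongr; exact h σ)

theorem norm_linearCombination_cyclic_le (σ : CyclicRep G) (c : G →₀ ℂ) (x : σ.carrier) :
    ‖Finsupp.linearCombination ℂ (UnitaryRep.op σ.rep) c x‖
      ≤ ‖Finsupp.linearCombination ℂ (UnitaryRep.op (universalRep G)) c‖ * ‖x‖ := by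
  classical
  let X : lp (fun σ : CyclicRep G => σ.carrier) 2 := lp.single 2 σ x
  have h : (Finsupp.linearCombination ℂ (UnitaryRep.op (universalRep G)) c X :
      ∀ σ : CyclicRep G, σ.carrier) σ = Finsupp.linearCombination ℂ (UnitaryRep.op σ.rep) c x := by
    simp only [Finsupp.linearCombination_apply, Finsupp.sum, sum_apply, smul_apply,
      UnitaryRep.op_apply, lp.coeFn_sum, Finset.sum_apply, lp.coeFn_smul, Pi.smul_apply,
      universalRep_apply, X, lp.single_apply_self]
  rw [← h]
  refine (lp.norm_apply_le_norm (by simp) _ σ).trans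
    ((ContinuousLinearMap.le_opNorm _ _).trans_eq ?_)
  rw [lp.norm_single (by simp)]

/-- Each vector ξ lies in its cyclic subspace, and the restriction of π to that subspace is a
summand of the universal representation. -/
theorem norm_linearCombination_op_le {H : Type u} [NormedAddCommGroup H] [InnerProductSpace ℂ H]
    [CompleteSpace H] (π : UnitaryRep G H) (c : G →₀ ℂ) :
    ‖Finsupp.linearCombination ℂ (UnitaryRep.op π) c‖
      ≤ ‖Finsupp.linearCombination ℂ (UnitaryRep.op (universalRep G)) c‖ := by
  refine ContinuousLinearMap.opNorm_le_bound _ (norm_nonneg _) fun ξ => ?_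
  let M := UnitaryRep.cyclicSubspace π ξ
  have : CompleteSpace M := (Submodule.isClosed_topologicalClosure _).completeSpace_coe
  let σ : CyclicRep G := ⟨M, UnitaryRep.sub π M (UnitaryRep.cyclicSubspace_invariant π ξ), _,
    UnitaryRep.isCyclicVector_sub π ξ⟩
  let ξ' : M := ⟨ξ, UnitaryRep.self_mem_cyclicSubspace π ξ⟩
  have h := norm_linearCombination_cyclic_le σ c ξ'
  have h2 : ((Finsupp.linearCombination ℂ (UnitaryRep.op σ.rep) c ξ' : M) : H)
      = Finsupp.linearCombination ℂ (UnitaryRep.op π) c ξ := by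
    simp only [Finsupp.linearCombination_apply, Finsupp.sum, sum_apply, smul_apply,
      UnitaryRep.op_apply]
    simp [σ, ξ']
  rw [← h2]
  exact h

instance instIsClosedCstar {H : Type*} [NormedAddCommGroup H] [InnerProductSpace ℂ H]
    [CompleteSpace H] (π : UnitaryRep G H) : IsClosed (UnitaryRep.cstar π : Set (H →L[ℂ] H)) :=
  StarSubalgebra.isClosed_topologicalClosure _

/-- Every unitary representation extends to the full group C*-algebra. -/
theorem exists_starAlgHom_fullCStar {H : Type u} [NormedAddCommGroup H] [InnerProductSpace ℂ H]
    [CompleteSpace H] (π : UnitaryRep G H) :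
    ∃ Φ : fullCStar G →⋆ₐ[ℂ] (H →L[ℂ] H), ∀ s, Φ (fullCStarOf G s) = UnitaryRep.op π s := by
  refine exists_starAlgHom_of_norm_le (UnitaryRep.cstarHom (universalRep G)) (UnitaryRep.opHom π)
    (UnitaryRep.star_cstarHom _) (UnitaryRep.star_op π) (UnitaryRep.denseRange_cstarHom _)
    fun c => ?_
  refine (norm_linearCombination_op_le π c).trans_eq ?_
  rw [← UnitaryRep.coe_linearCombination_cstarHom]
  rfl

/-- Matrices over `C*(G)` of the form `∑ s ∈ S, c(s) ⊗ ϖ(s)`. -/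
noncomputable def fullMatrix {ι : Type*} (S : Finset G) (c : G → Matrix ι ι ℂ) :
    Matrix ι ι (fullCStar G) :=
  Matrix.of fun i j => ∑ s ∈ S, c s i j • fullCStarOf G s

theorem fullMatrix_map_coe {ι : Type*} (S : Finset G) (c : G → Matrix ι ι ℂ) :
    ((fullMatrix S c).map fun a => (a : lp (fun σ : CyclicRep G => σ.carrier) 2 →L[ℂ] _))
      = repMatrix (universalRep G) S c := by
  ext i j : 2
  simp [fullMatrix, repMatrix_apply, UnitaryRep.cstarOf]

theorem matNorm_fullMatrix {ι : Type} [Fintype ι] [DecidableEq ι] (S : Finset G)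
    (c : G → Matrix ι ι ℂ) :
    matNorm (fullMatrix S c) = ‖opMatrix (repMatrix (universalRep G) S c)‖ := by
  rw [starSubalgebra_matNorm_def, fullMatrix_map_coe]

/-- Matricial form of `norm_linearCombination_op_le`. It follows from complete contractivity of the
extension of π to C*(G), whose inclusion in the bounded operators is injective. -/
theorem norm_repMatrix_le_universalRep {H : Type u} [NormedAddCommGroup H] [InnerProductSpace ℂ H]
    [CompleteSpace H] (π : UnitaryRep G H) {ι : Type*} [Fintype ι] (S : Finset G)
    (c : G → Matrix ι ι ℂ) :
    ‖opMatrix (repMatrix π S c)‖ ≤ ‖opMatrix (repMatrix (universalRep G) S c)‖ := by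
  obtain ⟨Φ, hΦ⟩ := exists_starAlgHom_fullCStar π
  have h := norm_opMatrix_map_le Φ (fullCStar G).subtype Subtype.val_injective (fullMatrix S c)
  have h1 : (fullMatrix S c).map Φ = repMatrix π S c := by
    ext i j : 2
    simp [fullMatrix, repMatrix_apply, hΦ]
  have h2 : (fullMatrix S c).map (fullCStar G).subtype = repMatrix (universalRep G) S c :=
    fullMatrix_map_coe S c
  rwa [h1, h2] at h

end Universal

/-! ### Multiplication by coefficient functions is completely bounded -/

section Multipliers

variable {G : Type u} [Group G]

theorem fs_matNorm_def {ι : Type} [Fintype ι] [DecidableEq ι]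
    (u : Matrix ι ι (fourierStieltjes G)) : matNorm u = matNorm (u.map fsToDual) := rfl

theorem norm_coords {H : Type*} [NormedAddCommGroup H] [InnerProductSpace ℂ H] {ι κ : Type*}
    [Fintype ι] [Fintype κ] {f : κ → H} (hf : Orthonormal ℂ f) (X : PiLp 2 fun _ : ι => H)
    (c : ι → κ → ℂ) (hc : ∀ i, X i = ∑ n, c i n • f n) :
    ‖(WithLp.toLp 2 fun p : ι × κ => c p.1 p.2 : EuclideanSpace ℂ (ι × κ))‖ = ‖X‖ := by
  have h : ‖(WithLp.toLp 2 fun p : ι × κ => c p.1 p.2 : EuclideanSpace ℂ (ι × κ))‖ ^ 2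
      = ‖X‖ ^ 2 := by
    rw [EuclideanSpace.norm_sq_eq, PiLp.norm_sq_eq_of_L2, Fintype.sum_prod_type]
    simp_rw [hc, hf.norm_sq_sum_smul]
  exact (pow_left_inj₀ (norm_nonneg _) (norm_nonneg _) two_ne_zero).1 h

/-- Multiplying by the coefficients of `τ` with respect to an orthonormal family is completely
contractive. -/
theorem norm_repMatrix_coeff_le (τ : CyclicRep G) {N : ℕ} {h : Fin N → τ.carrier}
    (hh : Orthonormal ℂ h) {ν : Type*} [Fintype ν] (S : Finset G) (d : G → Matrix ν ν ℂ) :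
    ‖opMatrix (repMatrix (universalRep G) S fun s => Matrix.of fun p q : ν × Fin N =>
        ⟪h p.2, τ.rep s (h q.2)⟫_ℂ * d s p.1 q.1)‖
      ≤ ‖opMatrix (repMatrix (universalRep G) S d)‖ := by
  refine norm_repMatrix_universalRep_le S _ (norm_nonneg _) fun κ => ?_
  -- The key step: κ ⊗ τ is again a unitary representation, hence dominated by ϖ, and slicing its
  -- second leg along h multiplies the coefficients by ⟨h n, τ(s) h m⟩.
  refine le_trans ?_ (norm_repMatrix_le_universalRep (UnitaryRep.tensor κ.rep τ.rep) S d)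
  let g : Fin N → PiLp 2 fun _ : Unit => τ.carrier := fun n => WithLp.toLp 2 fun _ => h n
  have hg : Orthonormal ℂ g := by
    rw [orthonormal_iff_ite] at hh ⊢
    intro i j
    rw [← hh i j]
    simp [g, PiLp.inner_apply]
  have h1 := norm_opMatrix_slice_le hg S
    (fun s => Matrix.of fun i j : ν => d s i j • UnitaryRep.op κ.rep s)
    (fun s => Matrix.of fun _ _ : Unit => UnitaryRep.op τ.rep s)
  have h2 : (Matrix.of fun p q : ν × Fin N => ∑ t ∈ S,
      ⟪g p.2, opMatrix (Matrix.of fun _ _ : Unit => UnitaryRep.op τ.rep t) (g q.2)⟫_ℂ •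
        (Matrix.of fun i j : ν => d t i j • UnitaryRep.op κ.rep t) p.1 q.1)
      = repMatrix κ.rep S fun s => Matrix.of fun p q : ν × Fin N =>
        ⟪h p.2, τ.rep s (h q.2)⟫_ℂ * d s p.1 q.1 := by
    ext p q : 2
    simp [repMatrix_apply, inner_opMatrix, g, smul_smul]
  rw [h2] at h1
  refine h1.trans ?_
  have h3 := norm_opMatrix_submatrix_le (f := fun p : ν × Unit => p.1)
    (fun p q h => Prod.ext h rfl) (repMatrix (UnitaryRep.tensor κ.rep τ.rep) S d)
  refine le_of_eq_of_le (congrArg (fun a : Matrix (ν × Unit) (ν × Unit)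
    (HilbertTensor κ.carrier τ.carrier →L[ℂ] _) => ‖opMatrix a‖) ?_) h3
  ext p q : 2
  simp only [Matrix.of_apply, opTensor_smul_left, Matrix.submatrix_apply, repMatrix_apply]
  rfl

theorem inner_repMatrix_coords {H : Type*} [NormedAddCommGroup H] [InnerProductSpace ℂ H]
    {ι κ : Type*} [Fintype κ] (π : UnitaryRep G H) (S : Finset G) (c : G → Matrix ι ι ℂ) (i j : ι)
    (h : κ → H) (x y : κ → ℂ) :
    ⟪∑ n, y n • h n, repMatrix π S c i j (∑ m, x m • h m)⟫_ℂ
      = ∑ n, ∑ m, star (y n) * (∑ s ∈ S, c s i j * ⟪h n, π s (h m)⟫_ℂ) * x m := by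
  simp only [sum_inner, map_sum, inner_sum, map_smul, inner_smul_left, inner_smul_right,
    Finset.mul_sum, repMatrix_apply, sum_apply, smul_apply, UnitaryRep.op_apply, Finset.sum_mul]
  rw [Finset.sum_comm (t := (Finset.univ : Finset κ)) (s := (Finset.univ : Finset κ))]
  simp_rw [Finset.sum_comm (s := S)]
  refine Finset.sum_congr rfl fun n _ => Finset.sum_congr rfl fun m _ =>
    Finset.sum_congr rfl fun s _ => ?_
  rw [RCLike.star_def]
  ring

set_option maxHeartbeats 1000000 in
/-- `C*(G)` is a completely contractive `B(G)`-module. -/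
theorem norm_repMatrix_mul_le {ι ν : Type} [Fintype ι] [DecidableEq ι] [Fintype ν] [DecidableEq ν]
    (u : Matrix ι ι (fourierStieltjes G)) (S : Finset G) (d : G → Matrix ν ν ℂ) :
    ‖opMatrix (repMatrix (universalRep G) S fun s => Matrix.of fun p q : ι × ν =>
        (u p.1 q.1 : G → ℂ) s * d s p.2 q.2)‖
      ≤ matNorm u * ‖opMatrix (repMatrix (universalRep G) S d)‖ := by
  have hu : 0 ≤ matNorm u := dual_matNorm_nonneg _
  refine norm_repMatrix_universalRep_le S _ (mul_nonneg hu (norm_nonneg _)) fun τ => ?_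
  refine norm_opMatrix_le _ (mul_nonneg hu (norm_nonneg _)) fun X Y => ?_
  -- In a common orthonormal basis of the entries of X and Y the form becomes a scalar matrix. That
  -- matrix consists of the functionals u i j evaluated at the entries of the matrix over C*(G) with
  -- coefficients `e`, so the completely bounded norm of u applies, and `norm_repMatrix_coeff_le`
  -- removes the coefficients of τ.
  obtain ⟨N, h, hh, c, hc⟩ := exists_orthonormal_coords (Sum.elim X Y)
  let e : G → Matrix (ν × Fin N) (ν × Fin N) ℂ := fun s => Matrix.of fun p q =>
    ⟪h p.2, τ.rep s (h q.2)⟫_ℂ * d s p.1 q.1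
  have hb := norm_dual_apply_le (u.map fsToDual) (fullMatrix S e)
  rw [matNorm_fullMatrix] at hb
  have hb' := hb.trans (mul_le_mul_of_nonneg_left (norm_repMatrix_coeff_le τ hh S d) hu)
  have hX := norm_coords hh X (fun i => c (.inl i)) fun i => hc (.inl i)
  have hY := norm_coords hh Y (fun i => c (.inr i)) fun i => hc (.inr i)
  let r := Equiv.prodAssoc ι ν (Fin N)
  have hb2 := (norm_scalarMatrix_submatrix_le r.injective
    (Matrix.of fun p q : ι × (ν × Fin N) =>
      u.map fsToDual p.1 q.1 (fullMatrix S e p.2 q.2))).trans hb'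
  rw [← hX, ← hY]
  refine le_trans ?_ ((norm_sum_scalarMatrix_le _ _ _).trans
    (mul_le_mul_of_nonneg_right (mul_le_mul_of_nonneg_right hb2 (norm_nonneg _)) (norm_nonneg _)))
  refine le_of_eq (congrArg norm ?_)
  simp_rw [Fintype.sum_prod_type (α₂ := Fin N)]
  refine Finset.sum_congr rfl fun p _ => ?_
  rw [Finset.sum_comm]
  refine Finset.sum_congr rfl fun q _ => ?_
  have hXq := hc (.inl q)
  have hYp := hc (.inr p)
  simp only [Sum.elim_inl, Sum.elim_inr] at hXq hYp
  rw [hXq, hYp, inner_repMatrix_coords]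
  refine Finset.sum_congr rfl fun n _ => Finset.sum_congr rfl fun m _ => ?_
  have hval : fsToDual (u p.1 q.1) (fullMatrix S e (p.2, n) (q.2, m))
      = ∑ s ∈ S, (u p.1 q.1 : G → ℂ) s * d s p.2 q.2 * ⟪h n, τ.rep s (h m)⟫_ℂ := by
    simp only [fullMatrix, Matrix.of_apply, map_sum, map_smul, fsToDual_apply, e, smul_eq_mul]
    exact Finset.sum_congr rfl fun s _ => by ring
  simp only [Matrix.of_apply, Matrix.submatrix_apply, Matrix.map_apply]
  rw [← hval]
  rfl

/-- `C*(G) ⊗_min B(H)` is a completely contractive `B(G)`-module. -/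
theorem norm_opTensor_mul_le {K : Type*} [NormedAddCommGroup K] [InnerProductSpace ℂ K]
    {ι κ : Type} [Fintype ι] [DecidableEq ι] [Fintype κ]
    [DecidableEq κ] (u : Matrix ι ι (fourierStieltjes G)) (S : Finset G)
    (T : G → Matrix κ κ (K →L[ℂ] K)) :
    ‖opMatrix (Matrix.of fun p q : ι × κ => ∑ s ∈ S,
        (u p.1 q.1 : G → ℂ) s • opTensor (UnitaryRep.op (universalRep G) s) (T s p.2 q.2))‖
      ≤ matNorm u * ‖opMatrix (Matrix.of fun p q : κ => ∑ s ∈ S,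
        opTensor (UnitaryRep.op (universalRep G) s) (T s p q))‖ := by
  have hu : 0 ≤ matNorm u := dual_matNorm_nonneg _
  -- After slicing the second leg, only scalar-weighted sums of ϖ(s) remain, for which
  -- `norm_repMatrix_mul_le` gives the bound. Slicing is contractive, so the right side returns to
  -- the unsliced norm.
  have key := norm_opMatrix_opTensor_le S
    (fun s => Matrix.of fun i j : ι => (u i j : G → ℂ) s • UnitaryRep.op (universalRep G) s) T
    (C := matNorm u * ‖opMatrix (Matrix.of fun p q : κ => ∑ s ∈ S,
        opTensor (UnitaryRep.op (universalRep G) s) (T s p q))‖)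
    (mul_nonneg hu (norm_nonneg _)) fun N g hg => ?_
  · simpa only [Matrix.of_apply, opTensor_smul_left] using key
  let d : G → Matrix (Fin N) (Fin N) ℂ := fun s => Matrix.of fun n m =>
    ⟪g n, opMatrix (T s) (g m)⟫_ℂ
  have h1 := norm_repMatrix_mul_le u S d
  have h2 := norm_opMatrix_slice_le hg S
    (fun s => Matrix.of fun _ _ : Unit => UnitaryRep.op (universalRep G) s) T
  have h3 := norm_opMatrix_submatrix_le (f := fun p : Unit × κ => p.2)
    (fun p q h => Prod.ext rfl h) (Matrix.of fun p q : κ => ∑ s ∈ S,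
        opTensor (UnitaryRep.op (universalRep G) s) (T s p q))
  have h4 := norm_opMatrix_submatrix_le (f := fun n : Fin N => ((), n))
    (fun p q h => (Prod.ext_iff.1 h).2) (Matrix.of fun p q : Unit × Fin N => ∑ t ∈ S,
      ⟪g p.2, opMatrix (T t) (g q.2)⟫_ℂ •
        (Matrix.of fun _ _ : Unit => UnitaryRep.op (universalRep G) t) p.1 q.1)
  refine le_trans (le_of_eq (congrArg (fun a : Matrix (ι × Fin N) (ι × Fin N)
      (lp (fun σ : CyclicRep G => σ.carrier) 2 →L[ℂ] _) => ‖opMatrix a‖) ?_))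
    (h1.trans (mul_le_mul_of_nonneg_left (h4.trans (h2.trans h3)) hu))
  ext p q : 2
  simp [repMatrix_apply, d, smul_smul, mul_comm]

end Multipliers

/-! ### The flip of the tensor factors. -/

section Flip

variable {H : Type*} [NormedAddCommGroup H] [InnerProductSpace ℂ H]
variable {K : Type*} [NormedAddCommGroup K] [InnerProductSpace ℂ K]

theorem exists_flip : ∃ W : HilbertTensor H K →ₗᵢ[ℂ] HilbertTensor K H,
    ∀ x y, W (HilbertTensor.incl H K (x ⊗ₜ y)) = HilbertTensor.incl K H (y ⊗ₜ x) := by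
  let F : HilbertTensor H K →L[ℂ] HilbertTensor K H :=
    ((TensorProduct.commIsometry ℂ H K).toContinuousLinearEquiv.toContinuousLinearMap).completion
  have hF : ∀ z, F (HilbertTensor.incl H K z)
      = HilbertTensor.incl K H (TensorProduct.comm ℂ H K z) := fun z =>
    ContinuousLinearMap.completion_apply_coe _ z
  refine ⟨⟨F.toLinearMap, fun z => ?_⟩, fun x y => hF _⟩
  refine HilbertTensor.denseRange_incl.induction_on z
    (isClosed_eq (by simp only [ContinuousLinearMap.coe_coe]; fun_prop) (by fun_prop)) fun z => ?_
  rw [ContinuousLinearMap.coe_coe, hF]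
  simp

/-- The flip is an isometry intertwining a ⊗ b with b ⊗ a. It transfers the module estimate from the
first leg to the second. -/
theorem norm_opMatrix_opTensor_flip_le {ι S : Type*} [Fintype ι] (s : Finset S)
    (c : S → Matrix ι ι ℂ) (a : S → H →L[ℂ] H) (b : S → K →L[ℂ] K) :
    ‖opMatrix (Matrix.of fun i j : ι => ∑ t ∈ s, c t i j • opTensor (a t) (b t))‖
      ≤ ‖opMatrix (Matrix.of fun i j : ι => ∑ t ∈ s, c t i j • opTensor (b t) (a t))‖ := by
  obtain ⟨W, hW⟩ := exists_flip (H := H) (K := K)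
  have hW' : ∀ t z, W (opTensor (a t) (b t) z) = opTensor (b t) (a t) (W z) := fun t z => by
    have : W.toContinuousLinearMap ∘L opTensor (a t) (b t)
        = opTensor (b t) (a t) ∘L W.toContinuousLinearMap :=
      HilbertTensor.clm_ext fun x y => by simp [opTensor_tmul, hW]
    exact congrArg (fun f => f z) this
  refine norm_opMatrix_le _ (ContinuousLinearMap.opNorm_nonneg _) fun X Y => ?_
  have hn : ∀ Z : PiLp 2 fun _ : ι => HilbertTensor H K,
      ‖(WithLp.toLp 2 fun i => W (Z i) : PiLp 2 fun _ : ι => HilbertTensor K H)‖ = ‖Z‖ := by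
    intro Z
    simp [PiLp.norm_eq_of_L2]
  rw [← hn X, ← hn Y]
  refine le_of_eq_of_le (congrArg norm ?_) (norm_sum_inner_le _ _ _)
  refine Finset.sum_congr rfl fun i _ => Finset.sum_congr rfl fun j _ => ?_
  simp only [Matrix.of_apply, sum_apply, smul_apply, ← hW', inner_sum, inner_smul_right,
    LinearIsometry.inner_map_map]

end Flip

/-! ### The minimal tensor square of `C*(G)` -/

section MinSquare

variable {G : Type u} [Group G]

theorem continuous_opMatrix {H : Type*} [NormedAddCommGroup H] [InnerProductSpace ℂ H]
    {ι : Type*} [Fintype ι] : Continuous fun a : Matrix ι ι (H →L[ℂ] H) => opMatrix a := by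
  refine continuous_iff_continuousAt.2 fun b => ?_
  refine (tendsto_iff_norm_sub_tendsto_zero
    (E := (PiLp 2 fun _ : ι => H) →L[ℂ] PiLp 2 fun _ : ι => H)).2 ?_
  have hsub : ∀ a, opMatrix a - opMatrix b = opMatrix (a - b) := fun a => by
    rw [eq_comm, eq_sub_iff_add_eq, ← opMatrix_add, sub_add_cancel]
  simp_rw [hsub]
  refine squeeze_zero (fun a => ContinuousLinearMap.opNorm_nonneg _)
    (fun a => norm_opMatrix_le_sum (a - b)) ?_
  have hc : Continuous fun a : Matrix ι ι (H →L[ℂ] H) => ∑ i, ∑ j, ‖(a - b) i j‖ := by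
    simp only [Matrix.sub_apply]
    fun_prop
  simpa using hc.tendsto b

theorem continuous_matNorm {H : Type*} [NormedAddCommGroup H] [InnerProductSpace ℂ H]
    [CompleteSpace H] (A : StarSubalgebra ℂ (H →L[ℂ] H)) {ι : Type} [Fintype ι] [DecidableEq ι] :
    Continuous fun x : Matrix ι ι A => matNorm x := by
  simp only [starSubalgebra_matNorm_def]
  exact (continuous_opMatrix.comp (continuous_id.matrix_map continuous_subtype_val)).norm

theorem norm_entry_le_matNorm {H : Type*} [NormedAddCommGroup H] [InnerProductSpace ℂ H]
    [CompleteSpace H] {A : StarSubalgebra ℂ (H →L[ℂ] H)} {ι : Type} [Fintype ι] [DecidableEq ι]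
    (x : Matrix ι ι A) (i j : ι) : ‖x i j‖ ≤ matNorm x :=
  norm_entry_le_norm_opMatrix (x.map fun a : A => (a : H →L[ℂ] H)) i j

instance instIsClosedMinTensor {H K : Type*} [NormedAddCommGroup H] [InnerProductSpace ℂ H]
    [NormedAddCommGroup K] [InnerProductSpace ℂ K] [CompleteSpace H] [CompleteSpace K]
    (A : StarSubalgebra ℂ (H →L[ℂ] H)) (B : StarSubalgebra ℂ (K →L[ℂ] K)) :
    IsClosed (minTensor A B : Set (HilbertTensor H K →L[ℂ] HilbertTensor H K)) :=
  StarSubalgebra.isClosed_topologicalClosure _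

variable (G) in
/-- The operators `ϖ(s) ⊗ ϖ(t)`. -/
noncomputable def tensorHom : G × G →*
    (HilbertTensor (lp (fun σ : CyclicRep G => σ.carrier) 2)
        (lp (fun σ : CyclicRep G => σ.carrier) 2) →L[ℂ]
      HilbertTensor (lp (fun σ : CyclicRep G => σ.carrier) 2)
        (lp (fun σ : CyclicRep G => σ.carrier) 2)) where
  toFun g := opTensor (UnitaryRep.op (universalRep G) g.1) (UnitaryRep.op (universalRep G) g.2)
  map_one' := by
    have h : UnitaryRep.op (universalRep G) 1 = 1 := map_one (UnitaryRep.opHom (universalRep G))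
    simp [h, opTensor_one]
  map_mul' g h := by
    have e : ∀ s t, UnitaryRep.op (universalRep G) (s * t)
        = UnitaryRep.op (universalRep G) s * UnitaryRep.op (universalRep G) t :=
      map_mul (UnitaryRep.opHom (universalRep G))
    simp [e, opTensor_mul]

theorem tensorHom_apply (g : G × G) : tensorHom G g
    = opTensor (UnitaryRep.op (universalRep G) g.1) (UnitaryRep.op (universalRep G) g.2) := rfl

theorem star_tensorHom (g : G × G) : star (tensorHom G g) = tensorHom G g⁻¹ := by
  rw [tensorHom_apply, ← opTensor_star, UnitaryRep.star_op, UnitaryRep.star_op]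
  rfl

/-- Separate continuity of (a, b) ↦ a ⊗ b allows the two legs to be approximated one after the other
by combinations of the ϖ(s). Thus the minimal tensor square is generated by a group of unitaries,
and identities can be checked on these. -/
theorem minSquare_eq_closure :
    minSquare G = (StarAlgebra.adjoin ℂ (Set.range (tensorHom G))).topologicalClosure := by
  refine le_antisymm ?_ ?_
  · refine StarSubalgebra.topologicalClosure_minimal
      (StarAlgebra.adjoin_le ?_) (StarSubalgebra.isClosed_topologicalClosure _)
    rintro _ ⟨a, ha, b, hb, rfl⟩
    have hB := StarSubalgebra.isClosed_topologicalClosure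
      (StarAlgebra.adjoin ℂ (Set.range (tensorHom G)))
    set B := (StarAlgebra.adjoin ℂ (Set.range (tensorHom G))).topologicalClosure
    have hmem : ∀ c ∈ fullCStar G, c ∈ closure (Submodule.span ℂ
        (Set.range (UnitaryRep.op (universalRep G))) : Set _) := fun c hc => by
      have := adjoin_range_eq_span (UnitaryRep.opHom (universalRep G)) (UnitaryRep.star_op _)
      have hc' : c ∈ closure ((StarAlgebra.adjoin ℂ
        (Set.range (UnitaryRep.op (universalRep G)))) : Set _) := hc
      refine closure_mono (fun x hx => ?_) hc'
      exact this.le hx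
    have h1 : ∀ s, ∀ b ∈ fullCStar G,
        opTensor (UnitaryRep.op (universalRep G) s) b ∈ B := fun s b hb => by
      refine hB.closure_subset (map_mem_closure (continuous_opTensor_right _) (hmem b hb) ?_)
      intro y hy
      induction hy using Submodule.span_induction with
      | mem y hy =>
        obtain ⟨t, rfl⟩ := hy
        exact StarSubalgebra.le_topologicalClosure _ (StarAlgebra.subset_adjoin ℂ _ ⟨(s, t), rfl⟩)
      | zero =>
        have := opTensor_smul_right 0 (UnitaryRep.op (universalRep G) s)
          (0 : lp (fun σ : CyclicRep G => σ.carrier) 2 →L[ℂ] _)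
        rw [zero_smul, zero_smul] at this
        rw [this]
        exact zero_mem B
      | add y z _ _ hy hz => rw [opTensor_add_right]; exact add_mem hy hz
      | smul c y _ hy => rw [opTensor_smul_right]; exact SMulMemClass.smul_mem c hy
    refine hB.closure_subset (map_mem_closure
      (f := fun a => opTensor a b) (continuous_opTensor_left b) (hmem a ha) ?_)
    intro y hy
    induction hy using Submodule.span_induction with
    | mem y hy => obtain ⟨s, rfl⟩ := hy; exact h1 s b hb
    | zero =>
      have := opTensor_smul_left 0 (0 : lp (fun σ : CyclicRep G => σ.carrier) 2 →L[ℂ] _) b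
      rw [zero_smul, zero_smul] at this
      change opTensor 0 b ∈ B
      rw [this]
      exact zero_mem B
    | add y z _ _ hy hz =>
      change opTensor (y + z) b ∈ B
      rw [opTensor_add_left]
      exact add_mem hy hz
    | smul c y _ hy =>
      change opTensor (c • y) b ∈ B
      rw [opTensor_smul_left]
      exact SMulMemClass.smul_mem c hy
  · refine StarSubalgebra.topologicalClosure_minimal
      (StarAlgebra.adjoin_le ?_) (StarSubalgebra.isClosed_topologicalClosure _)
    rintro _ ⟨⟨s, t⟩, rfl⟩
    exact (minTmul (fullCStarOf G s) (fullCStarOf G t)).2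

variable (G) in
/-- The canonical homomorphism of `G × G` into `C*(G) ⊗_min C*(G)`. -/
noncomputable def minHom : G × G →* minSquare G where
  toFun g := minTmul (fullCStarOf G g.1) (fullCStarOf G g.2)
  map_one' := Subtype.ext (map_one (tensorHom G))
  map_mul' g h := Subtype.ext (map_mul (tensorHom G) g h)

theorem star_minHom (g : G × G) : star (minHom G g) = minHom G g⁻¹ := Subtype.ext (star_tensorHom g)

theorem denseRange_minHom : DenseRange (Finsupp.linearCombination ℂ (minHom G)) :=
  denseRange_linearCombination (tensorHom G) star_tensorHom minSquare_eq_closure _ fun _ => rfl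

theorem minSquare_clm_ext {E : Type*} [NormedAddCommGroup E] [NormedSpace ℂ E]
    {f g : minSquare G →L[ℂ] E} (h : ∀ x, f (minHom G x) = g (minHom G x)) : f = g := by
  refine ContinuousLinearMap.coeFn_injective ?_
  refine denseRange_minHom.equalizer f.continuous g.continuous ?_
  have : f.toLinearMap ∘ₗ Finsupp.linearCombination ℂ (minHom G)
      = g.toLinearMap ∘ₗ Finsupp.linearCombination ℂ (minHom G) := by
    ext x
    simpa using h x
  exact congrArg DFunLike.coe this

/-! ### The `B(G)`-module structure -/

variable {ι κ : Type} [Fintype ι] [DecidableEq ι] [Fintype κ] [DecidableEq κ]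

/-- On a product set the sum can be grouped by its first coordinate: the operators in the second leg
are ∑ t, c(s,t) ϖ(t). -/
theorem norm_tensorHom_mul_fst_le (u : Matrix ι ι (fourierStieltjes G)) (S : Finset G)
    (c : G × G → Matrix κ κ ℂ) :
    ‖opMatrix (Matrix.of fun p q : ι × κ => ∑ g ∈ S ×ˢ S,
        ((u p.1 q.1 : G → ℂ) g.1 * c g p.2 q.2) • tensorHom G g)‖
      ≤ matNorm u * ‖opMatrix (Matrix.of fun p q : κ => ∑ g ∈ S ×ˢ S,
        c g p q • tensorHom G g)‖ := by
  have h := norm_opTensor_mul_le u S fun s => Matrix.of fun k l : κ =>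
    ∑ t ∈ S, c (s, t) k l • UnitaryRep.op (universalRep G) t
  have e : ∀ s k l, opTensor (UnitaryRep.op (universalRep G) s)
      (∑ t ∈ S, c (s, t) k l • UnitaryRep.op (universalRep G) t)
      = ∑ t ∈ S, c (s, t) k l • tensorHom G (s, t) := fun s k l => by
    let f : (lp (fun σ : CyclicRep G => σ.carrier) 2 →L[ℂ] _) →ₗ[ℂ] _ :=
      { toFun := fun b => opTensor (UnitaryRep.op (universalRep G) s) b
        map_add' := opTensor_add_right _
        map_smul' := fun c b => opTensor_smul_right c _ b }
    exact (map_sum f _ _).trans (Finset.sum_congr rfl fun t _ => map_smul f _ _)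
  simpa only [Matrix.of_apply, e, Finset.sum_product, mul_smul, Finset.smul_sum] using h

theorem norm_tensorHom_flip_le {ι : Type*} [Fintype ι] (S : Finset G) (c : G × G → Matrix ι ι ℂ) :
    ‖opMatrix (Matrix.of fun p q : ι => ∑ g ∈ S ×ˢ S, c g p q • tensorHom G g)‖
      ≤ ‖opMatrix (Matrix.of fun p q : ι => ∑ g ∈ S ×ˢ S, c g.swap p q • tensorHom G g)‖ := by
  have h := norm_opMatrix_opTensor_flip_le (S ×ˢ S) c
    (fun g => UnitaryRep.op (universalRep G) g.1) (fun g => UnitaryRep.op (universalRep G) g.2)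
  have e : ∀ p q : ι, ∑ g ∈ S ×ˢ S, c g.swap p q • tensorHom G g = ∑ g ∈ S ×ˢ S, c g p q •
      opTensor (UnitaryRep.op (universalRep G) g.2) (UnitaryRep.op (universalRep G) g.1) :=
    fun p q => Finset.sum_nbij' Prod.swap Prod.swap (by simp +contextual) (by simp +contextual)
      (by simp) (by simp) (by simp [tensorHom_apply])
  simp only [e]
  exact h

theorem norm_tensorHom_mul_le {pr : G × G → G} (hpr : pr = Prod.fst ∨ pr = Prod.snd)
    (u : Matrix ι ι (fourierStieltjes G)) (S : Finset G) (c : G × G → Matrix κ κ ℂ) :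
    ‖opMatrix (Matrix.of fun p q : ι × κ => ∑ g ∈ S ×ˢ S,
        ((u p.1 q.1 : G → ℂ) (pr g) * c g p.2 q.2) • tensorHom G g)‖
      ≤ matNorm u * ‖opMatrix (Matrix.of fun p q : κ => ∑ g ∈ S ×ˢ S,
        c g p q • tensorHom G g)‖ := by
  rcases hpr with rfl | rfl
  · exact norm_tensorHom_mul_fst_le u S c
  -- Flip the legs, act on the first leg, and flip back.
  · have hu : 0 ≤ matNorm u := dual_matNorm_nonneg _
    have h1 := norm_tensorHom_flip_le S fun g => Matrix.of fun p q : ι × κ =>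
      (u p.1 q.1 : G → ℂ) g.2 * c g p.2 q.2
    have h2 := norm_tensorHom_mul_fst_le u S fun g => c g.swap
    have h3 := norm_tensorHom_flip_le S fun g => c g.swap
    simp only [Prod.swap_swap] at h3
    exact h1.trans (h2.trans (mul_le_mul_of_nonneg_left h3 hu))

end MinSquare

/-! ### The two actions of B(G) on the minimal tensor square. -/

section MinModule

variable {G : Type u} [Group G]
variable {ι κ : Type} [Fintype ι] [DecidableEq ι] [Fintype κ] [DecidableEq κ]

/-- Multiplication of a finitely supported function on `G × G` by `u ∘ pr`. -/
noncomputable def finsuppMul {G : Type*} (pr : G × G → G) (u : G → ℂ) :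
    (G × G →₀ ℂ) →ₗ[ℂ] (G × G →₀ ℂ) :=
  Finsupp.linearCombination ℂ fun g => Finsupp.single g (u (pr g))

theorem linearCombination_eq_sum {α M : Type*} [AddCommGroup M] [Module ℂ M] (f : α → M)
    (c : α →₀ ℂ) {s : Finset α} (hs : c.support ⊆ s) :
    Finsupp.linearCombination ℂ f c = ∑ g ∈ s, c g • f g := by
  rw [Finsupp.linearCombination_apply, Finsupp.sum_of_support_subset _ hs _ (by simp)]

theorem linearCombination_finsuppMul {G M : Type*} [AddCommGroup M] [Module ℂ M]
    (f : G × G → M) (pr : G × G → G) (u : G → ℂ) (c : G × G →₀ ℂ)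
    {s : Finset (G × G)} (hs : c.support ⊆ s) :
    Finsupp.linearCombination ℂ f (finsuppMul pr u c) = ∑ g ∈ s, (u (pr g) * c g) • f g := by
  rw [finsuppMul, linearCombination_eq_sum _ _ hs, map_sum]
  refine Finset.sum_congr rfl fun g _ => ?_
  rw [map_smul, Finsupp.linearCombination_single, smul_smul, mul_comm]

theorem coe_linearCombination_minHom (c : G × G →₀ ℂ) :
    ((Finsupp.linearCombination ℂ (minHom G) c : minSquare G) : HilbertTensor _ _ →L[ℂ] _)
      = Finsupp.linearCombination ℂ (tensorHom G) c :=
  Finsupp.apply_linearCombination ℂ (minSquare G).toSubalgebra.toSubmodule.subtype (minHom G) c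

theorem map_coe_linearCombination_minHom {κ : Type*} (c : Matrix κ κ (G × G →₀ ℂ))
    {s : Finset (G × G)} (hs : ∀ k l, (c k l).support ⊆ s) :
    ((c.map (Finsupp.linearCombination ℂ (minHom G))).map
        fun a : minSquare G => (a : HilbertTensor _ _ →L[ℂ] _))
      = Matrix.of fun p q : κ => ∑ g ∈ s, c p q g • tensorHom G g := by
  refine Matrix.ext fun p q => ?_
  exact (coe_linearCombination_minHom _).trans (linearCombination_eq_sum _ _ (hs p q))

theorem map_coe_linearCombination_finsuppMul {ι κ : Type*} (pr : G × G → G)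
    (u : Matrix ι ι (G → ℂ)) (c : Matrix κ κ (G × G →₀ ℂ))
    {s : Finset (G × G)} (hs : ∀ k l, (c k l).support ⊆ s) :
    ((Matrix.of fun p q : ι × κ => Finsupp.linearCombination ℂ (minHom G)
      (finsuppMul pr (u p.1 q.1) (c p.2 q.2))).map
        fun a : minSquare G => (a : HilbertTensor _ _ →L[ℂ] _))
      = Matrix.of fun p q : ι × κ => ∑ g ∈ s,
        (u p.1 q.1 (pr g) * c p.2 q.2 g) • tensorHom G g := by
  refine Matrix.ext fun p q => ?_
  exact (coe_linearCombination_minHom _).trans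
    (linearCombination_finsuppMul _ _ _ _ (hs p.2 q.2))

set_option maxHeartbeats 1000000 in
theorem matNorm_linearCombination_finsuppMul_le {pr : G × G → G}
    (hpr : pr = Prod.fst ∨ pr = Prod.snd) (u : Matrix ι ι (fourierStieltjes G))
    (c : Matrix κ κ (G × G →₀ ℂ)) :
    matNorm (Matrix.of fun p q : ι × κ =>
        Finsupp.linearCombination ℂ (minHom G) (finsuppMul pr (u p.1 q.1 : G → ℂ) (c p.2 q.2)))
      ≤ matNorm u * matNorm (c.map (Finsupp.linearCombination ℂ (minHom G))) := by
  classical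
  let S₀ : Finset (G × G) := Finset.univ.biUnion fun p : κ × κ => (c p.1 p.2).support
  -- All supports are enlarged to a common square, as the estimate for sums over S × S requires.
  let S : Finset G := S₀.image Prod.fst ∪ S₀.image Prod.snd
  have hS : ∀ k l, (c k l).support ⊆ S ×ˢ S := fun k l g hg => by
    have : g ∈ S₀ := Finset.mem_biUnion.2 ⟨(k, l), Finset.mem_univ _, hg⟩
    exact Finset.mem_product.2 ⟨Finset.mem_union_left _ (Finset.mem_image_of_mem _ this),
      Finset.mem_union_right _ (Finset.mem_image_of_mem _ this)⟩
  have h := norm_tensorHom_mul_le hpr u S fun g => Matrix.of fun k l => c k l g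
  rw [starSubalgebra_matNorm_def, starSubalgebra_matNorm_def]
  have e := map_coe_linearCombination_finsuppMul pr
    (u.map fun w : fourierStieltjes G => (w : G → ℂ)) c hS
  simp only [Matrix.map_apply] at e
  rw [map_coe_linearCombination_minHom c hS, e]
  exact h

theorem norm_linearCombination_finsuppMul_le {pr : G × G → G}
    (hpr : pr = Prod.fst ∨ pr = Prod.snd) (u : fourierStieltjes G) (c : G × G →₀ ℂ) :
    ‖Finsupp.linearCombination ℂ (minHom G) (finsuppMul pr (u : G → ℂ) c)‖
      ≤ matNorm (Matrix.of fun _ _ : Unit => u) * ‖Finsupp.linearCombination ℂ (minHom G) c‖ := by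
  have h := matNorm_linearCombination_finsuppMul_le hpr (Matrix.of fun _ _ : Unit => u)
    (Matrix.of fun _ _ : Unit => c)
  have h1 := IsOperatorSpace.matNorm_one_by_one (Finsupp.linearCombination ℂ (minHom G) c)
  rw [← h1]
  exact (norm_entry_le_matNorm (Matrix.of fun p q : Unit × Unit =>
    Finsupp.linearCombination ℂ (minHom G) (finsuppMul pr (u : G → ℂ) c)) ((), ()) ((), ())).trans h

/-- The action of `u ∈ B(G)` on `C*(G) ⊗_min C*(G)` with `ϖ(s) ⊗ ϖ(t) ↦ u(pr(s, t)) ϖ(s) ⊗ ϖ(t)`,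
for `pr` one of the two projections. -/
noncomputable def minAct (pr : G × G → G) (u : fourierStieltjes G) :
    minSquare G →L[ℂ] minSquare G :=
  (Finsupp.linearCombination ℂ (minHom G) ∘ₗ finsuppMul pr (u : G → ℂ)).extendOfNorm
    (Finsupp.linearCombination ℂ (minHom G))

/-- `extendOfNorm` agrees with the intended map only when a norm bound is known; `hpr` provides that
bound. -/
theorem minAct_linearCombination {pr : G × G → G} (hpr : pr = Prod.fst ∨ pr = Prod.snd)
    (u : fourierStieltjes G) (c : G × G →₀ ℂ) :
    minAct pr u (Finsupp.linearCombination ℂ (minHom G) c)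
      = Finsupp.linearCombination ℂ (minHom G) (finsuppMul pr (u : G → ℂ) c) :=
  LinearMap.extendOfNorm_eq (denseRange_minHom (G := G))
    ⟨_, norm_linearCombination_finsuppMul_le hpr u⟩ c

theorem minAct_minHom {pr : G × G → G} (hpr : pr = Prod.fst ∨ pr = Prod.snd)
    (u : fourierStieltjes G) (g : G × G) :
    minAct pr u (minHom G g) = (u : G → ℂ) (pr g) • minHom G g := by
  have h := minAct_linearCombination hpr u (Finsupp.single g 1)
  simpa [finsuppMul] using h

/-- Both sides are continuous in v, so it suffices to treat matrices over the span of the ϖ(s) ⊗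
ϖ(t). -/
theorem matNorm_minAct_le {pr : G × G → G} (hpr : pr = Prod.fst ∨ pr = Prod.snd)
    (u : Matrix ι ι (fourierStieltjes G)) (v : Matrix κ κ (minSquare G)) :
    matNorm (Matrix.of fun p q : ι × κ => minAct pr (u p.1 q.1) (v p.2 q.2))
      ≤ matNorm u * matNorm v := by
  have hd : DenseRange fun c : Matrix κ κ (G × G →₀ ℂ) =>
      c.map (Finsupp.linearCombination ℂ (minHom G)) :=
    DenseRange.piMap fun _ => DenseRange.piMap fun _ => denseRange_minHom
  refine hd.induction_on v (isClosed_le ?_ ?_) fun c => ?_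
  · refine (continuous_matNorm (minSquare G)).comp (continuous_matrix fun p q => ?_)
    exact (minAct pr (u p.1 q.1)).continuous.comp (continuous_id.matrix_elem _ _)
  · exact continuous_const.mul (continuous_matNorm (minSquare G))
  · simp only [Matrix.map_apply, minAct_linearCombination hpr]
    exact matNorm_linearCombination_finsuppMul_le hpr u c

end MinModule

/-! ### Operator Connes-amenability and invariant functionals -/

section Amenability

variable {A : Type v} [NonUnitalRing A] [Module ℂ A] [MatrixNorms A]

/-- A completely contractive action of the algebra `A` by commuting operators on `V`. -/
structure CommutingAction (A : Type*) [NonUnitalRing A] [Module ℂ A] [MatrixNorms A]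
    (V : Type*) [NormedAddCommGroup V] [NormedSpace ℂ V] [MatrixNorms V] where
  /-- the operator by which `a` acts -/
  act : A →ₗ[ℂ] V →L[ℂ] V
  act_mul : ∀ a b v, act (a * b) v = act a (act b v)
  act_comm : ∀ a b v, act a (act b v) = act b (act a v)
  matNorm_act_le : ∀ {ι κ : Type} [Fintype ι] [DecidableEq ι] [Fintype κ] [DecidableEq κ]
    (x : Matrix ι ι A) (v : Matrix κ κ V),
    matNorm (Matrix.of fun p q : ι × κ => act (x p.1 q.1) (v p.2 q.2)) ≤ matNorm x * matNorm v

theorem continuous_weakStar_of_eval {X : Type*} {τ : TopologicalSpace X}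
    {V : Type*} [NormedAddCommGroup V] [NormedSpace ℂ V] {f : X → StrongDual ℂ V}
    (h : ∀ v, Continuous fun x => f x v) : Continuous[τ, weakStar V] f :=
  continuous_induced_rng.2 (WeakDual.continuous_of_continuous_eval h)

theorem continuous_eval_weakStar {V : Type*} [NormedAddCommGroup V] [NormedSpace ℂ V] (v : V) :
    Continuous[weakStar V, inferInstance] fun φ : StrongDual ℂ V => φ v :=
  @Continuous.comp _ _ _ (weakStar V) _ _ _ _ (WeakDual.eval_continuous v) continuous_induced_dom

namespace CommutingAction

variable {V : Type*} [NormedAddCommGroup V] [NormedSpace ℂ V] [MatrixNorms V]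

/-- The action on the dual space by the adjoint operators. -/
noncomputable def dualAct (L : CommutingAction A V) : A →ₗ[ℂ] StrongDual ℂ V →ₗ[ℂ] StrongDual ℂ V :=
  LinearMap.mk₂ ℂ (fun a φ => φ.comp (L.act a))
    (fun a b φ => by ext v; simp) (fun c a φ => by ext v; simp)
    (fun a φ ψ => by ext v; simp) (fun c a φ => by ext v; simp)

@[simp]
theorem dualAct_apply (L : CommutingAction A V) (a : A) (φ : StrongDual ℂ V) (v : V) :
    L.dualAct a φ v = φ (L.act a v) := rfl

theorem dualAct_weakStar (L : CommutingAction A V) (a : A) :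
    Continuous[weakStar V, weakStar V] (L.dualAct a) :=
  continuous_weakStar_of_eval (τ := weakStar V) fun v => continuous_eval_weakStar (L.act a v)

/-- Tested against z, the matrix of a · φ is the matrix φ applied to the matrix of the L_a z, up to
the order of the indices. -/
theorem dualAct_cb [IsOperatorSpace V] (hA : ∀ (n : ℕ) (x : Matrix (Fin n) (Fin n) A),
    0 ≤ matNorm x) (L : CommutingAction A V) : IsJointlyCompletelyBounded L.dualAct := by
  refine ⟨1, fun m n x y => ?_⟩
  rw [one_mul]
  refine dual_matNorm_le (mul_nonneg (hA m x) (dual_matNorm_nonneg y)) fun N z => ?_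
  let f : (Fin m × Fin n) × Fin N → Fin n × (Fin m × Fin N) := fun p => (p.1.2, (p.1.1, p.2))
  have hf : Function.Injective f := fun p q h => by
    simp only [f, Prod.mk.injEq] at h
    exact Prod.ext (Prod.ext h.2.1 h.1) h.2.2
  have h1 := norm_scalarMatrix_submatrix_le hf (Matrix.of fun p q : Fin n × (Fin m × Fin N) =>
    y p.1 q.1 ((Matrix.of fun p q : Fin m × Fin N => L.act (x p.1 q.1) (z p.2 q.2)) p.2 q.2))
  refine h1.trans ((norm_dual_apply_le y _).trans ?_)
  calc _ ≤ matNorm y * (matNorm x * matNorm z) :=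
        mul_le_mul_of_nonneg_left (L.matNorm_act_le x z) (dual_matNorm_nonneg y)
    _ = _ := by ring

/-- The dual of a space with two commuting actions of `A` is a bimodule. -/
noncomputable def dualBimodule [IsOperatorSpace V] (hA : ∀ (n : ℕ) (x : Matrix (Fin n) (Fin n) A),
    0 ≤ matNorm x) (L R : CommutingAction A V)
    (h : ∀ a b v, L.act a (R.act b v) = R.act b (L.act a v)) : DualOperatorBimodule A V where
  left := L.dualAct
  right := R.dualAct
  -- Passing to adjoints reverses products, so the left module law uses commutativity of the action.
  left_mul a b φ := by ext v; simp [L.act_mul, L.act_comm a b]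
  right_mul a b φ := by ext v; simp [R.act_mul]
  left_right a b φ := by ext v; simp [h]
  left_cb := L.dualAct_cb hA
  right_cb := R.dualAct_cb hA
  left_weakStar := L.dualAct_weakStar
  right_weakStar := R.dualAct_weakStar

/-- The action induced on the quotient by an invariant subspace. -/
noncomputable def quotient [IsOperatorSpace V]
    (hA : ∀ {ι : Type} [Fintype ι] [DecidableEq ι] (x : Matrix ι ι A),
    0 ≤ matNorm x) (L : CommutingAction A V) (W : Submodule ℂ V) [IsClosed (W : Set V)]
    (hW : ∀ a, ∀ w ∈ W, L.act a w ∈ W) : CommutingAction A (V ⧸ W) where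
  act :=
    { toFun := fun a => W.liftQL (W.mkQL.comp (L.act a)) fun w hw => by
        simpa using hW a w hw
      map_add' := fun a b => by
        ext v; obtain ⟨v, rfl⟩ := W.mkQ_surjective v; simp
      map_smul' := fun c a => by
        ext v; obtain ⟨v, rfl⟩ := W.mkQ_surjective v; simp }
  act_mul a b v := by
    obtain ⟨v, rfl⟩ := W.mkQ_surjective v
    simp [L.act_mul]
  act_comm a b v := by
    obtain ⟨v, rfl⟩ := W.mkQ_surjective v
    simp [L.act_comm a b]
  matNorm_act_le x v := by
    refine le_mul_quotient_matNorm W v (hA x) ?_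
    rintro y rfl
    exact (quotient_matNorm_map_le W _).trans (L.matNorm_act_le x y)

theorem quotient_act_mkQ [IsOperatorSpace V]
    (hA : ∀ {ι : Type} [Fintype ι] [DecidableEq ι] (x : Matrix ι ι A),
    0 ≤ matNorm x) (L : CommutingAction A V) (W : Submodule ℂ V) [IsClosed (W : Set V)]
    (hW : ∀ a, ∀ w ∈ W, L.act a w ∈ W) (a : A) (v : V) :
    (L.quotient hA W hW).act a (W.mkQ v) = W.mkQ (L.act a v) := rfl

theorem norm_functional_act_le [IsOperatorSpace V] (L : CommutingAction A V) (M : StrongDual ℂ V)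
    {ι κ : Type} [Fintype ι] [DecidableEq ι] [Fintype κ] [DecidableEq κ]
    (x : Matrix ι ι A) (v : Matrix κ κ V) :
    ‖(Matrix.of fun p q : ι × κ => M (L.act (x p.1 q.1) (v p.2 q.2)) :
      Matrix (ι × κ) (ι × κ) ℂ)‖ ≤ ‖M‖ * (matNorm x * matNorm v) :=
  (norm_map_functional_le M (Matrix.of fun p q : ι × κ => L.act (x p.1 q.1) (v p.2 q.2))).trans
    (mul_le_mul_of_nonneg_left (L.matNorm_act_le x v) (norm_nonneg _))

end CommutingAction

/-- If `A` is operator Connes-amenable, a functional on `V` which balances two commuting actions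
of `A` on an invariant subspace `W` can be corrected, away from `W`, to balance them on `V`. -/
theorem OperatorConnesAmenable.exists_balanced {V : Type w} [NormedAddCommGroup V]
    [NormedSpace ℂ V] [CompleteSpace V] [MatrixNorms V] [IsOperatorSpace V]
    {τ : TopologicalSpace A} (hAm : OperatorConnesAmenable.{v, w} A τ)
    (hA : ∀ {ι : Type} [Fintype ι] [DecidableEq ι] (x : Matrix ι ι A), 0 ≤ matNorm x)
    (L R : CommutingAction A V) (h : ∀ a b v, L.act a (R.act b v) = R.act b (L.act a v))
    (hL : ∀ (ψ : StrongDual ℂ V) v, Continuous fun a => ψ (L.act a v))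
    (hR : ∀ (ψ : StrongDual ℂ V) v, Continuous fun a => ψ (R.act a v))
    (W : Submodule ℂ V) [IsClosed (W : Set V)]
    (hWL : ∀ a, ∀ w ∈ W, L.act a w ∈ W) (hWR : ∀ a, ∀ w ∈ W, R.act a w ∈ W)
    (M₀ : StrongDual ℂ V) (hM₀ : ∀ a, ∀ w ∈ W, M₀ (L.act a w) = M₀ (R.act a w)) :
    ∃ M : StrongDual ℂ V, (∀ w ∈ W, M w = M₀ w) ∧ ∀ a v, M (L.act a v) = M (R.act a v) := by
  let LQ := L.quotient hA W hWL
  let RQ := R.quotient hA W hWR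
  have hLQ : ∀ a v, LQ.act a (W.mkQ v) = W.mkQ (L.act a v) := L.quotient_act_mkQ hA W hWL
  have hRQ : ∀ a v, RQ.act a (W.mkQ v) = W.mkQ (R.act a v) := R.quotient_act_mkQ hA W hWR
  have hLR : ∀ a b v, LQ.act a (RQ.act b v) = RQ.act b (LQ.act a v) := fun a b v => by
    obtain ⟨v, rfl⟩ := W.mkQ_surjective v
    rw [hRQ, hLQ, hLQ, hRQ, h]
  -- On V* this derivation is implemented by M₀ itself. The gain comes from regarding it in the
  -- smaller module (V/W)*, where an implementing functional must vanish on W.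
  let D : A →ₗ[ℂ] StrongDual ℂ (V ⧸ W) :=
    { toFun := fun a => W.liftQL (M₀.comp (L.act a - R.act a)) fun w hw => by
        simpa [sub_eq_zero] using hM₀ a w hw
      map_add' := fun a b => by
        ext v; obtain ⟨v, rfl⟩ := W.mkQ_surjective v; simp; ring
      map_smul' := fun c a => by
        ext v; obtain ⟨v, rfl⟩ := W.mkQ_surjective v; simp [mul_sub] }
  have hD : ∀ a v, D a (W.mkQ v) = M₀ (L.act a v) - M₀ (R.act a v) := fun a v =>
    map_sub M₀ _ _
  have hnormal : (CommutingAction.dualBimodule (fun _ => hA) LQ RQ hLR).IsNormal τ := fun φ => by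
    constructor
    · refine continuous_weakStar_of_eval fun v => ?_
      obtain ⟨v, rfl⟩ := W.mkQ_surjective v
      exact hL (φ.comp W.mkQL) v
    · refine continuous_weakStar_of_eval fun v => ?_
      obtain ⟨v, rfl⟩ := W.mkQ_surjective v
      exact hR (φ.comp W.mkQL) v
  obtain ⟨N, hN⟩ := hAm (V ⧸ W) (CommutingAction.dualBimodule (fun _ => hA) LQ RQ hLR) hnormal D
    (fun a b => by
      ext v
      obtain ⟨v, rfl⟩ := W.mkQ_surjective v
      change D (a * b) (W.mkQ v) = D b (LQ.act a (W.mkQ v)) + D a (RQ.act b (W.mkQ v))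
      rw [hLQ, hRQ, hD, hD, hD, L.act_mul, L.act_comm a b, R.act_mul, h]
      ring)
    -- One ‖M₀‖ for each of the two actions.
    ⟨2 * ‖M₀‖, fun n x => by
      have hx := hA x
      refine dual_matNorm_le (mul_nonneg (by positivity) hx) fun m z => ?_
      refine le_mul_quotient_matNorm W z (mul_nonneg (by positivity) hx) ?_
      rintro y rfl
      have e : (Matrix.of fun p q : Fin n × Fin m => x.map D p.1 q.1 (y.map W.mkQ p.2 q.2) :
          Matrix (Fin n × Fin m) (Fin n × Fin m) ℂ)
          = (Matrix.of fun p q : Fin n × Fin m => M₀ (L.act (x p.1 q.1) (y p.2 q.2)))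
            - Matrix.of fun p q : Fin n × Fin m => M₀ (R.act (x p.1 q.1) (y p.2 q.2)) := by
        ext p q
        exact hD _ _
      rw [e]
      refine (norm_sub_le _ _).trans ((add_le_add (L.norm_functional_act_le M₀ x y)
        (R.norm_functional_act_le M₀ x y)).trans_eq ?_)
      ring⟩
    (continuous_weakStar_of_eval fun v => by
      obtain ⟨v, rfl⟩ := W.mkQ_surjective v
      simp only [hD]
      exact (hL M₀ v).sub (hR M₀ v))
  -- M₀ and N implement the same derivation, so their difference is balanced; N vanishes on W, so
  -- the values there do not change.
  refine ⟨M₀ - N.comp W.mkQL, fun w hw => ?_, fun a v => ?_⟩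
  · have : W.mkQ w = 0 := by simpa using hw
    change M₀ w - N (W.mkQ w) = M₀ w
    rw [this, map_zero, sub_zero]
  · have h1 : D a (W.mkQ v) = N (LQ.act a (W.mkQ v)) - N (RQ.act a (W.mkQ v)) :=
      DFunLike.congr_fun (hN a) (W.mkQ v)
    rw [hLQ, hRQ, hD] at h1
    change M₀ _ - N (W.mkQ _) = M₀ _ - N (W.mkQ _)
    linear_combination h1

end Amenability

/-! ### Weak* continuity of the module actions -/

section WeakStarContinuity

variable {G : Type u} [Group G]

theorem norm_linearCombination_universalRep_le (c : G →₀ ℂ) {C : ℝ} (hC : 0 ≤ C)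
    (h : ∀ (σ : CyclicRep G) (x : σ.carrier),
      ‖Finsupp.linearCombination ℂ (UnitaryRep.op σ.rep) c x‖ ≤ C * ‖x‖) :
    ‖Finsupp.linearCombination ℂ (UnitaryRep.op (universalRep G)) c‖ ≤ C := by
  refine ContinuousLinearMap.opNorm_le_bound _ hC fun x => ?_
  refine le_of_sq_le_sq ?_ (by positivity)
  have h2 := (lp_hasSum_norm_sq x).mul_left (C ^ 2)
  rw [← mul_pow] at h2
  refine hasSum_le (fun σ => ?_)
    (lp_hasSum_norm_sq (Finsupp.linearCombination ℂ (UnitaryRep.op (universalRep G)) c x)) h2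
  have e : (Finsupp.linearCombination ℂ (UnitaryRep.op (universalRep G)) c x :
      ∀ σ : CyclicRep G, σ.carrier) σ
      = Finsupp.linearCombination ℂ (UnitaryRep.op σ.rep) c (x σ) := by
    simp only [Finsupp.linearCombination_apply, Finsupp.sum, sum_apply, smul_apply,
      UnitaryRep.op_apply, lp.coeFn_sum, Finset.sum_apply, lp.coeFn_smul, Pi.smul_apply,
      universalRep_apply]
  rw [e, ← mul_pow]
  exact pow_le_pow_left₀ (norm_nonneg _) (h σ (x σ)) 2

/-- A coefficient function of a cyclic representation as an element of `B(G)`. -/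
noncomputable def fsCoeff (σ : CyclicRep G) (x y : σ.carrier) : fourierStieltjes G :=
  ⟨UnitaryRep.coeff σ.rep x y, _, σ.carrier, inferInstance, inferInstance, inferInstance,
    σ.rep, x, y, rfl, rfl⟩

theorem linearCombination_coeff (σ : CyclicRep G) (x y : σ.carrier) (c : G →₀ ℂ) :
    Finsupp.linearCombination ℂ (UnitaryRep.coeff σ.rep x y) c
      = ⟪y, Finsupp.linearCombination ℂ (UnitaryRep.op σ.rep) c x⟫_ℂ := by
  simp only [Finsupp.linearCombination_apply, Finsupp.sum, sum_apply, smul_apply,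
    UnitaryRep.op_apply, inner_sum, inner_smul_right, UnitaryRep.coeff, smul_eq_mul]

theorem fsToDual_linearCombination (u : fourierStieltjes G) (c : G →₀ ℂ) :
    fsToDual u (Finsupp.linearCombination ℂ (UnitaryRep.cstarHom (universalRep G)) c)
      = Finsupp.linearCombination ℂ (u : G → ℂ) c := by
  have h := Finsupp.apply_linearCombination ℂ (fsToDual u).toLinearMap
    (UnitaryRep.cstarHom (universalRep G)) c
  refine h.trans (congrArg (fun f : G → ℂ => Finsupp.linearCombination ℂ f c) ?_)
  exact funext fun s => fsToDual_apply u s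

theorem norm_linearCombination_cstarHom (c : G →₀ ℂ) :
    ‖Finsupp.linearCombination ℂ (UnitaryRep.cstarHom (universalRep G)) c‖
      = ‖Finsupp.linearCombination ℂ (UnitaryRep.op (universalRep G)) c‖ := by
  rw [← UnitaryRep.coe_linearCombination_cstarHom]
  rfl

theorem norm_fsToDual_fsCoeff_le (σ : CyclicRep G) (x y : σ.carrier) :
    ‖fsToDual (fsCoeff σ x y)‖ ≤ ‖x‖ * ‖y‖ := by
  refine ContinuousLinearMap.opNorm_le_bound _ (by positivity) fun a => ?_
  refine (UnitaryRep.denseRange_cstarHom (universalRep G)).induction_on a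
    (isClosed_le (fsToDual (fsCoeff σ x y)).continuous.norm
      (continuous_const.mul continuous_norm)) fun c => ?_
  rw [fsToDual_linearCombination, norm_linearCombination_cstarHom]
  change ‖Finsupp.linearCombination ℂ (UnitaryRep.coeff σ.rep x y) c‖ ≤ _
  rw [linearCombination_coeff]
  calc _ ≤ ‖y‖ * _ := norm_inner_le_norm _ _
    _ ≤ ‖y‖ * (_ * ‖x‖) := by gcongr; exact norm_linearCombination_cyclic_le σ c x
    _ = _ := by ring

/-- Bounded functionals are completely bounded with the same norm, so the module estimate in terms
of `matNorm` becomes one in terms of the functional norm. -/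
theorem matNorm_one_by_one_le (u : fourierStieltjes G) :
    matNorm (Matrix.of fun _ _ : Unit => u) ≤ ‖fsToDual u‖ := by
  rw [fs_matNorm_def]
  refine dual_matNorm_le (norm_nonneg _) fun n x => ?_
  exact (norm_scalarMatrix_submatrix_le (f := fun p : Unit × Fin n => p.2)
    (fun p q h => Prod.ext rfl h) (Matrix.of fun i j => fsToDual u (x i j))).trans
    (norm_map_functional_le _ x)

/-- Transposes the action: for v = ∑ c(g) ϖ(s) ⊗ ϖ(t) with g = (s,t), the number ψ(u · v) is u
evaluated at the combination ∑ c(g) ψ(ϖ(s) ⊗ ϖ(t)) pr(g). This combination is the candidate for the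
element of C*(G) representing u ↦ ψ(u · v). -/
theorem linearCombination_weight {pr : G × G → G} (ψ : StrongDual ℂ (minSquare G)) (u : G → ℂ)
    (c : G × G →₀ ℂ) :
    Finsupp.linearCombination ℂ u
        (Finsupp.linearCombination ℂ (fun g => Finsupp.single (pr g) (ψ (minHom G g))) c)
      = ψ (Finsupp.linearCombination ℂ (minHom G) (finsuppMul pr u c)) := by
  have h : Finsupp.linearCombination ℂ u ∘ₗ
        Finsupp.linearCombination ℂ (fun g => Finsupp.single (pr g) (ψ (minHom G g)))
      = ψ.toLinearMap ∘ₗ Finsupp.linearCombination ℂ (minHom G) ∘ₗ finsuppMul pr u := by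
    refine Finsupp.lhom_ext' fun g => LinearMap.ext_ring ?_
    simp only [LinearMap.comp_apply, Finsupp.lsingle_apply, Finsupp.linearCombination_single,
      finsuppMul, one_smul, smul_eq_mul, ContinuousLinearMap.coe_coe, map_smul]
    exact mul_comm _ _
  exact LinearMap.congr_fun h c

set_option maxHeartbeats 400000 in
theorem norm_functional_finsuppMul_le {pr : G × G → G}
    (hpr : pr = Prod.fst ∨ pr = Prod.snd) (ψ : StrongDual ℂ (minSquare G)) (c : G × G →₀ ℂ)
    (σ : CyclicRep G) (x y : σ.carrier) :
    ‖ψ (Finsupp.linearCombination ℂ (minHom G) (finsuppMul pr (UnitaryRep.coeff σ.rep x y) c))‖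
      ≤ ‖ψ‖ * (‖x‖ * ‖y‖ * ‖Finsupp.linearCombination ℂ (minHom G) c‖) := by
    have h := norm_linearCombination_finsuppMul_le hpr (fsCoeff σ x y) c
    have h2 := (matNorm_one_by_one_le (fsCoeff σ x y)).trans (norm_fsToDual_fsCoeff_le σ x y)
    exact (ψ.le_opNorm _).trans (
        mul_le_mul_of_nonneg_left (h.trans (mul_le_mul_of_nonneg_right h2 (norm_nonneg _)))
          (norm_nonneg _))

set_option maxHeartbeats 400000 in
-- The norm in C*(G) is tested on cyclic representations, whose coefficients are elements of B(G).
-- Evaluating such a coefficient at the weighted combination is, by transposition, evaluating ψ on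
-- the module action.
theorem norm_linearCombination_weight_le_of_forall {pr : G × G → G}
    (ψ : StrongDual ℂ (minSquare G)) (c : G × G →₀ ℂ) {C : ℝ} (hC : 0 ≤ C)
    (key : ∀  (σ : CyclicRep G) (x y : σ.carrier),
    ‖ψ (Finsupp.linearCombination ℂ (minHom G) (finsuppMul pr (UnitaryRep.coeff σ.rep x y) c))‖
      ≤ C * ‖x‖ * ‖y‖) :
    ‖Finsupp.linearCombination ℂ (UnitaryRep.cstarHom (universalRep G))
        (Finsupp.linearCombination ℂ (fun g => Finsupp.single (pr g) (ψ (minHom G g))) c)‖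
      ≤ C := by
  refine (norm_linearCombination_cstarHom _).trans_le ?_
  refine norm_linearCombination_universalRep_le _ hC fun σ x => ?_
  generalize hT : Finsupp.linearCombination ℂ (UnitaryRep.op σ.rep)
    (Finsupp.linearCombination ℂ (fun g => Finsupp.single (pr g) (ψ (minHom G g))) c) = T
  -- The hypothesis `key` is used with y = T x, so that the pairing is ‖T x‖².
  have h : ‖⟪T x, T x⟫_ℂ‖ ≤ C * ‖x‖ * ‖T x‖ := by
    refine le_of_eq_of_le ?_ (key σ x (T x))
    rw [← linearCombination_weight, linearCombination_coeff, hT]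
  rw [inner_self_eq_norm_sq_to_K, ← RCLike.ofReal_pow, RCLike.norm_ofReal,
    abs_of_nonneg (sq_nonneg _)] at h
  rcases (norm_nonneg (T x)).eq_or_lt with h0 | h0
  · rw [← h0]; positivity
  · exact le_of_mul_le_mul_right (by linarith [sq ‖T x‖]) h0

set_option maxHeartbeats 400000 in
theorem norm_linearCombination_weight_le {pr : G × G → G}
    (hpr : pr = Prod.fst ∨ pr = Prod.snd) (ψ : StrongDual ℂ (minSquare G)) (c : G × G →₀ ℂ) :
    ‖Finsupp.linearCombination ℂ (UnitaryRep.cstarHom (universalRep G))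
        (Finsupp.linearCombination ℂ (fun g => Finsupp.single (pr g) (ψ (minHom G g))) c)‖
      ≤ ‖ψ‖ * ‖Finsupp.linearCombination ℂ (minHom G) c‖ :=
  norm_linearCombination_weight_le_of_forall ψ c (mul_nonneg (norm_nonneg _) (norm_nonneg _))
    fun σ x y => (norm_functional_finsuppMul_le hpr ψ c σ x y).trans_eq (by ring)

set_option maxHeartbeats 400000 in
/-- The functionals `u ↦ ψ(u · v)` on `B(G)` come from elements of `C*(G)`. -/
theorem exists_fsToDual_eq_minAct {pr : G × G → G} (hpr : pr = Prod.fst ∨ pr = Prod.snd)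
    (ψ : StrongDual ℂ (minSquare G)) (v : minSquare G) :
    ∃ a : fullCStar G, ∀ u : fourierStieltjes G, ψ (minAct pr u v) = fsToDual u a := by
  let f : (G × G →₀ ℂ) →ₗ[ℂ] fullCStar G :=
    Finsupp.linearCombination ℂ (UnitaryRep.cstarHom (universalRep G)) ∘ₗ
      Finsupp.linearCombination ℂ (fun g => Finsupp.single (pr g) (ψ (minHom G g)))
  -- The weighted combination depends contractively, up to the factor ‖ψ‖, on v, so it extends from
  -- the span to all v.
  let Φ : minSquare G →L[ℂ] fullCStar G :=
    f.extendOfNorm (Finsupp.linearCombination ℂ (minHom G))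
  have hΦ : ∀ c, Φ (Finsupp.linearCombination ℂ (minHom G) c) = f c := fun c =>
    LinearMap.extendOfNorm_eq (denseRange_minHom (G := G))
      ⟨_, norm_linearCombination_weight_le hpr ψ⟩ c
  refine ⟨Φ v, fun u => ?_⟩
  refine (denseRange_minHom (G := G)).induction_on (p := fun v => ψ (minAct pr u v)
    = fsToDual u (Φ v)) v (isClosed_eq (ψ.continuous.comp (minAct pr u).continuous)
      ((fsToDual u).continuous.comp Φ.continuous)) fun c => ?_
  refine (congrArg ψ (minAct_linearCombination hpr u c)).trans ?_
  refine (linearCombination_weight ψ u c).symm.trans ?_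
  exact (fsToDual_linearCombination u _).symm.trans (congrArg (fsToDual u) (hΦ c).symm)

set_option maxHeartbeats 400000 in
theorem continuous_fsToDual_apply (a : fullCStar G) :
    Continuous[fsWeakStar G, inferInstance] fun u : fourierStieltjes G => fsToDual u a :=
      @Continuous.comp _ _ _ (fsWeakStar G) (weakStar (fullCStar G)) _ _ _
        (continuous_eval_weakStar a) continuous_induced_dom

set_option maxHeartbeats 400000 in
theorem continuous_functional_minAct {pr : G × G → G} (hpr : pr = Prod.fst ∨ pr = Prod.snd)
    (ψ : StrongDual ℂ (minSquare G)) (v : minSquare G) :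
    Continuous[fsWeakStar G, inferInstance] fun u : fourierStieltjes G => ψ (minAct pr u v) := by
  obtain ⟨a, ha⟩ := exists_fsToDual_eq_minAct hpr ψ v
  refine Eq.mpr (congrArg (fun f : fourierStieltjes G → ℂ =>
    Continuous[fsWeakStar G, inferInstance] f) (funext ha)) ?_
  exact continuous_fsToDual_apply a

end WeakStarContinuity

/-! ### The factorization property -/

section GNS

variable {Γ : Type*} [Group Γ] {A : Type*} [CStarAlgebra A]
variable {H : Type*} [NormedAddCommGroup H] [InnerProductSpace ℂ H] [CompleteSpace H]

/-- The convolution product of finitely supported functions. -/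
noncomputable def finsuppConv (c d : Γ →₀ ℂ) : Γ →₀ ℂ :=
  Finsupp.linearCombination ℂ
    (fun g => Finsupp.linearCombination ℂ (fun h => Finsupp.single (g * h) (1 : ℂ)) d) c

theorem linearCombination_finsuppConv {R : Type*} [Ring R] [Algebra ℂ R] (f : Γ →* R)
    (c d : Γ →₀ ℂ) : Finsupp.linearCombination ℂ f (finsuppConv c d)
      = Finsupp.linearCombination ℂ f c * Finsupp.linearCombination ℂ f d := by
  unfold finsuppConv
  induction c using Finsupp.induction_linear with
  | zero => simp
  | add c c' hc hc' => simp only [map_add, hc, hc', add_mul]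
  | single s z =>
    simp only [Finsupp.linearCombination_single, map_smul, smul_mul_assoc]
    congr 1
    induction d using Finsupp.induction_linear with
    | zero => simp
    | add d d' hd hd' => simp only [map_add, hd, hd', mul_add]
    | single t w => simp

/-- On the dense group algebra φ is the vector functional of ξ, even before π is known to extend to
A. -/
theorem map_star_mul_linearCombination (f : Γ →* A) (π : Γ →* (H →L[ℂ] H))
    (hf : ∀ s, star (f s) = f s⁻¹) (hπ : ∀ s, star (π s) = π s⁻¹) (φ : StrongDual ℂ A) (ξ : H)
    (hφ : ∀ s, φ (f s) = ⟪ξ, π s ξ⟫_ℂ) (c d : Γ →₀ ℂ) :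
    φ (star (Finsupp.linearCombination ℂ f c) * Finsupp.linearCombination ℂ f d)
      = ⟪Finsupp.linearCombination ℂ π c ξ, Finsupp.linearCombination ℂ π d ξ⟫_ℂ := by
  induction c using Finsupp.induction_linear with
  | zero => simp
  | add c c' hc hc' => simp only [map_add, star_add, add_mul, hc, hc', add_apply, inner_add_left]
  | single s z =>
    induction d using Finsupp.induction_linear with
    | zero => simp
    | add d d' hd hd' =>
      rw [map_add, mul_add, map_add, hd, hd', map_add, add_apply, inner_add_right]
    | single t w =>
      have h : ⟪π s ξ, π t ξ⟫_ℂ = φ (f s⁻¹ * f t) := by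
        rw [← map_mul, hφ, map_mul, ← hπ, ContinuousLinearMap.star_eq_adjoint]
        exact (ContinuousLinearMap.adjoint_inner_right (π s) ξ (π t ξ)).symm
      simp only [Finsupp.linearCombination_single, star_smul, hf, smul_mul_smul_comm, map_smul,
        smul_apply, inner_smul_left, inner_smul_right, h, smul_eq_mul]
      simp only [RCLike.star_def]
      ring

theorem inner_self_nonneg_complex {E : Type*} [NormedAddCommGroup E] [InnerProductSpace ℂ E]
    (x : E) : 0 ≤ ⟪x, x⟫_ℂ := by
  rw [inner_self_eq_norm_sq_to_K, ← RCLike.ofReal_pow]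
  exact Complex.zero_le_real.2 (sq_nonneg _)

/-- No positivity of φ is assumed: it is inherited from the positive-definite coefficient on the
group algebra and passes to the closure. -/
theorem map_star_mul_self_nonneg (f : Γ →* A) (π : Γ →* (H →L[ℂ] H))
    (hf : ∀ s, star (f s) = f s⁻¹) (hπ : ∀ s, star (π s) = π s⁻¹)
    (hd : DenseRange (Finsupp.linearCombination ℂ f)) (φ : StrongDual ℂ A) (ξ : H)
    (hφ : ∀ s, φ (f s) = ⟪ξ, π s ξ⟫_ℂ) (a : A) : 0 ≤ φ (star a * a) := by
  refine hd.induction_on a (isClosed_le continuous_const (by fun_prop)) fun c => ?_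
  rw [map_star_mul_linearCombination f π hf hπ φ ξ hφ]
  exact inner_self_nonneg_complex _

/-- In the C*-order b*(a*a)b ≤ ‖a‖² b*b, and φ is nonnegative on the difference because positive
elements have the form x*x. -/
theorem map_star_mul_mul_le (φ : StrongDual ℂ A) (hφ : ∀ a, 0 ≤ φ (star a * a)) (a b : A) :
    φ (star (a * b) * (a * b)) ≤ ‖a‖ ^ 2 * φ (star b * b) := by
  let _ := CStarAlgebra.spectralOrder A
  let _ := CStarAlgebra.spectralOrderedRing A
  have h : star b * (star a * a) * b ≤ ‖star a * a‖ • (star b * b) :=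
    CStarAlgebra.star_left_conjugate_le_norm_smul (IsSelfAdjoint.star_mul_self a)
  obtain ⟨x, hx⟩ := CStarAlgebra.nonneg_iff_eq_star_mul_self.1 (sub_nonneg.2 h)
  have h2 := hφ x
  rw [← hx, map_sub, sub_nonneg] at h2
  have e : star (a * b) * (a * b) = star b * (star a * a) * b := by
    simp only [star_mul, mul_assoc]
  rw [e]
  refine h2.trans_eq ?_
  rw [CStarRing.norm_star_mul_self, ← Complex.coe_smul, map_smul, smul_eq_mul]
  push_cast
  ring

/-- A representation with a cyclic vector whose coefficient extends to a bounded functional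
extends itself. -/
theorem exists_starAlgHom_of_functional (f : Γ →* A) (π : Γ →* (H →L[ℂ] H))
    (hf : ∀ s, star (f s) = f s⁻¹) (hπ : ∀ s, star (π s) = π s⁻¹)
    (hd : DenseRange (Finsupp.linearCombination ℂ f)) (φ : StrongDual ℂ A) (ξ : H)
    (hφ : ∀ s, φ (f s) = ⟪ξ, π s ξ⟫_ℂ)
    (hξ : DenseRange fun c => Finsupp.linearCombination ℂ π c ξ) :
    ∃ Φ : A →⋆ₐ[ℂ] (H →L[ℂ] H), ∀ s, Φ (f s) = π s := by
  refine exists_starAlgHom_of_norm_le f π hf hπ hd fun c => ?_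
  refine ContinuousLinearMap.opNorm_le_bound _ (norm_nonneg _) fun x => ?_
  refine hξ.induction_on x (isClosed_le (by fun_prop) (by fun_prop)) fun d => ?_
  have hsq : ∀ d, φ (star (Finsupp.linearCombination ℂ f d) * Finsupp.linearCombination ℂ f d)
      = (‖Finsupp.linearCombination ℂ π d ξ‖ ^ 2 : ℝ) := fun d => by
    rw [map_star_mul_linearCombination f π hf hπ φ ξ hφ, inner_self_eq_norm_sq_to_K]
    norm_cast
  -- In vectors this reads ‖π(c)π(d)ξ‖² ≤ ‖f(c)‖² ‖π(d)ξ‖², the required bound for π(c) on the dense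
  -- set of vectors π(d)ξ.
  have h := map_star_mul_mul_le φ (map_star_mul_self_nonneg f π hf hπ hd φ ξ hφ)
    (Finsupp.linearCombination ℂ f c) (Finsupp.linearCombination ℂ f d)
  rw [← linearCombination_finsuppConv, hsq, hsq, linearCombination_finsuppConv] at h
  rw [← mul_apply_eq_comp]
  refine le_of_sq_le_sq ?_ (by positivity)
  rw [mul_pow]
  exact_mod_cast h

/-- A unit vector in a representation of a concrete C*-algebra defines a state. -/
theorem exists_isState_of_starAlgHom {K : Type*} [NormedAddCommGroup K] [InnerProductSpace ℂ K]
    [CompleteSpace K] {B : StarSubalgebra ℂ (K →L[ℂ] K)} [IsClosed (B : Set (K →L[ℂ] K))]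
    (Φ : B →⋆ₐ[ℂ] (H →L[ℂ] H)) (ξ : H) (hξ : ‖ξ‖ = 1) :
    ∃ φ : StrongDual ℂ B, IsState φ ∧ ∀ a, φ a = ⟪ξ, Φ a ξ⟫_ℂ := by
  have hbound : ∀ a, ‖⟪ξ, Φ a ξ⟫_ℂ‖ ≤ 1 * ‖a‖ := fun a => by
    refine (norm_inner_le_norm _ _).trans ?_
    rw [hξ]
    refine mul_le_mul_of_nonneg_left (((Φ a).le_opNorm ξ).trans ?_) zero_le_one
    rw [hξ, mul_one]
    exact NonUnitalStarAlgHom.norm_apply_le Φ a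
  let φ : StrongDual ℂ B := LinearMap.mkContinuous
    { toFun := fun a => ⟪ξ, Φ a ξ⟫_ℂ
      map_add' := fun a b => by rw [map_add, add_apply, inner_add_right]
      map_smul' := fun c a => by rw [map_smul, smul_apply, inner_smul_right]; rfl } 1 hbound
  have hφ : ∀ a, φ a = ⟪ξ, Φ a ξ⟫_ℂ := fun a => rfl
  refine ⟨φ, ⟨fun a => ?_, le_antisymm ?_ ?_⟩, hφ⟩
  · rw [hφ, map_mul, map_star, mul_apply_eq_comp, ContinuousLinearMap.star_eq_adjoint,
      ContinuousLinearMap.adjoint_inner_right]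
    exact inner_self_nonneg_complex _
  · exact LinearMap.mkContinuous_norm_le _ zero_le_one _
  · have h1 : ‖(1 : B)‖ ≤ 1 := ContinuousLinearMap.norm_id_le
    have h2 : ‖φ 1‖ = 1 := by
      rw [hφ, map_one, one_apply_eq_self, inner_self_eq_norm_sq_to_K, hξ]
      simp
    exact h2.symm.le.trans ((φ.le_opNorm 1).trans (mul_le_of_le_one_right (norm_nonneg _) h1))

end GNS

/-! ### The biregular representation and the diagonal. -/

section Factorization

variable {G : Type u} [Group G]

variable (G) in
/-- The representation `(s, t) ↦ λ(s) ρ(t)` of `G × G`. -/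
noncomputable def biregular : G × G →* (lp (fun _ : G => ℂ) 2 →L[ℂ] lp (fun _ : G => ℂ) 2) where
  toFun g := UnitaryRep.op (leftRegular G) g.1 * UnitaryRep.op (rightRegular G) g.2
  map_one' := by ext f x; simp
  map_mul' g h := by
    ext f x
    simp [leftRegular, rightRegular, lpComp, mul_assoc]

theorem biregular_apply (g : G × G) : biregular G g
    = UnitaryRep.op (leftRegular G) g.1 * UnitaryRep.op (rightRegular G) g.2 := rfl

theorem biregular_apply_apply (g : G × G) (f : lp (fun _ : G => ℂ) 2) (x : G) :
    biregular G g f x = f (g.1⁻¹ * x * g.2) := rfl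

theorem star_biregular (g : G × G) : star (biregular G g) = biregular G g⁻¹ := by
  rw [biregular_apply, star_mul, UnitaryRep.star_op, UnitaryRep.star_op]
  ext f x
  change f (g.1⁻¹⁻¹ * (x * g.2⁻¹)) = f (g.1⁻¹⁻¹ * x * g.2⁻¹)
  rw [mul_assoc]

open Classical in
-- The link between the diagonal and factorization: λ(s)ρ(t) maps δ₁ to the point mass at st⁻¹.
theorem inner_biregular_single (s t : G) :
    ⟪lp.single 2 (1 : G) (1 : ℂ), biregular G (s, t) (lp.single 2 (1 : G) (1 : ℂ))⟫_ℂ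
      = if s = t then 1 else 0 := by
  rw [lp.inner_single_left, biregular_apply_apply, lp.single_apply]
  simp [Pi.single_apply, inv_mul_eq_one]

open Classical in
theorem denseRange_biregular_single : DenseRange fun c : G × G →₀ ℂ =>
    Finsupp.linearCombination ℂ (biregular G) c (lp.single 2 (1 : G) (1 : ℂ)) := by
  intro f
  have h := lp.hasSum_single (p := 2) (by simp) f
  refine mem_closure_of_tendsto h (Filter.Eventually.of_forall fun S => ?_)
  -- The left translations alone suffice: λ(s) maps δ₁ to the point mass at s.
  refine ⟨∑ s ∈ S, Finsupp.single (s, 1) (f s), ?_⟩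
  simp only [map_sum, Finsupp.linearCombination_single, sum_apply, smul_apply]
  refine Finset.sum_congr rfl fun s _ => ?_
  ext x
  simp only [lp.coeFn_smul, Pi.smul_apply, biregular_apply_apply, lp.single_apply, mul_one,
    Pi.single_apply, inv_mul_eq_one, smul_eq_mul]
  by_cases h : s = x
  · simp [h]
  · simp [h, Ne.symm h]

open Classical in
-- A bounded extension of 1_Δ is enough; neither positivity nor norm one has to be known. This is
-- why the functional supplied by amenability can be used directly.
theorem factorizationProperty_of_functional (φ : StrongDual ℂ (minSquare G))
    (hφ : ∀ s t, φ (minHom G (s, t)) = if s = t then 1 else 0) : FactorizationProperty G := by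
  obtain ⟨Φ, hΦ⟩ := exists_starAlgHom_of_functional (minHom G) (biregular G) star_minHom
    star_biregular denseRange_minHom φ (lp.single 2 (1 : G) (1 : ℂ))
    (fun g => (hφ g.1 g.2).trans (inner_biregular_single g.1 g.2).symm) denseRange_biregular_single
  exact ⟨Φ, fun s t => hΦ (s, t)⟩

open Classical in
theorem FactorizationProperty.diagonalExtendsToState (h : FactorizationProperty G) :
    DiagonalExtendsToState G := by
  obtain ⟨Φ, hΦ⟩ := h
  obtain ⟨φ, hs, hφ⟩ := exists_isState_of_starAlgHom Φ (lp.single 2 (1 : G) (1 : ℂ)) (by simp)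
  refine ⟨φ, hs, fun s t => (hφ _).trans ?_⟩
  rw [hΦ]
  exact inner_biregular_single s t

theorem DiagonalExtendsToState.factorizationProperty (h : DiagonalExtendsToState G) :
    FactorizationProperty G :=
  h.elim fun φ hφ => factorizationProperty_of_functional φ hφ.2

end Factorization

/-! ### Operator Connes-amenability implies the factorization property -/

section Main

variable {G : Type u} [Group G]

theorem eqOn_topologicalClosure_span {V E : Type*} [NormedAddCommGroup V] [NormedSpace ℂ V]
    [NormedAddCommGroup E] [NormedSpace ℂ E] {S : Set V} {f g : V →L[ℂ] E}
    (h : ∀ v ∈ S, f v = g v) : ∀ w ∈ (Submodule.span ℂ S).topologicalClosure, f w = g w := by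
  have h1 : Submodule.span ℂ S ≤ LinearMap.eqLocus f.toLinearMap g.toLinearMap :=
    Submodule.span_le.2 h
  exact fun w hw => (Submodule.topologicalClosure_minimal _ h1
    (isClosed_eq f.continuous g.continuous)) hw

theorem map_mem_topologicalClosure_span {V : Type*} [NormedAddCommGroup V] [NormedSpace ℂ V]
    {S : Set V} {f : V →L[ℂ] V} (h : ∀ v ∈ S, f v ∈ Submodule.span ℂ S) :
    ∀ w ∈ (Submodule.span ℂ S).topologicalClosure,
      f w ∈ (Submodule.span ℂ S).topologicalClosure := fun _ hw =>
  map_mem_closure f.continuous hw fun _ hv =>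
    (Submodule.span_le (p := (Submodule.span ℂ S).comap f.toLinearMap)).2 h hv

variable (G) in
/-- The trivial representation. -/
noncomputable def trivialCyclicRep : CyclicRep G where
  carrier := EuclideanSpace ℂ PUnit.{u + 1}
  rep := 1
  cyclic := by
    refine ⟨EuclideanSpace.single PUnit.unit 1, eq_top_iff.2 fun x _ => ?_⟩
    refine Submodule.le_topologicalClosure _ ?_
    have h : x = x PUnit.unit • (1 : UnitaryRep G (EuclideanSpace ℂ PUnit.{u + 1})) 1
        (EuclideanSpace.single PUnit.unit 1) := by
      ext i
      simp
    rw [h]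
    exact Submodule.smul_mem _ _ (Submodule.subset_span ⟨1, rfl⟩)

/-- The trivial representation of `G × G` extends to `C*(G) ⊗_min C*(G)`. -/
theorem exists_functional_eq_one :
    ∃ M : StrongDual ℂ (minSquare G), ∀ g, M (minHom G g) = 1 := by
  classical
  let e : lp (fun σ : CyclicRep G => σ.carrier) 2 :=
    lp.single 2 (trivialCyclicRep G) (EuclideanSpace.single PUnit.unit (1 : ℂ))
  -- The trivial representation is a summand of ϖ, so e is a unit vector fixed by every ϖ(s); the
  -- vector functional of e ⊗ e is then 1 at every ϖ(s) ⊗ ϖ(t).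
  have he : ∀ s, universalRep G s e = e := fun s => by
    ext σ : 2
    rw [universalRep_apply]
    by_cases h : σ = trivialCyclicRep G
    · subst h
      rfl
    · have : (e : ∀ σ : CyclicRep G, σ.carrier) σ = 0 := lp.single_apply_ne _ _ _ h
      rw [this, map_zero]
  have hn : ‖e‖ = 1 := by
    refine (lp.norm_single (by simp) _ _).trans ?_
    exact (PiLp.norm_single 2 _ _ _).trans norm_one
  let η := HilbertTensor.incl _ _ (e ⊗ₜ[ℂ] e)
  refine ⟨((innerSL ℂ η).comp (ContinuousLinearMap.apply ℂ _ η)).comp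
    (minSquare G).toSubalgebra.toSubmodule.subtypeL, fun g => ?_⟩
  change ⟪η, tensorHom G g η⟫_ℂ = 1
  have h1 : tensorHom G g η = η := by
    rw [tensorHom_apply, opTensor_tmul, UnitaryRep.op_apply, UnitaryRep.op_apply, he, he]
  rw [h1, LinearIsometry.inner_map_map, TensorProduct.inner_tmul, inner_self_eq_norm_sq_to_K, hn]
  simp

variable {A : Type v} [NonUnitalRing A] [Module ℂ A] [MatrixNorms A]

/-- The action of `A` on a space spanned by vectors `e g` which are joint eigenvectors. -/
def CommutingAction.ofEigenvectors {V : Type*} [NormedAddCommGroup V] [NormedSpace ℂ V]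
    [MatrixNorms V] {I : Type*} (e : I → V)
    (he : ∀ f g : V →L[ℂ] V, (∀ i, f (e i) = g (e i)) → f = g)
    (χ : A →ₗ[ℂ] I → ℂ) (hχ : ∀ a b, χ (a * b) = χ a * χ b)
    (T : A → V →L[ℂ] V) (hT : ∀ a i, T a (e i) = χ a i • e i)
    (hn : ∀ {ι κ : Type} [Fintype ι] [DecidableEq ι] [Fintype κ] [DecidableEq κ]
      (x : Matrix ι ι A) (v : Matrix κ κ V),
      matNorm (Matrix.of fun p q : ι × κ => T (x p.1 q.1) (v p.2 q.2)) ≤ matNorm x * matNorm v) :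
    CommutingAction A V where
  act :=
    { toFun := T
      map_add' := fun a b => he _ _ fun i => by simp [hT, add_smul]
      map_smul' := fun c a => he _ _ fun i => by simp [hT, mul_smul] }
  act_mul a b v := DFunLike.congr_fun (he (T (a * b)) ((T a).comp (T b)) fun i => by
    simp [hT, hχ, mul_smul, smul_comm (χ a i)]) v
  act_comm a b v := DFunLike.congr_fun (he ((T a).comp (T b)) ((T b).comp (T a)) fun i => by
    simp [hT, smul_comm (χ a i)]) v
  matNorm_act_le := hn

open Classical in
-- Both actions are diagonal in the vectors e, with eigenvalues χ a s and χ a t at e (s, t), and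
-- they coincide on the closed span of the e (s, s). A balanced functional extending `M₀` from there
-- is killed off the diagonal by the point masses.
theorem OperatorConnesAmenable.exists_diagonal {τ : TopologicalSpace A}
    {V : Type w} [NormedAddCommGroup V] [NormedSpace ℂ V] [CompleteSpace V] [MatrixNorms V]
    [IsOperatorSpace V] (hAm : OperatorConnesAmenable.{v, w} A τ)
    (hA : ∀ {ι : Type} [Fintype ι] [DecidableEq ι] (x : Matrix ι ι A), 0 ≤ matNorm x)
    {I : Type*} (e : I × I → V)
    (he : ∀ f g : V →L[ℂ] V, (∀ i, f (e i) = g (e i)) → f = g)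
    (χ : A →ₗ[ℂ] I → ℂ) (hχ : ∀ a b, χ (a * b) = χ a * χ b)
    (hδ : ∀ s, ∃ a, ∀ t, χ a t = if s = t then 1 else 0)
    (T : (I × I → I) → A → V →L[ℂ] V)
    (hT : ∀ pr : I × I → I, (pr = Prod.fst ∨ pr = Prod.snd) →
      ∀ a i, T pr a (e i) = χ a (pr i) • e i)
    (hn : ∀ pr : I × I → I, (pr = Prod.fst ∨ pr = Prod.snd) →
      ∀ {ι κ : Type} [Fintype ι] [DecidableEq ι] [Fintype κ] [DecidableEq κ]
      (x : Matrix ι ι A) (v : Matrix κ κ V),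
      matNorm (Matrix.of fun p q : ι × κ => T pr (x p.1 q.1) (v p.2 q.2))
        ≤ matNorm x * matNorm v)
    (hc : ∀ pr : I × I → I, (pr = Prod.fst ∨ pr = Prod.snd) → ∀ (ψ : StrongDual ℂ V) (v : V),
      Continuous[τ, inferInstance] fun a => ψ (T pr a v))
    (M₀ : StrongDual ℂ V) (hM₀ : ∀ i, M₀ (e i) = 1) :
    ∃ M : StrongDual ℂ V, ∀ s t, M (e (s, t)) = if s = t then 1 else 0 := by
  have h1 : (Prod.fst : I × I → I) = Prod.fst ∨ (Prod.fst : I × I → I) = Prod.snd := Or.inl rfl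
  have h2 : (Prod.snd : I × I → I) = Prod.fst ∨ (Prod.snd : I × I → I) = Prod.snd := Or.inr rfl
  let χ' : (I × I → I) → A →ₗ[ℂ] I × I → ℂ := fun pr =>
    (LinearMap.funLeft ℂ ℂ pr).comp χ
  have hχ' : ∀ pr a b, χ' pr (a * b) = χ' pr a * χ' pr b := fun pr a b => by
    ext i
    simp [χ', hχ]
  let L := CommutingAction.ofEigenvectors e he (χ' Prod.fst) (hχ' _)
    (T Prod.fst) (hT _ h1) (hn _ h1)
  let R := CommutingAction.ofEigenvectors e he (χ' Prod.snd) (hχ' _)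
    (T Prod.snd) (hT _ h2) (hn _ h2)
  have hLe : ∀ a i, L.act a (e i) = χ a i.1 • e i := hT _ h1
  have hRe : ∀ a i, R.act a (e i) = χ a i.2 • e i := hT _ h2
  let S : Set V := Set.range fun s => e (s, s)
  let W : Submodule ℂ V := (Submodule.span ℂ S).topologicalClosure
  have : IsClosed (W : Set V) := Submodule.isClosed_topologicalClosure _
  have hLR : ∀ a b v, L.act a (R.act b v) = R.act b (L.act a v) := fun a b v =>
    DFunLike.congr_fun (he ((L.act a).comp (R.act b)) ((R.act b).comp (L.act a)) fun i => by
      simp [hLe, hRe, smul_comm (χ a i.1)]) v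
  have hWL : ∀ a, ∀ w ∈ W, L.act a w ∈ W := fun a => map_mem_topologicalClosure_span (by
    rintro _ ⟨s, rfl⟩
    rw [hLe]
    exact Submodule.smul_mem _ _ (Submodule.subset_span ⟨s, rfl⟩))
  have heq : ∀ a, ∀ w ∈ W, L.act a w = R.act a w := fun a => eqOn_topologicalClosure_span (by
    rintro _ ⟨s, rfl⟩
    rw [hLe, hRe])
  obtain ⟨M, hM, hbal⟩ := hAm.exists_balanced hA L R hLR (hc _ h1) (hc _ h2) W hWL
    (fun a w hw => heq a w hw ▸ hWL a w hw) M₀ (fun a w hw => congrArg M₀ (heq a w hw))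
  refine ⟨M, fun s t => ?_⟩
  by_cases hst : s = t
  · subst hst
    rw [if_pos rfl, ← hM₀ (s, s)]
    exact hM _ (Submodule.le_topologicalClosure _ (Submodule.subset_span ⟨s, rfl⟩))
  -- For the point mass at s the left eigenvalue at e (s, t) is 1 and the right one is 0.
  · obtain ⟨a, ha⟩ := hδ s
    have h := hbal a (e (s, t))
    rw [hLe, hRe, ha, ha, if_pos rfl, if_neg hst, one_smul, zero_smul, map_zero] at h
    rw [h, if_neg hst]

variable (G) in
/-- The inclusion of `B(G)` into the functions on `G`. -/
def fsVal : fourierStieltjes G →ₗ[ℂ] G → ℂ := (fourierStieltjes G).toSubmodule.subtype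

set_option maxHeartbeats 1000000 in
open Classical in
-- The map j treats subalgebras of B(G) and B(G) itself at once. The predual lives in universe `u +
-- 1` because the universal representation is a sum over all cyclic representations on spaces in
-- `Type u`.
theorem OperatorConnesAmenable.factorizationProperty {τ : TopologicalSpace A}
    (hAm : OperatorConnesAmenable.{v, u + 1} A τ)
    (j : A →ₗ[ℂ] fourierStieltjes G) (hj : ∀ a b, j (a * b) = j a * j b)
    (hn : ∀ {ι : Type} [Fintype ι] [DecidableEq ι] (x : Matrix ι ι A),
      matNorm x = matNorm (x.map j))
    (hτ : Continuous[τ, fsWeakStar G] j)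
    (hδ : ∀ s, ∃ a, ∀ t, (j a : G → ℂ) t = if s = t then 1 else 0) :
    FactorizationProperty G := by
  have hA : ∀ {ι : Type} [Fintype ι] [DecidableEq ι] (x : Matrix ι ι A), 0 ≤ matNorm x :=
    fun x => (dual_matNorm_nonneg ((x.map j).map fsToDual)).trans_eq (hn x).symm
  obtain ⟨M₀, hM₀⟩ := exists_functional_eq_one (G := G)
  obtain ⟨M, hM⟩ := hAm.exists_diagonal hA (minHom G) (fun _ _ h => minSquare_clm_ext h)
    ((fsVal G).comp j) (fun a b => congrArg (fsVal G) (hj a b)) hδ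
    (fun pr a => minAct pr (j a)) (fun pr hpr a i => minAct_minHom hpr (j a) i)
    (fun pr hpr ι κ _ _ _ _ x v => (matNorm_minAct_le hpr (x.map j) v).trans_eq
      (congrArg (fun r => r * matNorm v) (hn x).symm))
    (fun pr hpr ψ v => @Continuous.comp _ _ _ τ (fsWeakStar G) _ _ _
      (continuous_functional_minAct hpr ψ v) hτ) M₀ hM₀
  exact factorizationProperty_of_functional M hM

open Classical in
/-- The indicator function of `{s}` as a coefficient of the left regular representation. -/
theorem coeff_leftRegular_single (s : G) :
    UnitaryRep.coeff (leftRegular G) (lp.single 2 (1 : G) (1 : ℂ)) (lp.single 2 s (1 : ℂ))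
      = fun t => if s = t then 1 else 0 := by
  funext t
  have h : (leftRegular G t (lp.single 2 (1 : G) (1 : ℂ)) : G → ℂ) s
      = (lp.single 2 (1 : G) (1 : ℂ) : lp (fun _ : G => ℂ) 2) (t⁻¹ * s) := rfl
  rw [UnitaryRep.coeff, lp.inner_single_left, h, lp.single_apply]
  simp [Pi.single_apply, inv_mul_eq_one, eq_comm]

theorem mem_fourierAlgebra_of_coeff {f : fourierStieltjes G} {ξ η : lp (fun _ : G => ℂ) 2}
    (h : (f : G → ℂ) = UnitaryRep.coeff (leftRegular G) ξ η) : f ∈ fourierAlgebra G := by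
  refine fun ε hε => ⟨f, Submodule.subset_span ⟨ξ, η, h⟩, lt_of_le_of_lt ?_ hε⟩
  -- f approximates itself, and f - f = 0 is the coefficient of the zero vectors, so its norm is at
  -- most 0.
  refine csInf_le ⟨0, ?_⟩ ⟨lp (fun _ : G => ℂ) 2, inferInstance, inferInstance, inferInstance,
    leftRegular G, 0, 0, ?_, by simp⟩
  · rintro _ ⟨H, _, _, _, π, x, y, _, rfl⟩
    positivity
  · funext s
    simp [UnitaryRep.coeff]

open Classical in
-- Point masses are the only elements of A(G) needed: they separate the two legs at off-diagonal
-- pairs.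
theorem exists_fourierAlgebra_eq_single (s : G) :
    ∃ f ∈ fourierAlgebra G, ∀ t, (f : G → ℂ) t = if s = t then 1 else 0 :=
  ⟨⟨UnitaryRep.coeff (leftRegular G) (lp.single 2 (1 : G) (1 : ℂ)) (lp.single 2 s (1 : ℂ)), _,
    lp (fun _ : G => ℂ) 2, inferInstance, inferInstance, inferInstance, leftRegular G, _, _, rfl,
    rfl⟩, mem_fourierAlgebra_of_coeff rfl, fun t => congrFun (coeff_leftRegular_single s) t⟩

end Main

theorem theorem4p2 {G : Type u} [Group G] :
    (∀ B : NonUnitalSubalgebra ℂ (fourierStieltjes G),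
      IsClosed[fsWeakStar G] (B : Set (fourierStieltjes G)) →
      fourierAlgebra G ⊆ (B : Set (fourierStieltjes G)) →
      OperatorConnesAmenable.{u, u + 1} B (fsSubWeakStar B) →
      FactorizationProperty G) ∧
    (FactorizationProperty G ↔ DiagonalExtendsToState G) ∧
    (¬ FactorizationProperty G →
      ¬ OperatorConnesAmenable.{u, u + 1} (fourierStieltjes G) (fsWeakStar G)) := by
  classical
  refine ⟨fun B _ hB hAm => ?_, ⟨fun h => h.diagonalExtendsToState,
    fun h => h.factorizationProperty⟩, fun h hAm => h ?_⟩
  · refine hAm.factorizationProperty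
      { toFun := fun b => (b : fourierStieltjes G), map_add' := fun _ _ => rfl,
        map_smul' := fun _ _ => rfl } (fun _ _ => rfl) (fun _ => rfl) continuous_induced_dom
      fun s => ?_
    obtain ⟨f, hf, hs⟩ := exists_fourierAlgebra_eq_single s
    exact ⟨⟨f, hB hf⟩, hs⟩
  -- B(G) carries its own matrix norms and topology, so j is the identity and no passage through the
  -- subalgebra `⊤` is needed.
  · refine hAm.factorizationProperty LinearMap.id (fun _ _ => rfl) (fun _ => rfl)
      (@continuous_id _ (fsWeakStar G)) fun s => ?_
    obtain ⟨f, _, hs⟩ := exists_fourierAlgebra_eq_single s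
    exact ⟨f, hs⟩
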